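/- Let $0\le\rho_x,\rho_y<1$ and $-1\le\rho_{xy}\le 1$ satisfy $2\rho_x^2(1+2|\rho_{xy}|)<1$, $2\rho_y^2(1+2|\rho_{xy}|)<1$ and $2\rho_x\rho_y(3\rho_{xy}^2+2|\rho_{xy}|+1)<1$. Let $\mu_x,\mu_y\in\mathbb R$, $T>0$, let $W^1,W^2$ be independent standard Brownian motions, $M^x=W^1$, $M^y=\rho_{xy}W^1+\sqrt{1-\rho_{xy}^2}\,W^2$, and consider on $\mathbb R^2$, for $0<t\le T$, $$\mathrm dv=-\mu_x v_x\,\mathrm dt-\mu_y v_y\,\mathrm dt+\tfrac12\big(v_{xx}+2\sqrt{\rho_x\rho_y}\,\rho_{xy}v_{xy}+v_{yy}\big)\mathrm dt-\sqrt{\rho_x}\,v_x\,\mathrm dM^x_t-\sqrt{\rho_y}\,v_y\,\mathrm dM^y_t .$$ For the Dirac initial datum $\delta(x-x_0)\delta(y-y_0)$ its solution is $$v(t,x,y)=\Gamma_t(x,y;x_0,y_0)=\frac{\exp\Big(-\frac{(x-x_0-\mu_xt-\sqrt{\rho_x}M^x_t)^2}{2(1-\rho_x)t}-\frac{(y-y_0-\mu_yt-\sqrt{\rho_y}M^y_t)^2}{2(1-\rho_y)t}\Big)}{2\pi\sqrt{(1-\rho_x)(1-\rho_y)}\,t},$$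 and for a real initial datum $v_0\in L_2(\mathbb R^2)$ it is $v(t,x,y)=\iint v_0(x',y')\,\Gamma_t(x,y;x',y')\,\mathrm dx'\,\mathrm dy'$. For an integer $N\ge1$, $k=T/N$ and mesh sizes $h_x,h_y>0$ let $Z_{n,x}=(M^x_{(n+1)k}-M^x_{nk})/\sqrt k$, $\widetilde Z_{n,y}=(M^y_{(n+1)k}-M^y_{nk})/\sqrt k$, and let the square-summable grid functions $V^n=(V^n_{i,j})_{i,j\in\mathbb Z}$, $0\le n\le N$, be given by the implicit Milstein scheme $$\Big(I+\tfrac{\mu_xk}{2h_x}D_x+\tfrac{\mu_yk}{2h_y}D_y-\tfrac{k}{2h_x^2}D_{xx}-\tfrac{k}{2h_y^2}D_{yy}\Big)V^{n+1}=\Big(I-\tfrac{\sqrt{\rho_xk}Z_{n,x}}{2h_x}D_x-\tfrac{\sqrt{\rho_yk}\widetilde Z_{n,y}}{2h_y}D_y+\tfrac{\rho_xk(Z_{n,x}^2-1)}{8h_x^2}D_x^2+\tfrac{\rho_yk(\widetilde Z_{n,y}^2-1)}{8h_y^2}D_y^2+\tfrac{\sqrt{\rho_x\rho_y}\,kZ_{n,x}\widetilde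 Z_{n,y}}{4h_xh_y}D_{xy}\Big)V^n,$$ where $(D_xV)_{i,j}=V_{i+1,j}-V_{i-1,j}$, $(D_{xx}V)_{i,j}=V_{i+1,j}-2V_{i,j}+V_{i-1,j}$, $D_y,D_{yy}$ are the same in the index $j$, and $(D_{xy}V)_{i,j}=V_{i+1,j+1}-V_{i-1,j+1}-V_{i+1,j-1}+V_{i-1,j-1}$. The initial values are as follows. For the Dirac datum, $h_x,h_y$ are such that $x_0=i_0h_x$, $y_0=j_0h_y$ with $i_0,j_0\in\mathbb Z$, and $V^0_{i,j}=h_x^{-1}h_y^{-1}$ if $(i,j)=(i_0,j_0)$ and $V^0_{i,j}=0$ otherwise. For $v_0\in L_2(\mathbb R^2)$ with Fourier transform $\widetilde v_0(\xi,\eta)=\iint v_0(x,y)e^{-\mathrm i\xi x-\mathrm i\eta y}\,\mathrm dx\,\mathrm dy$ (in the $L_2$ sense), $$V^0_{i,j}=\frac1{4\pi^2}\int_{-\pi/h_y}^{\pi/h_y}\int_{-\pi/h_x}^{\pi/h_x}\widetilde v_0(\xi,\eta)\,e^{\mathrm i(ih_x\xi+jh_y\eta)}\,\mathrm d\xi\,\mathrm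 d\eta .$$ (a) There is $\theta\in(0,1)$, depending only on $\rho_x,\rho_y,\rho_{xy}$, such that for all $\mu_x,\mu_y$, $T>0$ and $x_0,y_0$ there is a constant $C$ such that, for the Dirac initial datum and all $N\ge1$ and $h_x,h_y>0$ with $x_0/h_x,y_0/h_y\in\mathbb Z$, $$\sqrt{\sum_{i,j\in\mathbb Z}\mathbb E\Big[\big|V^N_{i,j}-v(T,ih_x,jh_y)\big|^2\Big]h_xh_y}\;\le\; C\big(h_x^2+h_y^2+k+\theta^Nh_x^{-1/2}h_y^{-1/2}\big).$$ (b) For all $\mu_x,\mu_y$, $T>0$ and $v_0\in L_2(\mathbb R^2)$ there is a constant $C$ such that, for the initial datum $v_0$ and all $N\ge1$ and $h_x,h_y>0$, $$\sqrt{\sum_{i,j\in\mathbb Z}\mathbb E\Big[\big|V^N_{i,j}-v(T,ih_x,jh_y)\big|^2\Big]h_xh_y}\;\le\; C\big(h_x^2+h_y^2+k\big).$$ -/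

import Mathlib

open MeasureTheory ProbabilityTheory
open scoped NNReal ENNReal

noncomputable section

namespace ZakaiMilstein

/-- The correlation parameters `ρ_x, ρ_y, ρ_xy` of the equation
`dv = -μ_x v_x dt - μ_y v_y dt + ½ (v_xx + 2 √(ρ_x ρ_y) ρ_xy v_xy + v_yy) dt
  - √ρ_x v_x dM^x - √ρ_y v_y dM^y`
on `ℝ²`, where `M^x, M^y` are Brownian motions with correlation `ρ_xy`. -/
structure Corr where
  ρx : ℝ
  ρy : ℝ
  ρxy : ℝ

/-- The standing assumption on the correlation parameters. -/
structure Corr.Stable (r : Corr) : Prop where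
  ρx_nonneg : 0 ≤ r.ρx
  ρx_lt_one : r.ρx < 1
  ρy_nonneg : 0 ≤ r.ρy
  ρy_lt_one : r.ρy < 1
  neg_one_le : -1 ≤ r.ρxy
  le_one : r.ρxy ≤ 1
  stable_x : 2 * r.ρx ^ 2 * (1 + 2 * |r.ρxy|) < 1
  stable_y : 2 * r.ρy ^ 2 * (1 + 2 * |r.ρxy|) < 1
  stable_xy : 2 * r.ρx * r.ρy * (3 * r.ρxy ^ 2 + 2 * |r.ρxy| + 1) < 1

/-! ### The driving noise -/

section Noise

variable {Ω : Type*} [MeasurableSpace Ω]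

/-- `W₁, W₂` are independent standard Brownian motions. The noise of the equation is
`M^x = W₁`, `M^y = ρ_xy W₁ + √(1 - ρ_xy²) W₂`. -/
structure IsBrownianPair (W₁ W₂ : ℝ≥0 → Ω → ℝ) (P : Measure Ω) : Prop where
  fst : IsBrownianReal W₁ P
  snd : IsBrownianReal W₂ P
  indep : IndepFun (fun ω t => W₁ t ω) (fun ω t => W₂ t ω) P

/-- `M^y = ρ_xy W₁ + √(1 - ρ_xy²) W₂`. -/
def noiseY (r : Corr) (W₁ W₂ : ℝ≥0 → Ω → ℝ) (t : ℝ≥0) (ω : Ω) : ℝ :=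
  r.ρxy * W₁ t ω + √(1 - r.ρxy ^ 2) * W₂ t ω

/-- The `n`-th point `n k` of the time grid with step `k = T / N`. -/
def gridTime (T : ℝ≥0) (N n : ℕ) : ℝ≥0 := n * (T / N)

/-- The increment of `M` over the `n`-th time step, divided by `√k`. For `M = M^x` this is
`Z_{n,x}`, for `M = M^y` it is `Z̃_{n,y} = ρ_xy Z_{n,x} + √(1 - ρ_xy²) Z_{n,y}`. -/
def normIncr (T : ℝ≥0) (N : ℕ) (M : ℝ≥0 → Ω → ℝ) (n : ℕ) (ω : Ω) : ℝ :=
  (M (gridTime T N (n + 1)) ω - M (gridTime T N n) ω) / √((T : ℝ) / N)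

end Noise

/-! ### Exact solutions -/

/-- The solution at time `t > 0` and at the point `(x, y)`, for the Dirac initial datum at
`(x₀, y₀)`; here `m₁, m₂` are the values of `M^x, M^y` at time `t`. -/
def diracSolution (r : Corr) (μx μy t m₁ m₂ x₀ y₀ x y : ℝ) : ℝ :=
  Real.exp (-((x - x₀ - μx * t - √r.ρx * m₁) ^ 2 / (2 * (1 - r.ρx) * t))
      - (y - y₀ - μy * t - √r.ρy * m₂) ^ 2 / (2 * (1 - r.ρy) * t))
    / (2 * Real.pi * √((1 - r.ρx) * (1 - r.ρy)) * t)

/-- The solution at time `t > 0` for an initial datum `v₀ ∈ L²(ℝ²)`: the superposition of the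
solutions for the Dirac data at the points `z`, with weights `v₀ z`. Its spatial Fourier transform
is that of `v₀` times
`exp (-½(1-ρ_x) ξ² t - ½(1-ρ_y) η² t - i μ_x ξ t - i μ_y η t - i ξ √ρ_x M^x_t - i η √ρ_y M^y_t)`. -/
def l2Solution (r : Corr) (μx μy t m₁ m₂ : ℝ) (v₀ : EuclideanSpace ℝ (Fin 2) → ℝ) (x y : ℝ) : ℝ :=
  ∫ z, v₀ z * diracSolution r μx μy t m₁ m₂ (z 0) (z 1) x y

/-! ### The finite difference scheme -/

/-- Real functions on the index grid `ℤ × ℤ`. -/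
abbrev Grid := ℤ → ℤ → ℝ

def Dx (V : Grid) : Grid := fun i j => V (i + 1) j - V (i - 1) j

def Dy (V : Grid) : Grid := fun i j => V i (j + 1) - V i (j - 1)

def Dxx (V : Grid) : Grid := fun i j => V (i + 1) j - 2 * V i j + V (i - 1) j

def Dyy (V : Grid) : Grid := fun i j => V i (j + 1) - 2 * V i j + V i (j - 1)

def Dxy (V : Grid) : Grid := fun i j =>
  V (i + 1) (j + 1) - V (i - 1) (j + 1) - V (i + 1) (j - 1) + V (i - 1) (j - 1)

/-- The operator on the left-hand side (implicit part) of the scheme. -/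
def implicitOp (μx μy k hx hy : ℝ) (V : Grid) : Grid :=
  V + (μx * k / (2 * hx)) • Dx V + (μy * k / (2 * hy)) • Dy V
    - (k / (2 * hx ^ 2)) • Dxx V - (k / (2 * hy ^ 2)) • Dyy V

/-- The operator on the right-hand side (explicit part) of the scheme; `zx, zy` are the values of
the normalised increments `Z_{n,x}` and `Z̃_{n,y}`. -/
def explicitOp (r : Corr) (k hx hy zx zy : ℝ) (V : Grid) : Grid :=
  V - (√(r.ρx * k) * zx / (2 * hx)) • Dx V - (√(r.ρy * k) * zy / (2 * hy)) • Dy V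
    + (r.ρx * k * (zx ^ 2 - 1) / (8 * hx ^ 2)) • Dx (Dx V)
    + (r.ρy * k * (zy ^ 2 - 1) / (8 * hy ^ 2)) • Dy (Dy V)
    + (√(r.ρx * r.ρy) * k * zx * zy / (4 * hx * hy)) • Dxy V

/-- `V n`, `n ≤ N`, are the iterates of the implicit Milstein finite difference scheme with time
step `k = T / N`, mesh sizes `hx, hy` and initial grid function `V₀`. The infinite linear system
of each step is solved in the space of square summable grid functions, where its solution is
unique. -/
structure IsMilsteinScheme {Ω : Type*} [MeasurableSpace Ω] (r : Corr) (μx μy : ℝ) (T : ℝ≥0)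
    (W₁ W₂ : ℝ≥0 → Ω → ℝ) (N : ℕ) (hx hy : ℝ) (V₀ : Grid) (V : ℕ → Ω → Grid) : Prop where
  init : ∀ ω, V 0 ω = V₀
  step : ∀ n < N, ∀ ω,
    implicitOp μx μy ((T : ℝ) / N) hx hy (V (n + 1) ω) =
      explicitOp r ((T : ℝ) / N) hx hy (normIncr T N W₁ n ω)
        (normIncr T N (noiseY r W₁ W₂) n ω) (V n ω)
  sq_summable : ∀ n ≤ N, ∀ ω, Summable fun p : ℤ × ℤ => V n ω p.1 p.2 ^ 2

/-- The discretisation of the Dirac datum at the grid point with index `(i₀, j₀)`. -/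
def diracData (hx hy : ℝ) (i₀ j₀ : ℤ) : Grid := fun i j =>
  if i = i₀ ∧ j = j₀ then hx⁻¹ * hy⁻¹ else 0

open scoped FourierTransform in
/-- The discretisation of an initial datum `v₀ ∈ L²(ℝ²)`. With `ṽ₀` the Fourier-Plancherel
transform of `v₀`,
`V⁰_{i,j} = (4π²)⁻¹ ∬_{|ξ| ≤ π/h_x, |η| ≤ π/h_y} ṽ₀(ξ,η) exp (i (ξ i h_x + η j h_y)) dξ dη`,
that is, the discrete Fourier transform of `V⁰` is the restriction of `ṽ₀`. Written here with
Mathlib's frequency variable `w = (ξ, η) / 2π`. The integral is real because `v₀` is. -/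
def l2Data (hx hy : ℝ) (v₀ : EuclideanSpace ℝ (Fin 2) → ℝ)
    (hv₀ : MemLp v₀ 2 volume) : Grid := fun i j =>
  (∫ w in {w : EuclideanSpace ℝ (Fin 2) | |w 0| ≤ 1 / (2 * hx) ∧ |w 1| ≤ 1 / (2 * hy)},
    (𝓕 ((hv₀.ofReal (K := ℂ)).toLp (fun z => (v₀ z : ℂ))) :
      Lp (α := EuclideanSpace ℝ (Fin 2)) ℂ 2 volume) w *
      Complex.exp (2 * Real.pi * Complex.I * (i * hx * w 0 + j * hy * w 1))).re

/-! ### The error -/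

/-- The `L²` distance in space and in probability,
`(∑_{i,j} 𝔼[|U_{i,j} - u(i h_x, j h_y)|²] h_x h_y)^{1/2}`, as an element of `[0, ∞]`. -/
def l2Error {Ω : Type*} [MeasurableSpace Ω] (P : Measure Ω) (hx hy : ℝ)
    (U : Ω → Grid) (u : Ω → ℝ → ℝ → ℝ) : ℝ≥0∞ :=
  (∑' p : ℤ × ℤ,
    (∫⁻ ω, ENNReal.ofReal (|U ω p.1 p.2 - u ω (p.1 * hx) (p.2 * hy)| ^ 2) ∂P) *
      ENNReal.ofReal (hx * hy)) ^ (1 / 2 : ℝ)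

end ZakaiMilstein

end

noncomputable section

namespace ZakaiMilstein

open Complex ComplexConjugate

/-! ### Gaussian moments -/

/-! Everything happens at a fixed frequency `(ξ, η)`. There one step of the scheme is multiplication
by the random number `X = (1 + q/2 - s²/2 - i s) / (1 + L)`. Here `s = u Z + w Z̃` is a centred
Gaussian, `q = u² + w²`, `u, w` are the noise symbols and `L` is the symbol of drift and diffusion.
The equation with the same discretised symbols would multiply by `E = exp (q/2 - i s - L)`. The
product of `N` factors `E` depends on the noise only through its terminal value, so it differs from
the true multiplier by the spatial error `O(hx² + hy²)` alone (`norm_discExact_sub_exactMult_le`).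
What remains is to compare the products of the `X` and of the `E`.

Put `A = Re L`. The stability assumption says exactly that `𝔼|X|² ≤ (1 + κ B) / (1 + B)` with `B =
2A + A²` and some `κ < 1`. For `A ≤ 1` this is at most `exp (-(1-κ)A/2)`, and `N` steps reproduce
Gaussian decay in the frequency (`growth_le_exp`). For `A ≥ 1` it is at most `(1 + 3κ)/4 < 1`
(`growth_le_const`), a contraction with no decay in the frequency.

For `A ≤ 1`, write `r` for the size of one step, that is `k (1 + ξ² + η²)` up to a constant. Then
`𝔼|X - E|² = O(r³)`, while the correlations of `X - E` with `X` and with `E` are `O(r²)`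
(`exists_step_consistency`). By independence the second moment of the difference of the products is
a combination of `N`-th powers of three second moments. An induction bounds it by the decay factor
times `N r³ + N² r⁴` (`integral_normSq_prod_sub_prod_le`), which is of order `k²` times a polynomial
in the frequency. The Gaussian decay absorbs that polynomial. For `A ≥ 1` the two multipliers are
estimated separately: the exact one is negligible because `k (ξ² + η²)` is bounded below, and the
scheme contributes `((1 + 3κ)/4)^N`. Together this is `exists_mult_error`.

Return to physical space is by Fourier integrals. The iterates are integrals over the box `|ξ| hx ≤
π`, `|η| hy ≤ π` (`IsMilsteinScheme.eq_synth`, which rests on uniqueness of the implicit step in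
`ℓ²`), and the solutions are integrals over the whole plane. Bessel's inequality turns the error on
the box into an integral of `|φ|²` times the multiplier error, `φ` being the transform of the datum.
Frequencies outside the box alias onto the grid; Bessel on each translated box and the Gaussian
decay of the exact multiplier give `O(hx² + hy²)` (`exists_alias_le`).

The two data differ only in the non-decaying term, which is integrated against `|φ|²` over the box.
For Dirac data `|φ| = 1` and this gives `1/(hx hy)`, whence the extra term of the estimate. For `L²`
data the integral is bounded and `((1 + 3κ)/4)^N = O(N⁻²)` is absorbed in `k²`. -/

lemma integrable_pow_gaussianReal (v : ℝ≥0) (n : ℕ) :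
    Integrable (fun s : ℝ => s ^ n) (gaussianReal 0 v) := by
  have h := (memLp_id_gaussianReal (μ := 0) (v := v) n).integrable_norm_pow'
  refine h.mono' (by fun_prop) (Filter.Eventually.of_forall fun s => ?_)
  simp

/-- The derivatives at `0` of the moment generating function are the Gaussian moments. Each
derivative is a polynomial `P` times the exponential, and `key` is the rule `P ↦ P' + v t P`. The
sixth moment enters through the square of the cubic Taylor remainder of one step. -/
lemma iteratedDeriv_exp_sq (v : ℝ) :
    iteratedDeriv 2 (fun t : ℝ => Real.exp (v * t ^ 2 / 2)) 0 = v ∧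
    iteratedDeriv 4 (fun t : ℝ => Real.exp (v * t ^ 2 / 2)) 0 = 3 * v ^ 2 ∧
    iteratedDeriv 6 (fun t : ℝ => Real.exp (v * t ^ 2 / 2)) 0 = 15 * v ^ 3 := by
  have key : ∀ (P P' : ℝ → ℝ), (∀ t, HasDerivAt P (P' t) t) →
      deriv (fun t => P t * Real.exp (v * t ^ 2 / 2)) =
        fun t => (P' t + v * t * P t) * Real.exp (v * t ^ 2 / 2) := by
    intro P P' hP
    ext t
    have h1 : HasDerivAt (fun t : ℝ => v * t ^ 2 / 2) (v * t) t := by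
      have := ((hasDerivAt_pow 2 t).const_mul v).div_const 2
      exact this.congr_deriv (by push_cast; ring)
    have := (hP t).fun_mul h1.exp
    rw [this.deriv]; ring
  have d1 : iteratedDeriv 1 (fun t : ℝ => Real.exp (v * t ^ 2 / 2)) =
      fun t => (v * t) * Real.exp (v * t ^ 2 / 2) := by
    rw [iteratedDeriv_one]
    have := key (fun _ => 1) (fun _ => 0) (fun t => hasDerivAt_const t 1)
    simpa using this
  have poly : ∀ (a b c d t : ℝ) , HasDerivAt (fun t : ℝ => a + b * t + c * t ^ 2 + d * t ^ 3)
      (b + 2 * c * t + 3 * d * t ^ 2) t := by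
    intro a b c d t
    have := (((hasDerivAt_id t).const_mul b).const_add a).add
      ((hasDerivAt_pow 2 t).const_mul c) |>.add ((hasDerivAt_pow 3 t).const_mul d)
    exact (HasDerivAt.congr_deriv this (by push_cast; ring))
  have poly5 : ∀ (a b c d e f t : ℝ) , HasDerivAt
      (fun t : ℝ => a + b * t + c * t ^ 2 + d * t ^ 3 + e * t ^ 4 + f * t ^ 5)
      (b + 2 * c * t + 3 * d * t ^ 2 + 4 * e * t ^ 3 + 5 * f * t ^ 4) t := by
    intro a b c d e f t
    have := ((poly a b c d t).add ((hasDerivAt_pow 4 t).const_mul e)).add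
      ((hasDerivAt_pow 5 t).const_mul f)
    exact (HasDerivAt.congr_deriv this (by push_cast; ring))
  have d2 : iteratedDeriv 2 (fun t : ℝ => Real.exp (v * t ^ 2 / 2)) =
      fun t => (v + v ^ 2 * t ^ 2) * Real.exp (v * t ^ 2 / 2) := by
    rw [iteratedDeriv_succ, d1, key _ _ (fun t => by simpa using poly 0 v 0 0 t)]
    ext t; ring
  have d3 : iteratedDeriv 3 (fun t : ℝ => Real.exp (v * t ^ 2 / 2)) =
      fun t => (3 * v ^ 2 * t + v ^ 3 * t ^ 3) * Real.exp (v * t ^ 2 / 2) := by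
    rw [iteratedDeriv_succ, d2, key _ _ (fun t => by simpa using poly v 0 (v ^ 2) 0 t)]
    ext t; ring
  have d4 : iteratedDeriv 4 (fun t : ℝ => Real.exp (v * t ^ 2 / 2)) =
      fun t => (3 * v ^ 2 + 6 * v ^ 3 * t ^ 2 + v ^ 4 * t ^ 4) * Real.exp (v * t ^ 2 / 2) := by
    rw [iteratedDeriv_succ, d3, key _ _ (fun t => by simpa using poly 0 (3 * v ^ 2) 0 (v ^ 3) t)]
    ext t; ring
  have d5 : iteratedDeriv 5 (fun t : ℝ => Real.exp (v * t ^ 2 / 2)) =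
      fun t => (15 * v ^ 3 * t + 10 * v ^ 4 * t ^ 3 + v ^ 5 * t ^ 5) *
        Real.exp (v * t ^ 2 / 2) := by
    rw [iteratedDeriv_succ, d4,
      key _ _ (fun t => by simpa using poly5 (3 * v ^ 2) 0 (6 * v ^ 3) 0 (v ^ 4) 0 t)]
    ext t; ring
  have d6 : iteratedDeriv 6 (fun t : ℝ => Real.exp (v * t ^ 2 / 2)) =
      fun t => (15 * v ^ 3 + 45 * v ^ 4 * t ^ 2 + 15 * v ^ 5 * t ^ 4 + v ^ 6 * t ^ 6) *
        Real.exp (v * t ^ 2 / 2) := by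
    rw [iteratedDeriv_succ, d5,
      key _ _ (fun t => by simpa using poly5 0 (15 * v ^ 3) 0 (10 * v ^ 4) 0 (v ^ 5) t)]
    ext t; ring
  refine ⟨by rw [d2]; simp, by rw [d4]; simp, by rw [d6]; simp⟩

lemma integral_even_pow_gaussianReal (v : ℝ≥0) :
    ∫ s, s ^ 2 ∂gaussianReal 0 v = v ∧ ∫ s, s ^ 4 ∂gaussianReal 0 v = 3 * v ^ 2 ∧
      ∫ s, s ^ 6 ∂gaussianReal 0 v = 15 * v ^ 3 := by
  have h : ∀ n, ∫ s, s ^ n ∂gaussianReal 0 v =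
      iteratedDeriv n (fun t : ℝ => Real.exp (v * t ^ 2 / 2)) 0 := by
    intro n
    have h1 := iteratedDeriv_mgf_zero (μ := gaussianReal 0 v) (X := fun x => x)
      (by simp) n
    rw [mgf_fun_id_gaussianReal] at h1
    simp only [zero_mul, zero_add] at h1
    rw [h1]; rfl
  obtain ⟨h2, h4, h6⟩ := iteratedDeriv_exp_sq v
  exact ⟨(h 2).trans h2, (h 4).trans h4, (h 6).trans h6⟩

lemma integral_cexp_neg_I_mul_gaussianReal (v : ℝ≥0) :
    ∫ s, cexp (-(I * (s : ℂ))) ∂gaussianReal 0 v = cexp (-(v / 2 : ℂ)) := by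
  have := charFun_gaussianReal (μ := 0) (v := v) (-1)
  rw [charFun_apply_real] at this
  simp only [ofReal_neg, ofReal_one, ofReal_zero, mul_zero, zero_mul] at this
  convert this using 1
  · congr 1; ext s; ring_nf
  · ring_nf

/-! ### One step of the scheme, at a fixed frequency -/

/-- The symbol of the explicit part of the scheme. -/
def stepNum (q s : ℝ) : ℂ := 1 + q / 2 - s ^ 2 / 2 - I * s

/-- The multiplier of one step of the scheme. -/
def stepApprox (q : ℝ) (L : ℂ) (s : ℝ) : ℂ := stepNum q s / (1 + L)

/-- The multiplier of one exact step of the equation with the discretised symbols. -/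
def stepExact (q : ℝ) (L : ℂ) (s : ℝ) : ℂ := cexp (q / 2 - I * s - L)

/-- Gaussian increments are unbounded, so the Taylor bound must hold for every real `s`. For `|s| ≤
1` it is the exponential remainder; for `|s| > 1` every term is dominated by `|s|³`. -/
lemma norm_exp_neg_I_mul_sub_le (s : ℝ) :
    ‖cexp (-(I * s)) - (1 - I * s - s ^ 2 / 2)‖ ≤ 4 * |s| ^ 3 := by
  have hn : ‖-(I * (s : ℂ))‖ = |s| := by simp
  rcases le_or_gt |s| 1 with h | h
  · have h1 := norm_exp_sub_sum_le_norm_mul_exp (-(I * (s : ℂ))) 3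
    rw [hn] at h1
    have h2 : Real.exp |s| ≤ 4 := by
      calc Real.exp |s| ≤ Real.exp 1 := Real.exp_le_exp.2 h
        _ ≤ 4 := by have := Real.exp_one_lt_d9; linarith
    have h3 : (1 - I * s - s ^ 2 / 2 : ℂ) =
        ∑ m ∈ Finset.range 3, (-(I * (s : ℂ))) ^ m / (m.factorial : ℂ) := by
      simp [Finset.sum_range_succ, mul_pow, Nat.factorial]; ring
    rw [h3]
    refine h1.trans ?_
    have : 0 ≤ |s| ^ 3 := by positivity
    nlinarith
  · have h1 : ‖cexp (-(I * s))‖ = 1 := by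
      rw [Complex.norm_exp]; simp
    have h2 : ‖(1 - I * s - s ^ 2 / 2 : ℂ)‖ ≤ 1 + |s| + |s| ^ 2 / 2 := by
      refine (norm_sub_le _ _).trans ?_
      refine add_le_add ((norm_sub_le _ _).trans ?_) ?_ <;> simp
    have h3 := norm_sub_le (cexp (-(I * s))) (1 - I * s - s ^ 2 / 2)
    have h4 : |s| ≤ |s| ^ 3 := by nlinarith [mul_pos (sub_pos.2 h) (sub_pos.2 h)]
    have h5 : |s| ^ 2 ≤ |s| ^ 3 := by nlinarith [sq_nonneg |s|]
    linarith

lemma one_le_norm_one_add {L : ℂ} (hL : 0 ≤ L.re) : 1 ≤ ‖1 + L‖ := by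
  have := Complex.re_le_norm (1 + L)
  simp at this; linarith

lemma norm_inv_one_add_le {L : ℂ} (hL : 0 ≤ L.re) : ‖(1 + L)⁻¹‖ ≤ 1 := by
  rw [norm_inv]; exact inv_le_one_of_one_le₀ (one_le_norm_one_add hL)

/-- The difference is `exp(-L) (exp L - 1 - L) (1 + L)⁻¹`, and the outer factors have norm at most
`1` since `Re L ≥ 0`. -/
lemma norm_inv_one_add_sub_exp_le {L : ℂ} (hL : 0 ≤ L.re) :
    ‖(1 + L)⁻¹ - cexp (-L)‖ ≤ ‖L‖ ^ 2 * Real.exp ‖L‖ := by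
  have h1 := one_le_norm_one_add hL
  have h0 : (1 + L) ≠ 0 := by
    intro h; rw [h] at h1; simp at h1; linarith
  have e : (1 + L)⁻¹ - cexp (-L) = cexp (-L) * (cexp L - (1 + L)) * (1 + L)⁻¹ := by
    rw [mul_sub, ← Complex.exp_add]; field_simp; simp
  have h2 : ‖cexp L - (1 + L)‖ ≤ ‖L‖ ^ 2 * Real.exp ‖L‖ := by
    have := norm_exp_sub_sum_le_norm_mul_exp L 2
    simpa [Finset.sum_range_succ] using this
  have h3 : ‖cexp (-L)‖ ≤ 1 := by
    rw [Complex.norm_exp]; simpa using hL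
  rw [e, norm_mul, norm_mul]
  calc _ ≤ 1 * (‖L‖ ^ 2 * Real.exp ‖L‖) * 1 := by
        gcongr
        exact norm_inv_one_add_le hL
    _ = _ := by ring

lemma norm_exp_sub_one_le_mul_exp (z : ℂ) : ‖cexp z - 1‖ ≤ ‖z‖ * Real.exp ‖z‖ := by
  simpa using norm_exp_sub_sum_le_norm_mul_exp z 1

lemma norm_exp_sub_one_sub_le_mul_exp (z : ℂ) :
    ‖cexp z - 1 - z‖ ≤ ‖z‖ ^ 2 * Real.exp ‖z‖ := by
  have := norm_exp_sub_sum_le_norm_mul_exp z 2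
  simpa [Finset.sum_range_succ, sub_sub] using this

/-- Think of `s` as having size `√r`: the bound is then of order `r^(3/2)`, the pathwise accuracy of
a Milstein step. `R` only bounds the range of `r`, so that the exponentials become constants. -/
lemma norm_stepApprox_sub_stepExact_le {R r q : ℝ} {L : ℂ} (hrR : r ≤ R)
    (hq : 0 ≤ q) (hqr : q ≤ r) (hL : 0 ≤ L.re) (hLr : ‖L‖ ≤ r) (s : ℝ) :
    ‖stepApprox q L s - stepExact q L s‖ ≤
      4 * Real.exp (2 * R) * (|s| ^ 3 + r * |s| + r * |s| ^ 2 + r ^ 2) := by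
  have hr : 0 ≤ r := hq.trans hqr
  set z : ℂ := ((q / 2 : ℝ) : ℂ) with hz
  have hzn : ‖z‖ = q / 2 := by rw [hz, Complex.norm_real, Real.norm_of_nonneg (by linarith)]
  have hzr : ‖z‖ ≤ r := by rw [hzn]; linarith
  have hE1 : Real.exp ‖z‖ ≤ Real.exp R := Real.exp_le_exp.2 (hzr.trans hrR)
  have hE1' : ‖cexp z‖ ≤ Real.exp R := (norm_exp_le_exp_norm z).trans hE1
  have hE2 : Real.exp ‖L‖ ≤ Real.exp R := Real.exp_le_exp.2 (hLr.trans hrR)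
  have hR1 : 1 ≤ Real.exp R := Real.one_le_exp (hr.trans hrR)
  -- The cubic remainder in `s`, the quadratic remainder in `q/2`, and the mixed products missing
  -- from the polynomial numerator.
  have e1 : stepNum q s - cexp (z - I * s) =
      -(cexp z * (cexp (-(I * s)) - (1 - I * s - s ^ 2 / 2)) + (cexp z - 1 - z)
        + (cexp z - 1) * (-(I * s) - s ^ 2 / 2)) := by
    rw [stepNum, sub_eq_add_neg z, Complex.exp_add, hz]; push_cast; ring
  have b1 : ‖stepNum q s - cexp (z - I * s)‖ ≤
      Real.exp R * (4 * |s| ^ 3 + r ^ 2 + r * (|s| + |s| ^ 2)) := by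
    rw [e1, norm_neg]
    have a1 : ‖cexp z * (cexp (-(I * s)) - (1 - I * s - s ^ 2 / 2))‖ ≤
        Real.exp R * (4 * |s| ^ 3) := by
      rw [norm_mul]; gcongr; exact norm_exp_neg_I_mul_sub_le s
    have a2 : ‖cexp z - 1 - z‖ ≤ Real.exp R * r ^ 2 := by
      refine (norm_exp_sub_one_sub_le_mul_exp z).trans ?_
      rw [mul_comm]; gcongr
    have a3 : ‖(cexp z - 1) * (-(I * s) - s ^ 2 / 2)‖ ≤ Real.exp R * (r * (|s| + |s| ^ 2)) := by
      rw [norm_mul, ← mul_assoc]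
      have c1 : ‖cexp z - 1‖ ≤ Real.exp R * r := by
        refine (norm_exp_sub_one_le_mul_exp z).trans ?_
        rw [mul_comm]; gcongr
      have c2 : ‖(-(I * s) - s ^ 2 / 2 : ℂ)‖ ≤ |s| + |s| ^ 2 := by
        refine (norm_sub_le _ _).trans ?_
        simp
        positivity
      gcongr
    calc _ ≤ _ := norm_add₃_le
      _ ≤ _ := by linarith
  have e2 : stepApprox q L s - stepExact q L s = (stepNum q s - cexp (z - I * s)) * (1 + L)⁻¹ +
      cexp (z - I * s) * ((1 + L)⁻¹ - cexp (-L)) := by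
    rw [mul_sub, ← Complex.exp_add, stepApprox, stepExact, hz]; push_cast; ring_nf
  have b2 : ‖cexp (z - I * s)‖ ≤ Real.exp R := by
    rw [sub_eq_add_neg, Complex.exp_add, norm_mul]
    have : ‖cexp (-(I * s))‖ = 1 := by rw [Complex.norm_exp]; simp
    rw [this, mul_one]; exact hE1'
  have b3 : ‖(1 + L)⁻¹ - cexp (-L)‖ ≤ r ^ 2 * Real.exp R := by
    refine (norm_inv_one_add_sub_exp_le hL).trans ?_
    gcongr
  rw [e2]
  have b4 : Real.exp (2 * R) = Real.exp R * Real.exp R := by rw [← Real.exp_add]; ring_nf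
  have b5 : Real.exp R ≤ Real.exp R * Real.exp R := by nlinarith
  calc _ ≤ ‖stepNum q s - cexp (z - I * s)‖ * ‖(1 + L)⁻¹‖ +
        ‖cexp (z - I * s)‖ * ‖(1 + L)⁻¹ - cexp (-L)‖ := by
        rw [← norm_mul, ← norm_mul]; exact norm_add_le _ _
    _ ≤ Real.exp R * (4 * |s| ^ 3 + r ^ 2 + r * (|s| + |s| ^ 2)) * 1 +
        Real.exp R * (r ^ 2 * Real.exp R) := by
        gcongr
        exact norm_inv_one_add_le hL
    _ ≤ Real.exp R * Real.exp R * (4 * |s| ^ 3 + r ^ 2 + r * (|s| + |s| ^ 2)) +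
        Real.exp R * Real.exp R * r ^ 2 := by
        have : 0 ≤ 4 * |s| ^ 3 + r ^ 2 + r * (|s| + |s| ^ 2) := by positivity
        nlinarith
    _ = Real.exp R * Real.exp R * (4 * |s| ^ 3 + 2 * r ^ 2 + r * (|s| + |s| ^ 2)) := by ring
    _ ≤ Real.exp R * Real.exp R * (4 * (|s| ^ 3 + r * |s| + r * |s| ^ 2 + r ^ 2)) := by
        gcongr
        have : 0 ≤ r * |s| := by positivity
        have : 0 ≤ r * |s| ^ 2 := by positivity
        nlinarith [sq_nonneg r]
    _ = _ := by rw [b4]; ring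

lemma continuous_stepNum (q : ℝ) : Continuous (stepNum q) := by
  unfold stepNum; fun_prop

lemma continuous_stepApprox (q : ℝ) (L : ℂ) : Continuous (stepApprox q L) := by
  unfold stepApprox; exact (continuous_stepNum q).div_const _

lemma continuous_stepExact (q : ℝ) (L : ℂ) : Continuous (stepExact q L) := by
  unfold stepExact; fun_prop

lemma normSq_stepNum (q s : ℝ) : ‖stepNum q s‖ ^ 2 = (1 + q / 2) ^ 2 - q / 2 * s ^ 2 + s ^ 4 / 4 := by
  have : stepNum q s = ((1 + q / 2 - s ^ 2 / 2 : ℝ) : ℂ) + ((-s : ℝ) : ℂ) * I := by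
    rw [stepNum]; push_cast; ring
  rw [this, ← Complex.normSq_eq_norm_sq, Complex.normSq_add_mul_I]; ring

lemma normSq_stepExact (q s : ℝ) (L : ℂ) : ‖stepExact q L s‖ ^ 2 = Real.exp (q - 2 * L.re) := by
  rw [stepExact, Complex.norm_exp, ← Real.exp_nat_mul]
  congr 1; simp; ring

lemma integral_normSq_stepNum (q : ℝ) (v : ℝ≥0) :
    ∫ s, ‖stepNum q s‖ ^ 2 ∂gaussianReal 0 v = (1 + q / 2) ^ 2 - q / 2 * v + 3 * v ^ 2 / 4 := by
  obtain ⟨h2, h4, _⟩ := integral_even_pow_gaussianReal v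
  simp_rw [normSq_stepNum]
  have i2 := integrable_pow_gaussianReal v 2
  have i4 := integrable_pow_gaussianReal v 4
  rw [integral_add, integral_sub, integral_const_mul, integral_div, h2, h4]
  · simp
  · exact integrable_const _
  · exact i2.const_mul _
  · exact (integrable_const _).sub (i2.const_mul _)
  · exact i4.div_const _

lemma memLp_stepNum (q : ℝ) (v : ℝ≥0) : MemLp (stepNum q) 2 (gaussianReal 0 v) := by
  rw [memLp_two_iff_integrable_sq_norm (continuous_stepNum q).aestronglyMeasurable]
  simp_rw [normSq_stepNum]
  exact ((integrable_const _).sub ((integrable_pow_gaussianReal v 2).const_mul _)).add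
    ((integrable_pow_gaussianReal v 4).div_const _)

lemma memLp_stepApprox (q : ℝ) (L : ℂ) (v : ℝ≥0) :
    MemLp (stepApprox q L) 2 (gaussianReal 0 v) := by
  have := (memLp_stepNum q v).mul_const (1 + L)⁻¹
  have e : stepApprox q L = fun s => stepNum q s * (1 + L)⁻¹ := by
    ext s; rw [stepApprox, div_eq_mul_inv]
  rw [e]; exact this

lemma memLp_stepExact (q : ℝ) (L : ℂ) (v : ℝ≥0) :
    MemLp (stepExact q L) 2 (gaussianReal 0 v) := by
  rw [memLp_two_iff_integrable_sq_norm (continuous_stepExact q L).aestronglyMeasurable]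
  simp_rw [normSq_stepExact]
  exact integrable_const _

lemma integral_stepApprox (q : ℝ) (L : ℂ) (v : ℝ≥0) :
    ∫ s, stepApprox q L s ∂gaussianReal 0 v = (1 + (((q - v) / 2 : ℝ) : ℂ)) * (1 + L)⁻¹ := by
  have h2 := (integral_even_pow_gaussianReal v).1
  have i1 : Integrable (fun s : ℝ => (s : ℂ)) (gaussianReal 0 v) := by
    simpa using (integrable_pow_gaussianReal v 1).ofReal (𝕜 := ℂ)
  have i2 : Integrable (fun s : ℝ => (s : ℂ) ^ 2) (gaussianReal 0 v) := by
    simpa using (integrable_pow_gaussianReal v 2).ofReal (𝕜 := ℂ)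
  have m1 : ∫ s : ℝ, (s : ℂ) ∂gaussianReal 0 v = 0 := by
    rw [integral_complex_ofReal]; simp
  have m2 : ∫ s : ℝ, (s : ℂ) ^ 2 ∂gaussianReal 0 v = v := by
    have : (fun s : ℝ => (s : ℂ) ^ 2) = fun s : ℝ => ((s ^ 2 : ℝ) : ℂ) := by ext; simp
    rw [this, integral_complex_ofReal, h2]
  simp_rw [stepApprox, stepNum, div_eq_mul_inv _ (1 + L)]
  rw [integral_mul_const, integral_sub, integral_sub, integral_const_mul, integral_div, m1, m2]
  · simp; ring_nf; simp
  · exact integrable_const _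
  · exact i2.div_const _
  · exact (integrable_const _).sub (i2.div_const _)
  · exact i1.const_mul _

lemma integral_stepExact (q : ℝ) (L : ℂ) (v : ℝ≥0) :
    ∫ s, stepExact q L s ∂gaussianReal 0 v = cexp (((q - v) / 2 : ℝ) : ℂ) * cexp (-L) := by
  have : ∀ s : ℝ, stepExact q L s = cexp (q / 2 - L) * cexp (-(I * s)) := by
    intro s; rw [stepExact, ← Complex.exp_add]; ring_nf
  simp_rw [this]
  rw [integral_const_mul, integral_cexp_neg_I_mul_gaussianReal, ← Complex.exp_add,
    ← Complex.exp_add]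
  push_cast; ring_nf

/-- In the mean the terms of order `r^(3/2)` cancel. With `y = (q - v)/2` the means are `(1 + y)/(1
+ L)` and `exp y · exp(-L)`, which agree up to second order. This half order gained over the
pathwise bound is the weak consistency of the step. -/
lemma norm_integral_stepApprox_sub_stepExact_le {R r q : ℝ} {L : ℂ} {v : ℝ≥0} (hrR : r ≤ R)
    (hq : 0 ≤ q) (hqr : q ≤ r) (hL : 0 ≤ L.re) (hLr : ‖L‖ ≤ r) (hv : v ≤ r) :
    ‖∫ s, (stepApprox q L s - stepExact q L s) ∂gaussianReal 0 v‖ ≤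
      2 * Real.exp (2 * R) * r ^ 2 := by
  have hr : 0 ≤ r := hq.trans hqr
  rw [integral_sub ((memLp_stepApprox q L v).integrable (by norm_num))
    ((memLp_stepExact q L v).integrable (by norm_num)), integral_stepApprox, integral_stepExact]
  set y : ℂ := (((q - v) / 2 : ℝ) : ℂ) with hy
  have hyr : ‖y‖ ≤ r := by
    rw [hy, Complex.norm_real, Real.norm_eq_abs, abs_le]
    have := v.2
    constructor <;> linarith [NNReal.coe_nonneg v]
  have hE1 : Real.exp ‖y‖ ≤ Real.exp R := Real.exp_le_exp.2 (hyr.trans hrR)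
  have hE1' : ‖cexp y‖ ≤ Real.exp R := (norm_exp_le_exp_norm y).trans hE1
  have hE2 : Real.exp ‖L‖ ≤ Real.exp R := Real.exp_le_exp.2 (hLr.trans hrR)
  have hR1 : 1 ≤ Real.exp R := Real.one_le_exp (hr.trans hrR)
  have e : (1 + y) * (1 + L)⁻¹ - cexp y * cexp (-L) =
      -((cexp y - 1 - y) * (1 + L)⁻¹) + cexp y * ((1 + L)⁻¹ - cexp (-L)) := by ring
  have b4 : Real.exp (2 * R) = Real.exp R * Real.exp R := by rw [← Real.exp_add]; ring_nf
  rw [e]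
  calc _ ≤ ‖cexp y - 1 - y‖ * ‖(1 + L)⁻¹‖ + ‖cexp y‖ * ‖(1 + L)⁻¹ - cexp (-L)‖ := by
        rw [← norm_mul, ← norm_mul, ← norm_neg ((cexp y - 1 - y) * (1 + L)⁻¹)]
        exact norm_add_le _ _
    _ ≤ (r ^ 2 * Real.exp R) * 1 + Real.exp R * (r ^ 2 * Real.exp R) := by
        gcongr
        · exact (norm_exp_sub_one_sub_le_mul_exp y).trans (by gcongr)
        · exact norm_inv_one_add_le hL
        · exact (norm_inv_one_add_sub_exp_le hL).trans (by gcongr)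
    _ ≤ _ := by
        rw [b4]
        have : 0 ≤ r ^ 2 * Real.exp R := by positivity
        nlinarith

/-- Each factor is within `O(√r)` of `1` in mean square. Paired with a strong error of size
`r^(3/2)`, this makes the cross terms in the consistency estimate `O(r²)`. -/
lemma norm_stepApprox_sub_one_le {r q : ℝ} {L : ℂ}
    (hq : 0 ≤ q) (hqr : q ≤ r) (hL : 0 ≤ L.re) (hLr : ‖L‖ ≤ r) (s : ℝ) :
    ‖stepApprox q L s - 1‖ ≤ 2 * r + |s| + |s| ^ 2 := by
  have h1 := one_le_norm_one_add hL
  have h0 : (1 + L) ≠ 0 := by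
    intro h; rw [h] at h1; simp at h1; linarith
  have e : stepApprox q L s - 1 = (((q / 2 : ℝ) : ℂ) - s ^ 2 / 2 - I * s - L) * (1 + L)⁻¹ := by
    rw [stepApprox, stepNum]; field_simp; push_cast; ring
  rw [e, norm_mul]
  have h2 : ‖((q / 2 : ℝ) : ℂ) - s ^ 2 / 2 - I * s - L‖ ≤ q / 2 + |s| ^ 2 / 2 + |s| + ‖L‖ := by
    refine (norm_sub_le _ _).trans (add_le_add ((norm_sub_le _ _).trans
      (add_le_add ((norm_sub_le _ _).trans (add_le_add ?_ ?_)) ?_)) le_rfl)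
    · rw [Complex.norm_real, Real.norm_of_nonneg (by linarith)]
    · simp
    · simp
  calc _ ≤ (q / 2 + |s| ^ 2 / 2 + |s| + ‖L‖) * 1 :=
        mul_le_mul h2 (norm_inv_one_add_le hL) (norm_nonneg _) (by positivity)
    _ ≤ _ := by nlinarith [sq_nonneg |s|]

lemma norm_stepExact_sub_one_le {R r q : ℝ} {L : ℂ} (hrR : r ≤ R)
    (hq : 0 ≤ q) (hqr : q ≤ r) (hLr : ‖L‖ ≤ r) (s : ℝ) :
    ‖stepExact q L s - 1‖ ≤ Real.exp (2 * R) * (2 * r + |s|) := by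
  have hr : 0 ≤ r := hq.trans hqr
  set z : ℂ := ((q / 2 : ℝ) : ℂ) - L with hz
  have hzr : ‖z‖ ≤ 2 * r := by
    refine (norm_sub_le _ _).trans ?_
    rw [Complex.norm_real, Real.norm_of_nonneg (by linarith)]; linarith
  have hE1 : Real.exp ‖z‖ ≤ Real.exp (2 * R) := Real.exp_le_exp.2 (by linarith)
  have hE1' : ‖cexp z‖ ≤ Real.exp (2 * R) := (norm_exp_le_exp_norm z).trans hE1
  have e : stepExact q L s - 1 = cexp z * (cexp (I * ((-s : ℝ) : ℂ)) - 1) + (cexp z - 1) := by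
    rw [mul_sub, ← Complex.exp_add, stepExact, hz]; push_cast; ring_nf
  rw [e]
  calc _ ≤ ‖cexp z‖ * ‖cexp (I * ((-s : ℝ) : ℂ)) - 1‖ + ‖cexp z - 1‖ := by
        rw [← norm_mul]; exact norm_add_le _ _
    _ ≤ Real.exp (2 * R) * |s| + (2 * r) * Real.exp (2 * R) := by
        gcongr
        · simpa using Real.norm_exp_I_mul_ofReal_sub_one_le (x := -s)
        · exact (norm_exp_sub_one_le_mul_exp z).trans (by gcongr)
    _ = _ := by ring

/-- After squaring, the moments of order two, four and six give multiples of `r³` and `r⁴`; one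
factor `r ≤ R` turns the latter into the former. -/
lemma integral_sq_bound_gaussianReal {R r : ℝ} {v : ℝ≥0} {f : ℝ → ℂ} {K : ℝ}
    (hr : 0 ≤ r) (hrR : r ≤ R) (hv : v ≤ r)
    (hf : MemLp f 2 (gaussianReal 0 v))
    (h : ∀ s, ‖f s‖ ≤ K * (|s| ^ 3 + r * |s| + r * |s| ^ 2 + r ^ 2)) :
    ∫ s, ‖f s‖ ^ 2 ∂gaussianReal 0 v ≤ 4 * K ^ 2 * (16 + 4 * R) * r ^ 3 := by
  obtain ⟨h2, h4, h6⟩ := integral_even_pow_gaussianReal v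
  have i2 := integrable_pow_gaussianReal v 2
  have i4 := integrable_pow_gaussianReal v 4
  have i6 := integrable_pow_gaussianReal v 6
  have hv0 := NNReal.coe_nonneg v
  have j1 := i6.add (i2.const_mul (r ^ 2))
  have j2 := j1.add (i4.const_mul (r ^ 2))
  have j3 := j2.add (integrable_const (r ^ 4))
  calc _ ≤ ∫ s, 4 * K ^ 2 * (s ^ 6 + r ^ 2 * s ^ 2 + r ^ 2 * s ^ 4 + r ^ 4) ∂gaussianReal 0 v := by
        refine integral_mono hf.integrable_norm_pow' (j3.const_mul _) fun s => ?_
        have h0 := h s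
        have : ‖f s‖ ^ 2 ≤ (K * (|s| ^ 3 + r * |s| + r * |s| ^ 2 + r ^ 2)) ^ 2 := by gcongr
        refine this.trans ?_
        rw [mul_pow]
        have e : (s ^ 6 + r ^ 2 * s ^ 2 + r ^ 2 * s ^ 4 + r ^ 4) =
          (|s| ^ 3) ^ 2 + (r * |s|) ^ 2 + (r * |s| ^ 2) ^ 2 + (r ^ 2) ^ 2 := by
          have a := sq_abs s
          rw [mul_pow, mul_pow, ← pow_mul, mul_comm 3 2, pow_mul, a]; ring
        show _ ≤ 4 * K ^ 2 * (s ^ 6 + r ^ 2 * s ^ 2 + r ^ 2 * s ^ 4 + r ^ 4)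
        rw [e]
        generalize |s| ^ 3 = a
        generalize r * |s| = b
        generalize r * |s| ^ 2 = c
        generalize r ^ 2 = d
        have : (a + b + c + d) ^ 2 ≤ 4 * (a ^ 2 + b ^ 2 + c ^ 2 + d ^ 2) := by
          nlinarith [sq_nonneg (a - b), sq_nonneg (a - c), sq_nonneg (a - d), sq_nonneg (b - c),
            sq_nonneg (b - d), sq_nonneg (c - d)]
        nlinarith [sq_nonneg K]
    _ = 4 * K ^ 2 * (15 * v ^ 3 + r ^ 2 * v + r ^ 2 * (3 * v ^ 2) + r ^ 4) := by
        rw [integral_const_mul]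
        congr 1
        rw [integral_add, integral_add, integral_add, integral_const_mul, integral_const_mul,
          h2, h4, h6]
        · simp
        · exact i6
        · exact i2.const_mul _
        · exact j1
        · exact i4.const_mul _
        · exact j2
        · exact integrable_const _
    _ ≤ 4 * K ^ 2 * (15 * r ^ 3 + r ^ 2 * r + r ^ 2 * (3 * r ^ 2) + r ^ 4) := by gcongr
    _ = 4 * K ^ 2 * (16 + 4 * r) * r ^ 3 := by ring
    _ ≤ _ := by gcongr

lemma integral_sq_bound_gaussianReal' {R r : ℝ} {v : ℝ≥0} {f : ℝ → ℂ} {K : ℝ}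
    (hr : 0 ≤ r) (hrR : r ≤ R) (hv : v ≤ r)
    (hf : MemLp f 2 (gaussianReal 0 v))
    (h : ∀ s, ‖f s‖ ≤ K * (2 * r + |s| + |s| ^ 2)) :
    ∫ s, ‖f s‖ ^ 2 ∂gaussianReal 0 v ≤ 3 * K ^ 2 * (1 + 7 * R) * r := by
  obtain ⟨h2, h4, h6⟩ := integral_even_pow_gaussianReal v
  have i2 := integrable_pow_gaussianReal v 2
  have i4 := integrable_pow_gaussianReal v 4
  have hv0 := NNReal.coe_nonneg v
  have j1 := (integrable_const (μ := gaussianReal 0 v) (4 * r ^ 2)).add i2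
  have j2 := j1.add i4
  calc _ ≤ ∫ s, 3 * K ^ 2 * (4 * r ^ 2 + s ^ 2 + s ^ 4) ∂gaussianReal 0 v := by
        refine integral_mono hf.integrable_norm_pow' (j2.const_mul _) fun s => ?_
        have h0 := h s
        have : ‖f s‖ ^ 2 ≤ (K * (2 * r + |s| + |s| ^ 2)) ^ 2 := by gcongr
        refine this.trans ?_
        rw [mul_pow]
        have e : 4 * r ^ 2 + s ^ 2 + s ^ 4 = (2 * r) ^ 2 + |s| ^ 2 + (|s| ^ 2) ^ 2 := by
          rw [sq_abs]; ring
        show _ ≤ 3 * K ^ 2 * (4 * r ^ 2 + s ^ 2 + s ^ 4)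
        rw [e]
        generalize |s| = b
        have : (2 * r + b + b ^ 2) ^ 2 ≤ 3 * ((2 * r) ^ 2 + b ^ 2 + (b ^ 2) ^ 2) := by
          nlinarith [sq_nonneg (2 * r - b), sq_nonneg (2 * r - b ^ 2), sq_nonneg (b - b ^ 2)]
        nlinarith [sq_nonneg K]
    _ = 3 * K ^ 2 * (4 * r ^ 2 + v + 3 * v ^ 2) := by
        rw [integral_const_mul]
        congr 1
        rw [integral_add, integral_add, h2, h4]
        · simp
        · exact integrable_const _
        · exact i2
        · exact j1
        · exact i4
    _ ≤ 3 * K ^ 2 * (4 * r ^ 2 + r + 3 * r ^ 2) := by gcongr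
    _ = 3 * K ^ 2 * (1 + 7 * r) * r := by ring
    _ ≤ _ := by gcongr

lemma norm_integral_mul_le {ν : Measure ℝ} [IsFiniteMeasure ν] {f g : ℝ → ℂ} {r a b : ℝ} (hr : 0 < r)
    (hf : MemLp f 2 ν) (hg : MemLp g 2 ν) (ha : ∫ s, ‖f s‖ ^ 2 ∂ν ≤ a * r)
    (hb : ∫ s, ‖g s‖ ^ 2 ∂ν ≤ b * r ^ 3) :
    ‖∫ s, f s * g s ∂ν‖ ≤ (a + b) * r ^ 2 := by
  have i1 := hf.integrable_norm_pow'
  have i2 := hg.integrable_norm_pow'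
  calc _ ≤ ∫ s, ‖f s * g s‖ ∂ν := norm_integral_le_integral_norm _
    -- Young's inequality in place of Cauchy–Schwarz: the weights `r` and `r⁻¹` balance the sizes
    -- `r` and `r³` of the two integrals.
    _ ≤ ∫ s, (r * ‖f s‖ ^ 2 + r⁻¹ * ‖g s‖ ^ 2) ∂ν := by
        refine integral_mono_of_nonneg (Filter.Eventually.of_forall fun s => norm_nonneg _)
          ((i1.const_mul _).add (i2.const_mul _)) (Filter.Eventually.of_forall fun s => ?_)
        show ‖f s * g s‖ ≤ r * ‖f s‖ ^ 2 + r⁻¹ * ‖g s‖ ^ 2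
        rw [norm_mul]
        have : r * ‖f s‖ ^ 2 + r⁻¹ * ‖g s‖ ^ 2 - ‖f s‖ * ‖g s‖ =
            r⁻¹ * ((r * ‖f s‖ - ‖g s‖ / 2) ^ 2 + 3 / 4 * ‖g s‖ ^ 2) := by
          field_simp; ring
        have h2 : 0 ≤ r⁻¹ * ((r * ‖f s‖ - ‖g s‖ / 2) ^ 2 + 3 / 4 * ‖g s‖ ^ 2) := by positivity
        linarith
    _ = r * ∫ s, ‖f s‖ ^ 2 ∂ν + r⁻¹ * ∫ s, ‖g s‖ ^ 2 ∂ν := by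
        rw [integral_add (i1.const_mul _) (i2.const_mul _), integral_const_mul,
          integral_const_mul]
    _ ≤ r * (a * r) + r⁻¹ * (b * r ^ 3) := by gcongr
    _ = _ := by field_simp

/-- Strong and weak consistency of one step of the scheme with the exact step. -/
theorem exists_step_consistency (R : ℝ) (hR : 0 ≤ R) : ∃ C : ℝ, 0 < C ∧
    ∀ (r q : ℝ) (v : ℝ≥0) (L : ℂ), 0 < r → r ≤ R → 0 ≤ q → q ≤ r → v ≤ r → 0 ≤ L.re → ‖L‖ ≤ r →
      ∫ s, ‖stepApprox q L s - stepExact q L s‖ ^ 2 ∂gaussianReal 0 v ≤ C * r ^ 3 ∧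
      ‖∫ s, stepApprox q L s * conj (stepApprox q L s - stepExact q L s) ∂gaussianReal 0 v‖
        ≤ C * r ^ 2 ∧
      ‖∫ s, (stepApprox q L s - stepExact q L s) * conj (stepExact q L s) ∂gaussianReal 0 v‖
        ≤ C * r ^ 2 := by
  set K := Real.exp (2 * R)
  have hK : 0 < K := Real.exp_pos _
  set D := 4 * (4 * K) ^ 2 * (16 + 4 * R)
  set a₁ := 3 * 1 ^ 2 * (1 + 7 * R)
  set a₂ := 3 * K ^ 2 * (1 + 7 * R)
  have hD : 0 < D := by positivity
  have ha₁ : 0 < a₁ := by positivity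
  have ha₂ : 0 < a₂ := by positivity
  refine ⟨D + a₁ + a₂ + 2 * K, by positivity, ?_⟩
  intro r q v L hr hrR hq hqr hv hL hLr
  have mX := memLp_stepApprox q L v
  have mE := memLp_stepExact q L v
  have mδ := mX.sub mE
  have hδ := integral_sq_bound_gaussianReal hr.le hrR hv mδ
    (norm_stepApprox_sub_stepExact_le hrR hq hqr hL hLr)
  have hw := norm_integral_stepApprox_sub_stepExact_le hrR hq hqr hL hLr hv
  have mX1 : MemLp (fun s => stepApprox q L s - 1) 2 (gaussianReal 0 v) :=
    mX.sub (memLp_const 1)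
  have mE1 : MemLp (fun s => stepExact q L s - 1) 2 (gaussianReal 0 v) :=
    mE.sub (memLp_const 1)
  have hX1 := integral_sq_bound_gaussianReal' (K := 1) hr.le hrR hv mX1
    (fun s => by simpa using norm_stepApprox_sub_one_le hq hqr hL hLr s)
  have hE1 := integral_sq_bound_gaussianReal' (K := K) hr.le hrR hv mE1 (fun s => by
    refine (norm_stepExact_sub_one_le hrR hq hqr hLr s).trans ?_
    have : 0 ≤ |s| ^ 2 := by positivity
    exact mul_le_mul_of_nonneg_left (by linarith) hK.le)
  have mδc : MemLp (fun s => conj (stepApprox q L s - stepExact q L s)) 2 (gaussianReal 0 v) :=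
    mδ.star
  have mE1c : MemLp (fun s => conj (stepExact q L s - 1)) 2 (gaussianReal 0 v) := mE1.star
  have hr2 : 0 ≤ r ^ 2 := by positivity
  have iδ : Integrable (fun s => stepApprox q L s - stepExact q L s) (gaussianReal 0 v) :=
    mδ.integrable (by norm_num)
  refine ⟨?_, ?_, ?_⟩
  · refine hδ.trans ?_
    have : 0 ≤ r ^ 3 := by positivity
    gcongr
    linarith
  -- Writing `X = (X - 1) + 1` leaves a product of a `√r` and an `r^(3/2)` quantity, plus the mean
  -- of `X - E`. The last conjunct is treated in the same way with `E = (E - 1) + 1`.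
  · have e : ∀ s, stepApprox q L s * conj (stepApprox q L s - stepExact q L s) =
        (stepApprox q L s - 1) * conj (stepApprox q L s - stepExact q L s) +
          conj (stepApprox q L s - stepExact q L s) := fun s => by ring
    simp_rw [e]
    have i1 : Integrable (fun s => (stepApprox q L s - 1) *
        conj (stepApprox q L s - stepExact q L s)) (gaussianReal 0 v) :=
      mX1.integrable_mul mδc
    rw [integral_add i1 (mδc.integrable (by norm_num)), integral_conj]
    refine (norm_add_le _ _).trans ?_
    rw [Complex.norm_conj]
    have := norm_integral_mul_le hr mX1 mδc hX1 (b := D) (by simp only [Complex.norm_conj]; exact hδ)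
    calc _ ≤ (a₁ + D) * r ^ 2 + 2 * K * r ^ 2 := add_le_add this hw
      _ ≤ _ := by nlinarith
  · have e : ∀ s, (stepApprox q L s - stepExact q L s) * conj (stepExact q L s) =
        conj (stepExact q L s - 1) * (stepApprox q L s - stepExact q L s) +
          (stepApprox q L s - stepExact q L s) := fun s => by simp; ring
    simp_rw [e]
    have i1 : Integrable (fun s => conj (stepExact q L s - 1) *
        (stepApprox q L s - stepExact q L s)) (gaussianReal 0 v) :=
      mE1c.integrable_mul mδ
    rw [integral_add i1 iδ]
    refine (norm_add_le _ _).trans ?_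
    have := norm_integral_mul_le hr mE1c mδ (a := a₂) (b := D) (by simpa only [Complex.norm_conj] using hE1) hδ
    calc _ ≤ (a₂ + D) * r ^ 2 + 2 * K * r ^ 2 := add_le_add this hw
      _ ≤ _ := by nlinarith

/-! ### Products of independent factors -/

lemma integral_sub_sub_add {X : Type*} [MeasurableSpace X] {μ : Measure X} {a b c d : X → ℂ}
    (ha : Integrable a μ) (hb : Integrable b μ) (hc : Integrable c μ) (hd : Integrable d μ) :
    ∫ x, (a x - b x - c x + d x) ∂μ =
      ∫ x, a x ∂μ - ∫ x, b x ∂μ - ∫ x, c x ∂μ + ∫ x, d x ∂μ := by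
  rw [← integral_sub ha hb, ← integral_sub (f := fun x => a x - b x) (ha.sub hb) hc,
    ← integral_add (f := fun x => a x - b x - c x) ((ha.sub hb).sub hc) hd]

lemma integral_prod_pi (ν : Measure ℝ) [IsProbabilityMeasure ν] (N : ℕ) (f : ℝ → ℂ) :
    ∫ z : Fin N → ℝ, ∏ i, f (z i) ∂Measure.pi (fun _ => ν) = (∫ s, f s ∂ν) ^ N := by
  simpa using integral_fintype_prod_eq_pow (ι := Fin N) (μ := ν) f

/-- Expanding the square gives four products of functions of separate coordinates, and independence
turns each integral into an `N`-th power of a one-step moment. -/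
lemma integral_normSq_prod_sub_prod {ν : Measure ℝ} [IsProbabilityMeasure ν] (N : ℕ)
    {f g : ℝ → ℂ} (hf : MemLp f 2 ν) (hg : MemLp g 2 ν) :
    Integrable (fun z : Fin N → ℝ => ‖∏ i, f (z i) - ∏ i, g (z i)‖ ^ 2)
      (Measure.pi (fun _ => ν)) ∧
    ((∫ z : Fin N → ℝ, ‖∏ i, f (z i) - ∏ i, g (z i)‖ ^ 2 ∂Measure.pi (fun _ => ν) : ℝ) : ℂ) =
      (∫ s, f s * conj (f s) ∂ν) ^ N - (∫ s, f s * conj (g s) ∂ν) ^ N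
        - conj (∫ s, f s * conj (g s) ∂ν) ^ N + (∫ s, g s * conj (g s) ∂ν) ^ N := by
  have hfc : MemLp (fun s => conj (f s)) 2 ν := hf.star
  have hgc : MemLp (fun s => conj (g s)) 2 ν := hg.star
  have e : ∀ z : Fin N → ℝ, ((‖∏ i, f (z i) - ∏ i, g (z i)‖ ^ 2 : ℝ) : ℂ) =
      ∏ i, (f (z i) * conj (f (z i))) - ∏ i, (f (z i) * conj (g (z i)))
        - ∏ i, (g (z i) * conj (f (z i))) + ∏ i, (g (z i) * conj (g (z i))) := by
    intro z
    simp only [Finset.prod_mul_distrib]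
    rw [← map_prod conj, ← map_prod conj]
    push_cast
    rw [← Complex.mul_conj']
    simp only [map_sub]
    ring
  have i1 : Integrable (fun z : Fin N → ℝ => ∏ i, (f (z i) * conj (f (z i))))
      (Measure.pi (fun _ => ν)) := Integrable.fintype_prod fun _ => hf.integrable_mul hfc
  have i2 : Integrable (fun z : Fin N → ℝ => ∏ i, (f (z i) * conj (g (z i))))
      (Measure.pi (fun _ => ν)) := Integrable.fintype_prod fun _ => hf.integrable_mul hgc
  have i3 : Integrable (fun z : Fin N → ℝ => ∏ i, (g (z i) * conj (f (z i))))
      (Measure.pi (fun _ => ν)) := Integrable.fintype_prod fun _ => hg.integrable_mul hfc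
  have i4 : Integrable (fun z : Fin N → ℝ => ∏ i, (g (z i) * conj (g (z i))))
      (Measure.pi (fun _ => ν)) := Integrable.fintype_prod fun _ => hg.integrable_mul hgc
  constructor
  · have := ((i1.sub i2).sub i3).add i4
    have h2 := this.re
    refine h2.congr (Filter.Eventually.of_forall fun z => ?_)
    have := congrArg Complex.re (e z)
    rw [Complex.ofReal_re] at this
    exact this.symm
  · rw [← integral_complex_ofReal]
    simp_rw [e]
    rw [integral_sub_sub_add i1 i2 i3 i4,
      integral_prod_pi ν N (fun s => f s * conj (f s)),
      integral_prod_pi ν N (fun s => f s * conj (g s)),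
      integral_prod_pi ν N (fun s => g s * conj (f s)),
      integral_prod_pi ν N (fun s => g s * conj (g s))]
    congr 3
    rw [← integral_conj]
    congr 1; ext s; simp [mul_comm]

lemma integral_normSq_prod {ν : Measure ℝ} [IsProbabilityMeasure ν] (N : ℕ) (f : ℝ → ℂ) :
    ∫ z : Fin N → ℝ, ‖∏ i, f (z i)‖ ^ 2 ∂Measure.pi (fun _ => ν) = (∫ s, ‖f s‖ ^ 2 ∂ν) ^ N := by
  have := integral_fintype_prod_eq_pow (ι := Fin N) (μ := ν) (fun s => ‖f s‖ ^ 2)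
  simp only [Fintype.card_fin] at this
  rw [← this]
  congr 1; ext z
  rw [norm_prod, Finset.prod_pow]

lemma integrable_normSq_prod {ν : Measure ℝ} [IsProbabilityMeasure ν] (N : ℕ) {f : ℝ → ℂ}
    (hf : MemLp f 2 ν) :
    Integrable (fun z : Fin N → ℝ => ‖∏ i, f (z i)‖ ^ 2) (Measure.pi (fun _ => ν)) := by
  have : Integrable (fun z : Fin N → ℝ => ∏ i, ‖f (z i)‖ ^ 2) (Measure.pi (fun _ => ν)) :=
    Integrable.fintype_prod fun _ => hf.integrable_norm_pow'
  refine this.congr (Filter.Eventually.of_forall fun z => ?_)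
  simp [norm_prod, Finset.prod_pow]

/-- The factor `m` on the left avoids the exponent `n - 1` on the right. -/
lemma norm_pow_sub_pow_le {a b : ℂ} {m : ℝ} (ha : ‖a‖ ≤ m) (hb : ‖b‖ ≤ m) (n : ℕ) :
    m * ‖a ^ n - b ^ n‖ ≤ n * m ^ n * ‖a - b‖ := by
  have hm : 0 ≤ m := (norm_nonneg _).trans ha
  induction n with
  | zero => simp
  | succ n ih =>
    have e : a ^ (n + 1) - b ^ (n + 1) = a * (a ^ n - b ^ n) + b ^ n * (a - b) := by ring
    have h1 : ‖b ^ n‖ ≤ m ^ n := by rw [norm_pow]; gcongr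
    calc m * ‖a ^ (n + 1) - b ^ (n + 1)‖ ≤ m * (‖a‖ * ‖a ^ n - b ^ n‖ + ‖b ^ n‖ * ‖a - b‖) := by
          rw [e, ← norm_mul, ← norm_mul]; gcongr; exact norm_add_le _ _
      _ ≤ m * (m * ‖a ^ n - b ^ n‖ + m ^ n * ‖a - b‖) := by gcongr
      _ = m * (m * ‖a ^ n - b ^ n‖) + m ^ (n + 1) * ‖a - b‖ := by ring
      _ ≤ m * (n * m ^ n * ‖a - b‖) + m ^ (n + 1) * ‖a - b‖ := by gcongr
      _ = _ := by push_cast; ring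

/-- If all four second moments of a pair of factors are bounded by `m`, the second moment of the
difference of `N`-fold products is controlled by the local errors. -/
lemma norm_pow_combination_le {a b g : ℂ} {m d e₁ e₂ : ℝ} (hm : 0 < m) (ha : ‖a‖ ≤ m)
    (hb : ‖b‖ ≤ m) (hg : ‖g‖ ≤ m) (hd : ‖a - b - conj b + g‖ ≤ d) (hac : conj a = a)
    (hgc : conj g = g) (h1 : ‖a - b‖ ≤ e₁) (h2 : ‖b - g‖ ≤ e₂) (N : ℕ) :
    ‖a ^ N - b ^ N - conj b ^ N + g ^ N‖ ≤
      m ^ N * (N * (d / m) + N ^ 2 * (2 * e₁ * e₂ / m ^ 2)) := by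
  have he1 : 0 ≤ e₁ := (norm_nonneg _).trans h1
  have he2 : 0 ≤ e₂ := (norm_nonneg _).trans h2
  have hd0 : 0 ≤ d := (norm_nonneg _).trans hd
  induction N with
  | zero => simp
  | succ n ih =>
    -- One-step recursion for the mean square error: propagation of the old error, two conjugate
    -- products of an accumulated and a new weak error, and a fresh strong error.
    have e : a ^ (n + 1) - b ^ (n + 1) - conj b ^ (n + 1) + g ^ (n + 1) =
        a * (a ^ n - b ^ n - conj b ^ n + g ^ n) + (b ^ n - g ^ n) * (a - b)
          + conj ((b ^ n - g ^ n) * (a - b)) + g ^ n * (a - b - conj b + g) := by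
      simp only [map_mul, map_sub, map_pow, hac, hgc]; ring
    have k1 : ‖b ^ n - g ^ n‖ * ‖a - b‖ ≤ n * m ^ n * (e₁ * e₂) / m := by
      rw [le_div_iff₀ hm]
      have := norm_pow_sub_pow_le hb hg n
      calc ‖b ^ n - g ^ n‖ * ‖a - b‖ * m = (m * ‖b ^ n - g ^ n‖) * ‖a - b‖ := by ring
        _ ≤ (n * m ^ n * ‖b - g‖) * ‖a - b‖ := by gcongr
        _ ≤ (n * m ^ n * e₂) * e₁ := by gcongr
        _ = _ := by ring
    calc _ ≤ ‖a‖ * ‖a ^ n - b ^ n - conj b ^ n + g ^ n‖ + ‖b ^ n - g ^ n‖ * ‖a - b‖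
          + ‖b ^ n - g ^ n‖ * ‖a - b‖ + ‖g‖ ^ n * ‖a - b - conj b + g‖ := by
          rw [e]
          refine (norm_add_le _ _).trans (add_le_add ((norm_add_le _ _).trans
            (add_le_add ((norm_add_le _ _).trans (add_le_add ?_ ?_)) ?_)) ?_)
          · rw [norm_mul]
          · rw [norm_mul]
          · rw [Complex.norm_conj, norm_mul]
          · rw [norm_mul, norm_pow]
      _ ≤ m * (m ^ n * (n * (d / m) + n ^ 2 * (2 * e₁ * e₂ / m ^ 2))) +
          n * m ^ n * (e₁ * e₂) / m + n * m ^ n * (e₁ * e₂) / m + m ^ n * d := by gcongr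
      _ = m ^ (n + 1) * ((n + 1) * (d / m) + (n ^ 2 + n) * (2 * e₁ * e₂ / m ^ 2)) := by
          field_simp; ring
      _ ≤ _ := by
          push_cast
          gcongr
          nlinarith [(Nat.cast_nonneg n : (0 : ℝ) ≤ n)]

/-- The strong local error `d` accumulates linearly in `N`, the weak local errors `e₁, e₂` only
through their product, quadratically in `N`. With `d` of order `k³`, `e₁` and `e₂` of order `k²` and
`N k = T`, both contributions are of order `k²`. Extracting `m ^ N` preserves the decay of the
multipliers. -/
theorem integral_normSq_prod_sub_prod_le {ν : Measure ℝ} [IsProbabilityMeasure ν] (N : ℕ)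
    {f g : ℝ → ℂ} {m d e₁ e₂ : ℝ} (hm : 0 < m) (hf : MemLp f 2 ν) (hg : MemLp g 2 ν)
    (hfm : ∫ s, ‖f s‖ ^ 2 ∂ν ≤ m) (hgm : ∫ s, ‖g s‖ ^ 2 ∂ν ≤ m)
    (hd : ∫ s, ‖f s - g s‖ ^ 2 ∂ν ≤ d)
    (h1 : ‖∫ s, f s * conj (f s - g s) ∂ν‖ ≤ e₁)
    (h2 : ‖∫ s, (f s - g s) * conj (g s) ∂ν‖ ≤ e₂) :
    ∫ z : Fin N → ℝ, ‖∏ i, f (z i) - ∏ i, g (z i)‖ ^ 2 ∂Measure.pi (fun _ => ν) ≤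
      m ^ N * (N * (d / m) + N ^ 2 * (2 * e₁ * e₂ / m ^ 2)) := by
  have hfc : MemLp (fun s => conj (f s)) 2 ν := hf.star
  have hgc : MemLp (fun s => conj (g s)) 2 ν := hg.star
  have i1 : Integrable (fun s => f s * conj (f s)) ν := hf.integrable_mul hfc
  have i2 : Integrable (fun s => f s * conj (g s)) ν := hf.integrable_mul hgc
  have i3 : Integrable (fun s => g s * conj (f s)) ν := hg.integrable_mul hfc
  have i4 : Integrable (fun s => g s * conj (g s)) ν := hg.integrable_mul hgc
  have nf := hf.integrable_norm_pow'
  have ng := hg.integrable_norm_pow'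
  set a := ∫ s, f s * conj (f s) ∂ν with ha
  set b := ∫ s, f s * conj (g s) ∂ν with hb
  set c := ∫ s, g s * conj (g s) ∂ν with hc
  have ea : a = ((∫ s, ‖f s‖ ^ 2 ∂ν : ℝ) : ℂ) := by
    rw [← integral_complex_ofReal, ha]; congr 1; ext s; rw [Complex.mul_conj']; push_cast; rfl
  have ec : c = ((∫ s, ‖g s‖ ^ 2 ∂ν : ℝ) : ℂ) := by
    rw [← integral_complex_ofReal, hc]; congr 1; ext s; rw [Complex.mul_conj']; push_cast; rfl
  have pa : 0 ≤ ∫ s, ‖f s‖ ^ 2 ∂ν := integral_nonneg fun s => by positivity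
  have pc : 0 ≤ ∫ s, ‖g s‖ ^ 2 ∂ν := integral_nonneg fun s => by positivity
  have na : ‖a‖ ≤ m := by rw [ea, Complex.norm_real, Real.norm_of_nonneg pa]; exact hfm
  have nc : ‖c‖ ≤ m := by rw [ec, Complex.norm_real, Real.norm_of_nonneg pc]; exact hgm
  have nb : ‖b‖ ≤ m := by
    calc ‖b‖ ≤ ∫ s, ‖f s * conj (g s)‖ ∂ν := norm_integral_le_integral_norm _
      _ ≤ ∫ s, (‖f s‖ ^ 2 / 2 + ‖g s‖ ^ 2 / 2) ∂ν := by
          refine integral_mono i2.norm ((nf.div_const _).add (ng.div_const _)) fun s => ?_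
          show ‖f s * conj (g s)‖ ≤ ‖f s‖ ^ 2 / 2 + ‖g s‖ ^ 2 / 2
          rw [norm_mul, Complex.norm_conj]
          nlinarith [sq_nonneg (‖f s‖ - ‖g s‖)]
      _ = (∫ s, ‖f s‖ ^ 2 ∂ν) / 2 + (∫ s, ‖g s‖ ^ 2 ∂ν) / 2 := by
          rw [integral_add (nf.div_const _) (ng.div_const _), integral_div, integral_div]
      _ ≤ m := by linarith
  have cb : conj b = ∫ s, g s * conj (f s) ∂ν := by
    rw [hb, ← integral_conj]; congr 1; ext s; simp [mul_comm]
  have hd' : ‖a - b - conj b + c‖ ≤ d := by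
    have : a - b - conj b + c = ((∫ s, ‖f s - g s‖ ^ 2 ∂ν : ℝ) : ℂ) := by
      rw [cb, ha, hb, hc, ← integral_sub_sub_add i1 i2 i3 i4, ← integral_complex_ofReal]
      congr 1; ext s
      push_cast
      rw [← Complex.mul_conj']
      simp; ring
    rw [this, Complex.norm_real, Real.norm_of_nonneg (integral_nonneg fun s => by positivity)]
    exact hd
  have h1' : ‖a - b‖ ≤ e₁ := by
    rw [ha, hb, ← integral_sub i1 i2]
    convert h1 using 4 with s
    simp; ring
  have h2' : ‖b - c‖ ≤ e₂ := by
    rw [hb, hc, ← integral_sub i2 i4]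
    convert h2 using 4 with s
    ring
  have key := norm_pow_combination_le hm na nb nc hd' (by rw [ea, Complex.conj_ofReal])
    (by rw [ec, Complex.conj_ofReal]) h1' h2' N
  rw [← (integral_normSq_prod_sub_prod N hf hg).2, Complex.norm_real] at key
  exact (le_abs_self _).trans key

/-! ### The discretised symbols -/

/-- The symbol of the central difference quotient, divided by `i`. -/
def symC (h ξ : ℝ) : ℝ := Real.sin (ξ * h) / h

/-- The square root of the symbol of minus the second difference quotient. -/
def symS (h ξ : ℝ) : ℝ := 2 * Real.sin (ξ * h / 2) / h

lemma abs_sin_sub_le (x : ℝ) : |Real.sin x - x| ≤ 2 * |x| ^ 3 := by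
  wlog hx : 0 ≤ x generalizing x
  · have := this (-x) (by linarith)
    rw [Real.sin_neg, abs_neg] at this
    rwa [show -Real.sin x - -x = -(Real.sin x - x) by ring, abs_neg] at this
  rw [abs_of_nonneg hx]
  rcases eq_or_lt_of_le hx with h0 | h0
  · simp [← h0]
  have h1 := Real.sin_lt h0
  rw [abs_of_neg (by linarith)]
  have := Real.sin_gt_sub_cube h0
  have h3 : 0 ≤ x ^ 3 := by positivity
  linarith

lemma abs_symS_le {h : ℝ} (hh : 0 < h) (ξ : ℝ) : |symS h ξ| ≤ |ξ| := by
  rw [symS, abs_div, abs_mul, abs_of_pos hh, div_le_iff₀ hh]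
  have := Real.abs_sin_le_abs (x := ξ * h / 2)
  rw [abs_div, abs_mul, abs_of_pos hh] at this
  simp at *; linarith

lemma symC_eq {h : ℝ} (ξ : ℝ) : symC h ξ = symS h ξ * Real.cos (ξ * h / 2) := by
  rw [symC, symS, show ξ * h = 2 * (ξ * h / 2) by ring, Real.sin_two_mul]
  ring_nf

lemma abs_symC_le_abs_symS (h ξ : ℝ) : |symC h ξ| ≤ |symS h ξ| := by
  rw [symC_eq, abs_mul]
  exact mul_le_of_le_one_right (abs_nonneg _) (Real.abs_cos_le_one _)

/-- The half-angle formula gives `symC = symS · cos(ξh/2)`. Hence the noise, discretised by central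
differences, is dominated at every frequency by the diffusion, discretised by the compact second
difference. Stability needs no relation between `k` and the mesh sizes for this reason. -/
lemma symC_sq_le_symS_sq (h ξ : ℝ) : symC h ξ ^ 2 ≤ symS h ξ ^ 2 :=
  sq_le_sq.2 (abs_symC_le_abs_symS h ξ)

lemma symS_sq_le {h : ℝ} (hh : 0 < h) (ξ : ℝ) : symS h ξ ^ 2 ≤ ξ ^ 2 :=
  sq_le_sq.2 (abs_symS_le hh ξ)

lemma abs_symC_le {h : ℝ} (hh : 0 < h) (ξ : ℝ) : |symC h ξ| ≤ |ξ| :=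
  (abs_symC_le_abs_symS h ξ).trans (abs_symS_le hh ξ)

/-- Jordan's inequality for the sine, with `(2/π)² ≥ 2/5` because `π² ≤ 10`. It keeps the discrete
dissipation comparable to `ξ²` on the whole box; `symC` has no such bound, as it vanishes at `|ξ| h
= π`. -/
lemma le_symS_sq {h ξ : ℝ} (hh : 0 < h) (hξ : |ξ| * h ≤ Real.pi) :
    2 / 5 * ξ ^ 2 ≤ symS h ξ ^ 2 := by
  have h1 : |ξ * h / 2| ≤ Real.pi / 2 := by
    rw [abs_div, abs_mul, abs_of_pos hh]; simp; linarith
  have h2 := Real.mul_abs_le_abs_sin h1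
  have h3 : 2 / Real.pi * |ξ| ≤ |symS h ξ| := by
    rw [symS, abs_div, abs_mul, abs_of_pos hh, le_div_iff₀ hh]
    rw [abs_div, abs_mul, abs_of_pos hh] at h2
    rw [abs_of_pos (two_pos : (0 : ℝ) < 2)] at *
    calc _ = 2 * (2 / Real.pi * (|ξ| * h / 2)) := by ring
      _ ≤ _ := by linarith
  have h4 : (2 / Real.pi * |ξ|) ^ 2 ≤ |symS h ξ| ^ 2 := by
    have := Real.pi_pos
    gcongr
  rw [sq_abs, mul_pow, sq_abs] at h4
  refine le_trans ?_ h4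
  have h5 : Real.pi ^ 2 ≤ 10 := by nlinarith [Real.pi_lt_d2, Real.pi_pos]
  have : (2 / 5 : ℝ) ≤ (2 / Real.pi) ^ 2 := by
    rw [div_pow, div_le_div_iff₀ (by norm_num) (by positivity)]; linarith
  gcongr

lemma abs_symC_sub_le {h : ℝ} (hh : 0 < h) (ξ : ℝ) : |symC h ξ - ξ| ≤ 2 * h ^ 2 * |ξ| ^ 3 := by
  have h1 := abs_sin_sub_le (ξ * h)
  have e : symC h ξ - ξ = (Real.sin (ξ * h) - ξ * h) / h := by rw [symC]; field_simp
  rw [e, abs_div, abs_of_pos hh, div_le_iff₀ hh]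
  refine h1.trans (le_of_eq ?_)
  rw [abs_mul, abs_of_pos hh]; ring

lemma abs_symS_sub_le {h : ℝ} (hh : 0 < h) (ξ : ℝ) : |symS h ξ - ξ| ≤ h ^ 2 * |ξ| ^ 3 / 2 := by
  have h1 := abs_sin_sub_le (ξ * h / 2)
  have e : symS h ξ - ξ = 2 * (Real.sin (ξ * h / 2) - ξ * h / 2) / h := by
    rw [symS]; field_simp
  rw [e, abs_div, abs_of_pos hh, div_le_iff₀ hh, abs_mul]
  rw [abs_div, abs_mul, abs_of_pos hh] at h1
  simp at *
  calc _ ≤ 2 * (2 * (|ξ| * h / 2) ^ 3) := by linarith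
    _ = _ := by ring

lemma abs_sq_sub_sq_le {a b d : ℝ} (hab : |a| ≤ |b|) (hd : |a - b| ≤ d) :
    |a ^ 2 - b ^ 2| ≤ 2 * d * |b| := by
  rw [show a ^ 2 - b ^ 2 = (a - b) * (a + b) by ring, abs_mul]
  have : |a + b| ≤ 2 * |b| := (abs_add_le a b).trans (by linarith)
  calc _ ≤ d * (2 * |b|) := mul_le_mul hd this (abs_nonneg _) ((abs_nonneg _).trans hd)
    _ = _ := by ring

lemma abs_symC_sq_sub_le {h : ℝ} (hh : 0 < h) (ξ : ℝ) :
    |symC h ξ ^ 2 - ξ ^ 2| ≤ 4 * h ^ 2 * ξ ^ 4 := by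
  refine (abs_sq_sub_sq_le (abs_symC_le hh ξ) (abs_symC_sub_le hh ξ)).trans (le_of_eq ?_)
  rw [show ξ ^ 4 = (ξ ^ 2) ^ 2 by ring, ← sq_abs ξ]; ring

lemma abs_symS_sq_sub_le {h : ℝ} (hh : 0 < h) (ξ : ℝ) :
    |symS h ξ ^ 2 - ξ ^ 2| ≤ h ^ 2 * ξ ^ 4 := by
  refine (abs_sq_sub_sq_le (abs_symS_le hh ξ) (abs_symS_sub_le hh ξ)).trans (le_of_eq ?_)
  rw [show ξ ^ 4 = (ξ ^ 2) ^ 2 by ring, ← sq_abs ξ]; ring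

/-! ### Mean square stability -/

/-- `κ < 1` measures the distance from the boundary of the stability region. -/
structure Corr.StableWith (r : Corr) (κ : ℝ) : Prop where
  nonneg : 0 ≤ κ
  lt_one : κ < 1
  ρx_nonneg : 0 ≤ r.ρx
  ρy_nonneg : 0 ≤ r.ρy
  ρx_le : r.ρx ≤ κ
  ρy_le : r.ρy ≤ κ
  abs_le_one : |r.ρxy| ≤ 1
  stable_x : 2 * r.ρx ^ 2 * (1 + 2 * |r.ρxy|) ≤ κ
  stable_y : 2 * r.ρy ^ 2 * (1 + 2 * |r.ρxy|) ≤ κ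
  stable_xy : 2 * r.ρx * r.ρy * (3 * r.ρxy ^ 2 + 2 * |r.ρxy| + 1) ≤ κ

/-- Finitely many strict inequalities have a common margin, given by the maximum of the five
quantities involved. -/
lemma Corr.Stable.exists_stableWith {r : Corr} (hr : r.Stable) : ∃ κ, r.StableWith κ := by
  set a := 2 * r.ρx ^ 2 * (1 + 2 * |r.ρxy|) with ha
  set b := 2 * r.ρy ^ 2 * (1 + 2 * |r.ρxy|) with hb
  set c := 2 * r.ρx * r.ρy * (3 * r.ρxy ^ 2 + 2 * |r.ρxy| + 1) with hc
  refine ⟨max r.ρx (max r.ρy (max a (max b c))), ?_⟩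
  constructor
  · exact hr.ρx_nonneg.trans (le_max_left _ _)
  · simp only [max_lt_iff]
    exact ⟨hr.ρx_lt_one, hr.ρy_lt_one, hr.stable_x, hr.stable_y, hr.stable_xy⟩
  · exact hr.ρx_nonneg
  · exact hr.ρy_nonneg
  · simp
  · simp
  · exact abs_le.2 ⟨hr.neg_one_le, hr.le_one⟩
  · simp [← ha]
  · simp [← hb]
  · simp [← hc]

/-- The variance of `a Z + b Z'` for standard normal variables with correlation `ρ`. -/
def corrVar (ρ a b : ℝ) : ℝ≥0 := Real.toNNReal (a ^ 2 + b ^ 2 + 2 * ρ * a * b)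

lemma coe_corrVar {ρ : ℝ} (hρ : |ρ| ≤ 1) (a b : ℝ) :
    (corrVar ρ a b : ℝ) = a ^ 2 + b ^ 2 + 2 * ρ * a * b := by
  rw [corrVar, Real.coe_toNNReal]
  obtain ⟨h1, h2⟩ := abs_le.1 hρ
  nlinarith [mul_nonneg (sub_nonneg.2 h2) (sq_nonneg (a - b)),
    mul_nonneg (by linarith : 0 ≤ 1 + ρ) (sq_nonneg (a + b))]

lemma corrVar_le {ρ : ℝ} (hρ : |ρ| ≤ 1) (a b : ℝ) :
    (corrVar ρ a b : ℝ) ≤ 2 * (a ^ 2 + b ^ 2) := by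
  rw [coe_corrVar hρ]
  obtain ⟨h1, h2⟩ := abs_le.1 hρ
  nlinarith [mul_nonneg (sub_nonneg.2 h2) (sq_nonneg (a + b)),
    mul_nonneg (by linarith : 0 ≤ 1 + ρ) (sq_nonneg (a - b))]

/-- With `q = u² + w²` the moment is `1 + q + q²/2 + 2 q ρ u w + 3 ρ² u² w²`. Using `|u w| ≤ q/2`,
the quartic part is at most `(1/2 + |ρ|)(u⁴ + w⁴) + (1 + 2|ρ| + 3ρ²) u² w²`. Its three coefficients
are those in the three stability conditions, which bound the quartic part by `κ (X² + Y² + 2XY)/4`.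
-/
lemma Corr.StableWith.integral_normSq_stepNum_le {r : Corr} {κ : ℝ} (hr : r.StableWith κ)
    {u w X Y : ℝ} (hX : 0 ≤ X) (hY : 0 ≤ Y) (hu : u ^ 2 ≤ r.ρx * X) (hw : w ^ 2 ≤ r.ρy * Y) :
    ∫ s, ‖stepNum (u ^ 2 + w ^ 2) s‖ ^ 2 ∂gaussianReal 0 (corrVar r.ρxy u w) ≤
      1 + κ * (X + Y + (X + Y) ^ 2 / 4) := by
  rw [integral_normSq_stepNum, coe_corrVar hr.abs_le_one]
  set ρ := r.ρxy
  have hρx := hr.ρx_nonneg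
  have hρy := hr.ρy_nonneg
  have hx1 : u ^ 2 ≤ κ * X := hu.trans (by gcongr; exact hr.ρx_le)
  have hy1 : w ^ 2 ≤ κ * Y := hw.trans (by gcongr; exact hr.ρy_le)
  have huw : |u * w| ≤ (u ^ 2 + w ^ 2) / 2 := by
    rw [abs_le]; constructor <;> nlinarith [sq_nonneg (u - w), sq_nonneg (u + w)]
  have hρuw : ρ * (u * w) ≤ |ρ| * ((u ^ 2 + w ^ 2) / 2) := by
    calc ρ * (u * w) ≤ |ρ * (u * w)| := le_abs_self _
      _ = |ρ| * |u * w| := abs_mul _ _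
      _ ≤ _ := by gcongr
  have h1 : (1 + (u ^ 2 + w ^ 2) / 2) ^ 2 - (u ^ 2 + w ^ 2) / 2 * (u ^ 2 + w ^ 2 + 2 * ρ * u * w) +
      3 * (u ^ 2 + w ^ 2 + 2 * ρ * u * w) ^ 2 / 4 = 1 + (u ^ 2 + w ^ 2) +
        (u ^ 2 + w ^ 2) ^ 2 / 2 + 2 * (u ^ 2 + w ^ 2) * (ρ * (u * w)) +
          3 * ρ ^ 2 * (u ^ 2 * w ^ 2) := by ring
  rw [h1]
  have h2 : 2 * (u ^ 2 + w ^ 2) * (ρ * (u * w)) ≤ |ρ| * (u ^ 2 + w ^ 2) ^ 2 := by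
    calc _ ≤ 2 * (u ^ 2 + w ^ 2) * (|ρ| * ((u ^ 2 + w ^ 2) / 2)) := by gcongr
      _ = _ := by ring
  have hu2 : (u ^ 2) ^ 2 ≤ (r.ρx * X) ^ 2 := by gcongr
  have hw2 : (w ^ 2) ^ 2 ≤ (r.ρy * Y) ^ 2 := by gcongr
  have huw2 : u ^ 2 * w ^ 2 ≤ (r.ρx * X) * (r.ρy * Y) := by gcongr
  have habs := abs_nonneg ρ
  have k1 : (u ^ 2) ^ 2 * (1 / 2 + |ρ|) ≤ κ * X ^ 2 / 4 := by
    calc _ ≤ (r.ρx * X) ^ 2 * (1 / 2 + |ρ|) := by gcongr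
      _ = 2 * r.ρx ^ 2 * (1 + 2 * |ρ|) * X ^ 2 / 4 := by ring
      _ ≤ _ := by gcongr; exact hr.stable_x
  have k2 : (w ^ 2) ^ 2 * (1 / 2 + |ρ|) ≤ κ * Y ^ 2 / 4 := by
    calc _ ≤ (r.ρy * Y) ^ 2 * (1 / 2 + |ρ|) := by gcongr
      _ = 2 * r.ρy ^ 2 * (1 + 2 * |ρ|) * Y ^ 2 / 4 := by ring
      _ ≤ _ := by gcongr; exact hr.stable_y
  have k3 : u ^ 2 * w ^ 2 * (3 * ρ ^ 2 + 2 * |ρ| + 1) ≤ κ * (X * Y) / 2 := by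
    calc _ ≤ (r.ρx * X) * (r.ρy * Y) * (3 * ρ ^ 2 + 2 * |ρ| + 1) := by gcongr
      _ = 2 * r.ρx * r.ρy * (3 * ρ ^ 2 + 2 * |ρ| + 1) * (X * Y) / 2 := by ring
      _ ≤ _ := by gcongr; exact hr.stable_xy
  nlinarith

/-- The drift only adds to the imaginary part of `L`, so `|1 + L|² ≥ (1 + Re L)²`. Since `X + Y = 2
Re L`, numerator and denominator involve the same quantity `2 Re L + (Re L)²`. -/
lemma Corr.StableWith.integral_normSq_stepApprox_le {r : Corr} {κ : ℝ} (hr : r.StableWith κ)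
    {u w X Y : ℝ} {L : ℂ} (hX : 0 ≤ X) (hY : 0 ≤ Y) (hu : u ^ 2 ≤ r.ρx * X)
    (hw : w ^ 2 ≤ r.ρy * Y) (hL : L.re = (X + Y) / 2) :
    ∫ s, ‖stepApprox (u ^ 2 + w ^ 2) L s‖ ^ 2 ∂gaussianReal 0 (corrVar r.ρxy u w) ≤
      (1 + κ * (2 * L.re + L.re ^ 2)) / (1 + (2 * L.re + L.re ^ 2)) := by
  have h1 := hr.integral_normSq_stepNum_le hX hY hu hw
  have h0 : 0 ≤ L.re := by rw [hL]; positivity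
  have h2 : (1 + L.re) ^ 2 ≤ ‖1 + L‖ ^ 2 := by
    have := Complex.re_le_norm (1 + L)
    simp only [add_re, one_re] at this
    gcongr
  simp_rw [stepApprox, norm_div, div_pow]
  rw [integral_div]
  have e : X + Y + (X + Y) ^ 2 / 4 = 2 * L.re + L.re ^ 2 := by rw [hL]; ring
  rw [e] at h1
  have h3 : (1 + L.re) ^ 2 = 1 + (2 * L.re + L.re ^ 2) := by ring
  rw [h3] at h2
  have := hr.nonneg
  exact div_le_div₀ (by positivity) h1 (by positivity) h2

/-- For resolved frequencies the one-step growth decays exponentially in `A`, so `N` steps give `exp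
(-(1-κ) N A / 2)`, as for the heat equation. -/
lemma growth_le_exp {κ A : ℝ} (hκ : κ < 1) (hA : 0 ≤ A) (hA1 : A ≤ 1) :
    (1 + κ * (2 * A + A ^ 2)) / (1 + (2 * A + A ^ 2)) ≤ Real.exp (-((1 - κ) * A / 2)) := by
  have h1 : (1 + κ * (2 * A + A ^ 2)) / (1 + (2 * A + A ^ 2)) ≤ 1 - (1 - κ) * A / 2 := by
    rw [div_le_iff₀ (by positivity)]
    have : 0 ≤ (1 - κ) * A * (3 - A ^ 2) := by
      apply mul_nonneg (mul_nonneg (by linarith) hA); nlinarith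
    nlinarith
  have := Real.add_one_le_exp (-((1 - κ) * A / 2))
  linarith

/-- The quotient decreases in `2A + A²`, which is at least `3`. This is the contraction rate whose
square root becomes `θ`; no decay in the frequency is gained. -/
lemma growth_le_const {κ A : ℝ} (hκ : κ < 1) (hA1 : 1 ≤ A) :
    (1 + κ * (2 * A + A ^ 2)) / (1 + (2 * A + A ^ 2)) ≤ (1 + 3 * κ) / 4 := by
  rw [div_le_div_iff₀ (by positivity) (by norm_num)]
  have : 0 ≤ (1 - κ) * (2 * A + A ^ 2 - 3) := mul_nonneg (by linarith) (by nlinarith)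
  nlinarith

/-! ### Comparison of exponentials -/

/-- The mean value inequality on the convex half-plane `Re ≤ M`, which retains the decay factor `exp
M`. -/
lemma norm_cexp_sub_cexp_le {z w : ℂ} {M : ℝ} (hz : z.re ≤ M) (hw : w.re ≤ M) :
    ‖cexp z - cexp w‖ ≤ Real.exp M * ‖z - w‖ := by
  have hs : Convex ℝ {z : ℂ | z.re ≤ M} := convex_halfSpace_re_le M
  refine hs.norm_image_sub_le_of_norm_deriv_le (f := cexp)
    (fun x _ => Complex.differentiable_exp.differentiableAt) (fun x hx => ?_) hw hz
  rw [Complex.deriv_exp, Complex.norm_exp]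
  exact Real.exp_le_exp.2 hx

/-! ### The multipliers of the scheme and of the equation -/

/-- The symbol of the implicit part of the scheme is `1 + implicitSymbol`. -/
def implicitSymbol (μx μy k hx hy ξ η : ℝ) : ℂ :=
  ((k / 2 * (symS hx ξ ^ 2 + symS hy η ^ 2) : ℝ) : ℂ) +
    ((k * (μx * symC hx ξ + μy * symC hy η) : ℝ) : ℂ) * I

/-- The coefficient of the normalised increment in the symbol of the explicit part. -/
def noiseSymbol (ρ k h ξ : ℝ) : ℝ := √(ρ * k) * symC h ξ

/-- The multiplier of one step of the scheme at the frequency `(ξ, η)`. -/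
def schemeMult (r : Corr) (μx μy k hx hy ξ η zx zy : ℝ) : ℂ :=
  stepApprox (noiseSymbol r.ρx k hx ξ ^ 2 + noiseSymbol r.ρy k hy η ^ 2)
    (implicitSymbol μx μy k hx hy ξ η)
    (noiseSymbol r.ρx k hx ξ * zx + noiseSymbol r.ρy k hy η * zy)

/-- The multiplier of the solution operator of the equation up to time `t`. -/
def exactMult (r : Corr) (μx μy t m₁ m₂ ξ η : ℝ) : ℂ :=
  cexp (((-(((1 - r.ρx) * ξ ^ 2 + (1 - r.ρy) * η ^ 2) * t / 2) : ℝ) : ℂ) -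
    (((μx * ξ + μy * η) * t + (√r.ρx * ξ * m₁ + √r.ρy * η * m₂) : ℝ) : ℂ) * I)

/-- Normalised increments `zx, zy` over `N` steps of two Brownian motions with correlation `ρ`,
and their values `mx, my` at the final time `T`. -/
structure IsGaussianNoise {Ω : Type*} [MeasurableSpace Ω] (ρ T : ℝ) {N : ℕ}
    (zx zy : Fin N → Ω → ℝ) (mx my : Ω → ℝ) (P : Measure Ω) : Prop where
  law : ∀ a b : ℝ, HasLaw (fun ω i => a * zx i ω + b * zy i ω)
    (Measure.pi fun _ : Fin N => gaussianReal 0 (corrVar ρ a b)) P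
  aemeasurable_x : AEMeasurable mx P
  aemeasurable_y : AEMeasurable my P
  sum_x : ∀ᵐ ω ∂P, √(T / N) * ∑ i, zx i ω = mx ω
  sum_y : ∀ᵐ ω ∂P, √(T / N) * ∑ i, zy i ω = my ω
  sq_x : ∫⁻ ω, ENNReal.ofReal (mx ω ^ 2) ∂P ≤ ENNReal.ofReal T
  sq_y : ∫⁻ ω, ENNReal.ofReal (my ω ^ 2) ∂P ≤ ENNReal.ofReal T

lemma implicitSymbol_re (μx μy k hx hy ξ η : ℝ) :
    (implicitSymbol μx μy k hx hy ξ η).re = (k * symS hx ξ ^ 2 + k * symS hy η ^ 2) / 2 := by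
  simp only [implicitSymbol, add_re, ofReal_re, mul_re, I_re, I_im, ofReal_im]; ring

lemma noiseSymbol_sq_le {ρ k : ℝ} (hρ : 0 ≤ ρ) (hk : 0 ≤ k) (h ξ : ℝ) :
    noiseSymbol ρ k h ξ ^ 2 ≤ ρ * (k * symS h ξ ^ 2) := by
  rw [noiseSymbol, mul_pow, Real.sq_sqrt (by positivity), mul_assoc]
  exact mul_le_mul_of_nonneg_left
    (mul_le_mul_of_nonneg_left (symC_sq_le_symS_sq h ξ) hk) hρ

/-- Exponents add, so the product sees the increments only through their sum, the terminal value of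
the noise. -/
lemma prod_stepExact (q : ℝ) (L : ℂ) {N : ℕ} (s : Fin N → ℝ) :
    ∏ i, stepExact q L (s i) = cexp (N * (q / 2 - L) - I * (∑ i, s i : ℝ)) := by
  simp only [stepExact]
  rw [← Complex.exp_sum]
  congr 1
  push_cast
  rw [Finset.mul_sum, Finset.sum_sub_distrib, Finset.sum_sub_distrib]
  simp; ring

lemma abs_cube_le (x y : ℝ) : |x| ^ 3 ≤ (1 + x ^ 2 + y ^ 2) ^ 2 := by
  have h : x ^ 2 = |x| ^ 2 := (sq_abs x).symm
  rw [h]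
  nlinarith [sq_nonneg y, sq_nonneg (|x| ^ 2 - |x|), abs_nonneg x, sq_nonneg (|x|),
    mul_nonneg (sq_nonneg |x|) (sq_nonneg y), sq_nonneg (y ^ 2)]

lemma abs_cube_le' (x y : ℝ) : |y| ^ 3 ≤ (1 + x ^ 2 + y ^ 2) ^ 2 := by
  have := abs_cube_le y x
  rwa [show 1 + y ^ 2 + x ^ 2 = 1 + x ^ 2 + y ^ 2 by ring] at this

lemma pow_four_le (x y : ℝ) : x ^ 4 ≤ (1 + x ^ 2 + y ^ 2) ^ 2 := by
  nlinarith [sq_nonneg x, sq_nonneg y, mul_nonneg (sq_nonneg x) (sq_nonneg y), sq_nonneg (y ^ 2)]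

lemma pow_four_le' (x y : ℝ) : y ^ 4 ≤ (1 + x ^ 2 + y ^ 2) ^ 2 := by
  nlinarith [sq_nonneg x, sq_nonneg y, mul_nonneg (sq_nonneg x) (sq_nonneg y), sq_nonneg (x ^ 2)]

lemma norm_exactMult (r : Corr) (μx μy t m₁ m₂ ξ η : ℝ) :
    ‖exactMult r μx μy t m₁ m₂ ξ η‖ =
      Real.exp (-(((1 - r.ρx) * ξ ^ 2 + (1 - r.ρy) * η ^ 2) * t / 2)) := by
  rw [exactMult, Complex.norm_exp]
  simp only [sub_re, ofReal_re, mul_re, I_re, I_im, ofReal_im]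
  congr 1; ring

lemma Corr.StableWith.norm_exactMult_le {r : Corr} {κ : ℝ} (hr : r.StableWith κ)
    {t : ℝ} (ht : 0 ≤ t) (μx μy m₁ m₂ ξ η : ℝ) :
    ‖exactMult r μx μy t m₁ m₂ ξ η‖ ≤ Real.exp (-((1 - κ) * t * (ξ ^ 2 + η ^ 2) / 2)) := by
  rw [norm_exactMult]
  apply Real.exp_le_exp.2
  have h1 : (1 - κ) * ξ ^ 2 ≤ (1 - r.ρx) * ξ ^ 2 := by gcongr; exact hr.ρx_le
  have h2 : (1 - κ) * η ^ 2 ≤ (1 - r.ρy) * η ^ 2 := by gcongr; exact hr.ρy_le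
  nlinarith

/-- The error caused by the discretisation of the symbols alone. -/
lemma Corr.StableWith.norm_discExact_sub_exactMult_le {r : Corr} {κ : ℝ} (hr : r.StableWith κ)
    {μx μy T k hx hy ξ η mx my : ℝ} {N : ℕ} (hk : 0 ≤ k) (hN : N * k = T) (hhx : 0 < hx)
    (hhy : 0 < hy) (hξ : |ξ| * hx ≤ Real.pi) (hη : |η| * hy ≤ Real.pi) :
    ‖cexp (N * (((noiseSymbol r.ρx k hx ξ ^ 2 + noiseSymbol r.ρy k hy η ^ 2 : ℝ) : ℂ) / 2
        - implicitSymbol μx μy k hx hy ξ η) -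
          I * ((√r.ρx * symC hx ξ * mx + √r.ρy * symC hy η * my : ℝ) : ℂ))
      - exactMult r μx μy T mx my ξ η‖ ≤
    Real.exp (-((1 - κ) * T * (ξ ^ 2 + η ^ 2) / 5)) * ((hx ^ 2 + hy ^ 2) *
      (1 + ξ ^ 2 + η ^ 2) ^ 2 * (5 * T / 2 + 2 * T * (|μx| + |μy|) + 2 * |mx| + 2 * |my|)) := by
  have hT : 0 ≤ T := by rw [← hN]; positivity
  have hρx := hr.ρx_nonneg
  have hρy := hr.ρy_nonneg
  have hρx1 : r.ρx ≤ 1 := hr.ρx_le.trans hr.lt_one.le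
  have hρy1 : r.ρy ≤ 1 := hr.ρy_le.trans hr.lt_one.le
  set cx := symC hx ξ
  set cy := symC hy η
  set sx := symS hx ξ
  set sy := symS hy η
  set Q := (1 + ξ ^ 2 + η ^ 2) ^ 2 with hQ
  have hQ0 : 0 ≤ Q := by positivity
  have q1 : noiseSymbol r.ρx k hx ξ ^ 2 = r.ρx * k * cx ^ 2 := by
    rw [noiseSymbol, mul_pow, Real.sq_sqrt (by positivity)]
  have q2 : noiseSymbol r.ρy k hy η ^ 2 = r.ρy * k * cy ^ 2 := by
    rw [noiseSymbol, mul_pow, Real.sq_sqrt (by positivity)]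
  have ez : (N * (((noiseSymbol r.ρx k hx ξ ^ 2 + noiseSymbol r.ρy k hy η ^ 2 : ℝ) : ℂ) / 2
        - implicitSymbol μx μy k hx hy ξ η) -
          I * ((√r.ρx * cx * mx + √r.ρy * cy * my : ℝ) : ℂ)) =
      ((T / 2 * (r.ρx * cx ^ 2 - sx ^ 2 + (r.ρy * cy ^ 2 - sy ^ 2)) : ℝ) : ℂ) -
        ((T * (μx * cx + μy * cy) + (√r.ρx * cx * mx + √r.ρy * cy * my) : ℝ) : ℂ) * I := by
    rw [q1, q2, implicitSymbol, ← hN]; push_cast; ring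
  rw [ez, exactMult]
  have hcx := symC_sq_le_symS_sq hx ξ
  have hcy := symC_sq_le_symS_sq hy η
  have hsx := le_symS_sq hhx hξ
  have hsy := le_symS_sq hhy hη
  have hκ0 : 0 ≤ 1 - κ := by linarith [hr.lt_one]
  -- `M` lies above both real parts. For the discrete exponent this uses `symS² ≥ (2/5) ξ²`, whose
  -- half is the `1/5`; the exact exponent decays faster.
  refine (norm_cexp_sub_cexp_le (M := -((1 - κ) * T * (ξ ^ 2 + η ^ 2) / 5)) ?_ ?_).trans ?_
  · simp only [sub_re, ofReal_re, mul_re, I_re, I_im, ofReal_im]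
    have a1 : r.ρx * cx ^ 2 - sx ^ 2 ≤ -((1 - κ) * (2 / 5 * ξ ^ 2)) := by
      have : r.ρx * cx ^ 2 ≤ κ * sx ^ 2 :=
        mul_le_mul hr.ρx_le hcx (sq_nonneg _) hr.nonneg
      nlinarith
    have a2 : r.ρy * cy ^ 2 - sy ^ 2 ≤ -((1 - κ) * (2 / 5 * η ^ 2)) := by
      have : r.ρy * cy ^ 2 ≤ κ * sy ^ 2 :=
        mul_le_mul hr.ρy_le hcy (sq_nonneg _) hr.nonneg
      nlinarith
    nlinarith
  · simp only [sub_re, ofReal_re, mul_re, I_re, I_im, ofReal_im]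
    have h1 : (1 - κ) * ξ ^ 2 ≤ (1 - r.ρx) * ξ ^ 2 := by gcongr; exact hr.ρx_le
    have h2 : (1 - κ) * η ^ 2 ≤ (1 - r.ρy) * η ^ 2 := by gcongr; exact hr.ρy_le
    have h3 : 0 ≤ (1 - κ) * T * (ξ ^ 2 + η ^ 2) := by positivity
    nlinarith
  · gcongr
    have e : (((T / 2 * (r.ρx * cx ^ 2 - sx ^ 2 + (r.ρy * cy ^ 2 - sy ^ 2)) : ℝ) : ℂ) -
        ((T * (μx * cx + μy * cy) + (√r.ρx * cx * mx + √r.ρy * cy * my) : ℝ) : ℂ) * I) -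
        ((((-(((1 - r.ρx) * ξ ^ 2 + (1 - r.ρy) * η ^ 2) * T / 2) : ℝ) : ℂ) -
    (((μx * ξ + μy * η) * T + (√r.ρx * ξ * mx + √r.ρy * η * my) : ℝ) : ℂ) * I)) =
      ((T / 2 * (r.ρx * (cx ^ 2 - ξ ^ 2) - (sx ^ 2 - ξ ^ 2) +
        (r.ρy * (cy ^ 2 - η ^ 2) - (sy ^ 2 - η ^ 2))) : ℝ) : ℂ) -
      ((T * (μx * (cx - ξ) + μy * (cy - η)) + (√r.ρx * (cx - ξ) * mx + √r.ρy * (cy - η) * my)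
        : ℝ) : ℂ) * I := by push_cast; ring
    rw [e]
    have b1 : |cx - ξ| ≤ 2 * hx ^ 2 * Q :=
      (abs_symC_sub_le hhx ξ).trans (by gcongr; exact abs_cube_le ξ η)
    have b2 : |cy - η| ≤ 2 * hy ^ 2 * Q :=
      (abs_symC_sub_le hhy η).trans (by gcongr; exact abs_cube_le' ξ η)
    have b3 : |cx ^ 2 - ξ ^ 2| ≤ 4 * hx ^ 2 * Q :=
      (abs_symC_sq_sub_le hhx ξ).trans (by gcongr; exact pow_four_le ξ η)
    have b4 : |cy ^ 2 - η ^ 2| ≤ 4 * hy ^ 2 * Q :=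
      (abs_symC_sq_sub_le hhy η).trans (by gcongr; exact pow_four_le' ξ η)
    have b5 : |sx ^ 2 - ξ ^ 2| ≤ hx ^ 2 * Q :=
      (abs_symS_sq_sub_le hhx ξ).trans (by gcongr; exact pow_four_le ξ η)
    have b6 : |sy ^ 2 - η ^ 2| ≤ hy ^ 2 * Q :=
      (abs_symS_sq_sub_le hhy η).trans (by gcongr; exact pow_four_le' ξ η)
    have hsρx : √r.ρx ≤ 1 := Real.sqrt_le_one.2 hρx1
    have hsρy : √r.ρy ≤ 1 := Real.sqrt_le_one.2 hρy1
    refine (norm_sub_le _ _).trans ?_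
    rw [norm_mul, Complex.norm_I, mul_one, Complex.norm_real, Complex.norm_real, Real.norm_eq_abs,
      Real.norm_eq_abs]
    have c1 : |T / 2 * (r.ρx * (cx ^ 2 - ξ ^ 2) - (sx ^ 2 - ξ ^ 2) +
        (r.ρy * (cy ^ 2 - η ^ 2) - (sy ^ 2 - η ^ 2)))| ≤
        T / 2 * ((1 * (4 * hx ^ 2 * Q) + hx ^ 2 * Q) + (1 * (4 * hy ^ 2 * Q) + hy ^ 2 * Q)) := by
      rw [abs_mul, abs_of_nonneg (by positivity : 0 ≤ T / 2)]
      gcongr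
      refine (abs_add_le _ _).trans (add_le_add ((abs_sub _ _).trans ?_) ((abs_sub _ _).trans ?_))
      · rw [abs_mul, abs_of_nonneg hρx]; gcongr
      · rw [abs_mul, abs_of_nonneg hρy]; gcongr
    have c2 : |T * (μx * (cx - ξ) + μy * (cy - η)) +
        (√r.ρx * (cx - ξ) * mx + √r.ρy * (cy - η) * my)| ≤
        T * (|μx| * (2 * hx ^ 2 * Q) + |μy| * (2 * hy ^ 2 * Q)) +
          (1 * (2 * hx ^ 2 * Q) * |mx| + 1 * (2 * hy ^ 2 * Q) * |my|) := by
      refine (abs_add_le _ _).trans (add_le_add ?_ ((abs_add_le _ _).trans (add_le_add ?_ ?_)))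
      · rw [abs_mul, abs_of_nonneg hT]
        gcongr
        refine (abs_add_le _ _).trans (add_le_add ?_ ?_)
        · rw [abs_mul]; gcongr
        · rw [abs_mul]; gcongr
      · rw [abs_mul, abs_mul, abs_of_nonneg (Real.sqrt_nonneg _)]; gcongr
      · rw [abs_mul, abs_mul, abs_of_nonneg (Real.sqrt_nonneg _)]; gcongr
    refine (add_le_add c1 c2).trans ?_
    have p1 : 0 ≤ hx ^ 2 * Q := by positivity
    have p2 : 0 ≤ hy ^ 2 * Q := by positivity
    have p3 := abs_nonneg μx
    have p4 := abs_nonneg μy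
    have p5 := abs_nonneg mx
    have p6 := abs_nonneg my
    have t1 : 0 ≤ (hx ^ 2 * Q) * (T * |μy|) := by positivity
    have t2 : 0 ≤ (hy ^ 2 * Q) * (T * |μx|) := by positivity
    have t3 : 0 ≤ (hx ^ 2 * Q) * |my| := by positivity
    have t4 : 0 ≤ (hy ^ 2 * Q) * |mx| := by positivity
    linarith

/-! ### Mean square error of the multipliers at low and high frequencies. -/

lemma norm_implicitSymbol_le {hx hy : ℝ} (hhx : 0 < hx) (hhy : 0 < hy) {k : ℝ} (hk : 0 ≤ k)
    (μx μy ξ η : ℝ) :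
    ‖implicitSymbol μx μy k hx hy ξ η‖ ≤ (2 + |μx| + |μy|) * k * (1 + ξ ^ 2 + η ^ 2) := by
  have h1 := symS_sq_le hhx ξ
  have h2 := symS_sq_le hhy η
  have h3 := abs_symC_le hhx ξ
  have h4 := abs_symC_le hhy η
  have x1 : |ξ| ≤ 1 + ξ ^ 2 + η ^ 2 := by
    rw [← sq_abs ξ]; nlinarith [sq_nonneg (|ξ| - 1), sq_nonneg η]
  have y1 : |η| ≤ 1 + ξ ^ 2 + η ^ 2 := by
    rw [← sq_abs η]; nlinarith [sq_nonneg (|η| - 1), sq_nonneg ξ]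
  rw [implicitSymbol]
  refine (norm_add_le _ _).trans ?_
  rw [norm_mul, Complex.norm_I, mul_one, Complex.norm_real, Complex.norm_real,
    Real.norm_of_nonneg (by positivity), Real.norm_eq_abs, abs_mul, abs_of_nonneg hk]
  have h5 : |μx * symC hx ξ + μy * symC hy η| ≤
      |μx| * (1 + ξ ^ 2 + η ^ 2) + |μy| * (1 + ξ ^ 2 + η ^ 2) := by
    refine (abs_add_le _ _).trans (add_le_add ?_ ?_)
    · rw [abs_mul]; gcongr; exact h3.trans x1
    · rw [abs_mul]; gcongr; exact h4.trans y1
  calc _ ≤ k / 2 * (ξ ^ 2 + η ^ 2) +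
        k * (|μx| * (1 + ξ ^ 2 + η ^ 2) + |μy| * (1 + ξ ^ 2 + η ^ 2)) := by gcongr
    _ ≤ _ := by
      have : 0 ≤ k * (2 + 3 / 2 * (ξ ^ 2 + η ^ 2)) := by positivity
      linarith

set_option maxHeartbeats 1000000 in
/-- The error caused by the time discretisation, at frequencies which are small compared with
`k ^ (-1 / 2)`. -/
lemma Corr.StableWith.exists_time_error {r : Corr} {κ : ℝ} (hr : r.StableWith κ)
    (μx μy : ℝ) {T : ℝ} (hT : 0 < T) : ∃ C : ℝ, 0 < C ∧
    ∀ (N : ℕ) (hx hy ξ η : ℝ), 1 ≤ N → 0 < hx → 0 < hy → |ξ| * hx ≤ Real.pi →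
      |η| * hy ≤ Real.pi → (implicitSymbol μx μy (T / N) hx hy ξ η).re ≤ 1 →
      ∫ z : Fin N → ℝ, ‖∏ i, stepApprox (noiseSymbol r.ρx (T / N) hx ξ ^ 2 +
            noiseSymbol r.ρy (T / N) hy η ^ 2) (implicitSymbol μx μy (T / N) hx hy ξ η) (z i) -
          ∏ i, stepExact (noiseSymbol r.ρx (T / N) hx ξ ^ 2 +
            noiseSymbol r.ρy (T / N) hy η ^ 2) (implicitSymbol μx μy (T / N) hx hy ξ η) (z i)‖ ^ 2
        ∂Measure.pi (fun _ => gaussianReal 0 (corrVar r.ρxy (noiseSymbol r.ρx (T / N) hx ξ)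
          (noiseSymbol r.ρy (T / N) hy η))) ≤
      C * (T / N) ^ 2 * (1 + ξ ^ 2 + η ^ 2) ^ 4 *
        Real.exp (-((1 - κ) * T * (ξ ^ 2 + η ^ 2) / 10)) := by
  set K := 2 + |μx| + |μy| with hK
  have hK2 : 2 ≤ K := by have := abs_nonneg μx; have := abs_nonneg μy; linarith
  -- `A ≤ 1` forces `k (ξ² + η²) ≤ 5`, so the local scale `K k (1 + ξ² + η²)` never exceeds `K (T +
  -- 5)` and the consistency constant is uniform.
  obtain ⟨C₁, hC₁, hcons⟩ := exists_step_consistency (K * (T + 5)) (by positivity)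
  refine ⟨2 * C₁ * K ^ 3 * T + 8 * C₁ ^ 2 * K ^ 4 * T ^ 2, by positivity, ?_⟩
  intro N hx hy ξ η hN hhx hhy hξ hη hA
  have hN0 : (0 : ℝ) < N := by exact_mod_cast hN
  set k := T / N with hk
  have hk0 : 0 < k := by positivity
  have hNk : N * k = T := by rw [hk]; field_simp
  have hkT : k ≤ T := by
    rw [hk]; exact div_le_self hT.le (by exact_mod_cast hN)
  set u := noiseSymbol r.ρx k hx ξ
  set w := noiseSymbol r.ρy k hy η
  set L := implicitSymbol μx μy k hx hy ξ η
  set A := L.re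
  set Q := 1 + ξ ^ 2 + η ^ 2 with hQ
  have hQ1 : 1 ≤ Q := by have := sq_nonneg ξ; have := sq_nonneg η; linarith
  have hAe : A = (k * symS hx ξ ^ 2 + k * symS hy η ^ 2) / 2 := implicitSymbol_re ..
  have hA0 : 0 ≤ A := by rw [hAe]; positivity
  have hsx := le_symS_sq hhx hξ
  have hsy := le_symS_sq hhy hη
  have hκ0 : 0 < 1 - κ := by linarith [hr.lt_one]
  have hkA : k * (ξ ^ 2 + η ^ 2) ≤ 5 * A := by rw [hAe]; nlinarith
  have hNA : T * (ξ ^ 2 + η ^ 2) ≤ 5 * (N * A) := by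
    calc T * (ξ ^ 2 + η ^ 2) = N * (k * (ξ ^ 2 + η ^ 2)) := by rw [← hNk]; ring
      _ ≤ N * (5 * A) := by gcongr
      _ = _ := by ring
  have hu := noiseSymbol_sq_le hr.ρx_nonneg hk0.le hx ξ
  have hw := noiseSymbol_sq_le hr.ρy_nonneg hk0.le hy η
  have hX : 0 ≤ k * symS hx ξ ^ 2 := by positivity
  have hY : 0 ≤ k * symS hy η ^ 2 := by positivity
  have hqA : u ^ 2 + w ^ 2 ≤ κ * (2 * A) := by
    have h1 : u ^ 2 ≤ κ * (k * symS hx ξ ^ 2) := hu.trans (by gcongr; exact hr.ρx_le)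
    have h2 : w ^ 2 ≤ κ * (k * symS hy η ^ 2) := hw.trans (by gcongr; exact hr.ρy_le)
    rw [hAe]; linarith
  have hqQ : 2 * (u ^ 2 + w ^ 2) ≤ K * k * Q := by
    have h1 : κ * (2 * A) ≤ 1 * (2 * A) := by gcongr; exact hr.lt_one.le
    have h2 : 2 * A ≤ k * Q := by
      have := symS_sq_le hhx ξ
      have := symS_sq_le hhy η
      rw [hAe, hQ]; nlinarith
    have h3 : 2 * (k * Q) ≤ K * (k * Q) := by gcongr
    nlinarith
  -- The local scale `r` of the consistency estimate: it dominates `q`, the variance and `|L|`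
  -- simultaneously.
  set ρ' := K * k * Q with hρ'
  have hρ0 : 0 < ρ' := by positivity
  have hρR : ρ' ≤ K * (T + 5) := by
    rw [hρ', mul_assoc]
    gcongr
    rw [hQ]
    nlinarith
  have hq0 : 0 ≤ u ^ 2 + w ^ 2 := by positivity
  obtain ⟨c1, c2, c3⟩ := hcons ρ' (u ^ 2 + w ^ 2) (corrVar r.ρxy u w) L hρ0 hρR hq0
    (by linarith) ((corrVar_le hr.abs_le_one u w).trans hqQ) hA0
    (norm_implicitSymbol_le hhx hhy hk0.le μx μy ξ η)
  set m := Real.exp (-((1 - κ) * A / 2)) with hm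
  have hm0 : 0 < m := Real.exp_pos _
  have hα := (hr.integral_normSq_stepApprox_le (L := L) hX hY hu hw hAe).trans
    (growth_le_exp hr.lt_one hA0 hA)
  have hγ : ∫ s, ‖stepExact (u ^ 2 + w ^ 2) L s‖ ^ 2 ∂gaussianReal 0 (corrVar r.ρxy u w) ≤ m := by
    simp_rw [normSq_stepExact]
    simp only [integral_const, probReal_univ, one_smul, hm]
    apply Real.exp_le_exp.2
    have h2 : 0 ≤ (1 - κ) * A := by positivity
    show u ^ 2 + w ^ 2 - 2 * A ≤ _
    linarith
  have key := integral_normSq_prod_sub_prod_le N hm0 (memLp_stepApprox _ L _)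
    (memLp_stepExact _ L _) hα hγ c1 c2 c3
  refine key.trans ?_
  -- The accumulation estimate divides by `m` and `m²`; at low frequencies these are bounded below.
  have hm1 : 1 / 2 ≤ m := by
    have := Real.add_one_le_exp (-((1 - κ) * A / 2))
    have h2 : (1 - κ) * A ≤ 1 * 1 := by
      gcongr; linarith [hr.nonneg]
    linarith
  -- The decay rate `(1-κ)/2` per unit of `A` and `N A ≥ T (ξ² + η²)/5` combine to the `1/10`.
  have hmN : m ^ N ≤ Real.exp (-((1 - κ) * T * (ξ ^ 2 + η ^ 2) / 10)) := by
    rw [hm, ← Real.exp_nat_mul]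
    apply Real.exp_le_exp.2
    have h2 := mul_le_mul_of_nonneg_left hNA hκ0.le
    linarith
  have d1 : N * (C₁ * ρ' ^ 3 / m) ≤ 2 * C₁ * K ^ 3 * T * (k ^ 2 * Q ^ 4) := by
    have h1 : C₁ * ρ' ^ 3 / m ≤ C₁ * ρ' ^ 3 / (1 / 2) := by gcongr
    calc N * (C₁ * ρ' ^ 3 / m) ≤ N * (C₁ * ρ' ^ 3 / (1 / 2)) := by gcongr
      _ = 2 * C₁ * K ^ 3 * (N * k) * (k ^ 2 * Q ^ 3) := by rw [hρ']; ring
      _ = 2 * C₁ * K ^ 3 * T * (k ^ 2 * Q ^ 3) := by rw [hNk]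
      _ ≤ _ := by gcongr; norm_num
  have d2 : N ^ 2 * (2 * (C₁ * ρ' ^ 2) * (C₁ * ρ' ^ 2) / m ^ 2) ≤
      8 * C₁ ^ 2 * K ^ 4 * T ^ 2 * (k ^ 2 * Q ^ 4) := by
    calc _ ≤ N ^ 2 * (2 * (C₁ * ρ' ^ 2) * (C₁ * ρ' ^ 2) / (1 / 2) ^ 2) := by gcongr
      _ = 8 * C₁ ^ 2 * K ^ 4 * (N * k) ^ 2 * (k ^ 2 * Q ^ 4) := by rw [hρ']; ring
      _ = _ := by rw [hNk]
  calc _ ≤ Real.exp (-((1 - κ) * T * (ξ ^ 2 + η ^ 2) / 10)) *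
        (2 * C₁ * K ^ 3 * T * (k ^ 2 * Q ^ 4) + 8 * C₁ ^ 2 * K ^ 4 * T ^ 2 * (k ^ 2 * Q ^ 4)) :=
        mul_le_mul hmN (add_le_add d1 d2) (by positivity) (Real.exp_pos _).le
    _ = _ := by ring

/-- Half of the exponential decay absorbs the polynomial, by `y⁴/4! ≤ exp y` at `y = c (1 + x)`. -/
lemma pow_mul_exp_neg_le {c x : ℝ} (hc : 0 < c) (hx : 0 ≤ x) :
    (1 + x) ^ 4 * Real.exp (-(2 * c * x)) ≤ (24 / c ^ 4 * Real.exp c) * Real.exp (-(c * x)) := by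
  have h1 := Real.pow_div_factorial_le_exp (c * (1 + x)) (by positivity) 4
  have h2 : (1 + x) ^ 4 ≤ 24 / c ^ 4 * Real.exp (c * (1 + x)) := by
    have h3 : (c * (1 + x)) ^ 4 / (Nat.factorial 4 : ℝ) = (1 + x) ^ 4 * (c ^ 4 / 24) := by
      simp [Nat.factorial]; ring
    rw [h3] at h1
    calc (1 + x) ^ 4 = 24 / c ^ 4 * ((1 + x) ^ 4 * (c ^ 4 / 24)) := by field_simp
      _ ≤ _ := by gcongr
  calc _ ≤ (24 / c ^ 4 * Real.exp (c * (1 + x))) * Real.exp (-(2 * c * x)) := by gcongr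
    _ = 24 / c ^ 4 * (Real.exp (c * (1 + x)) * Real.exp (-(2 * c * x))) := by ring
    _ = 24 / c ^ 4 * (Real.exp c * Real.exp (-(c * x))) := by
        rw [← Real.exp_add, ← Real.exp_add]; ring_nf
    _ = _ := by ring

lemma HasLaw.lintegral_ofReal_comp {Ω X : Type*} [MeasurableSpace Ω] [MeasurableSpace X]
    {P : Measure Ω} {ν : Measure X} {s : Ω → X} (h : HasLaw s ν P) {f : X → ℝ}
    (hf : Integrable f ν) (hm : Measurable f) (h0 : ∀ x, 0 ≤ f x) :
    ∫⁻ ω, ENNReal.ofReal (f (s ω)) ∂P = ENNReal.ofReal (∫ x, f x ∂ν) := by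
  rw [ofReal_integral_eq_lintegral_ofReal hf (Filter.Eventually.of_forall h0), ← h.map_eq,
    lintegral_map' (by fun_prop) h.aemeasurable]

lemma continuous_normSq_prod (N : ℕ) {f : ℝ → ℂ} (hf : Continuous f) :
    Continuous fun z : Fin N → ℝ => ‖∏ i, f (z i)‖ ^ 2 := by fun_prop

lemma continuous_normSq_prod_sub (N : ℕ) {f g : ℝ → ℂ} (hf : Continuous f) (hg : Continuous g) :
    Continuous fun z : Fin N → ℝ => ‖∏ i, f (z i) - ∏ i, g (z i)‖ ^ 2 := by fun_prop

lemma normSq_sub_le (a b c : ℂ) : ‖a - c‖ ^ 2 ≤ 2 * ‖a - b‖ ^ 2 + 2 * ‖b - c‖ ^ 2 := by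
  have h : ‖a - c‖ ≤ ‖a - b‖ + ‖b - c‖ := norm_sub_le_norm_sub_add_norm_sub a b c
  have : ‖a - c‖ ^ 2 ≤ (‖a - b‖ + ‖b - c‖) ^ 2 := by gcongr
  nlinarith [sq_nonneg (‖a - b‖ - ‖b - c‖)]

/-- The scaled increments telescope to the terminal values, so compounding the exact steps leaves no
time discretisation error, only that of the symbols. -/
lemma prod_stepExact_noise {r : Corr} (hρx : 0 ≤ r.ρx) (hρy : 0 ≤ r.ρy) {k hx hy ξ η mx my : ℝ}
    {N : ℕ} {zx zy : Fin N → ℝ} (L : ℂ) (hmx : √k * ∑ i, zx i = mx) (hmy : √k * ∑ i, zy i = my)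
    (q : ℝ) :
    ∏ i, stepExact q L (noiseSymbol r.ρx k hx ξ * zx i + noiseSymbol r.ρy k hy η * zy i) =
      cexp (N * ((q : ℂ) / 2 - L) -
        I * ((√r.ρx * symC hx ξ * mx + √r.ρy * symC hy η * my : ℝ) : ℂ)) := by
  rw [prod_stepExact, Finset.sum_add_distrib, ← Finset.mul_sum, ← Finset.mul_sum, ← hmx, ← hmy,
    noiseSymbol, noiseSymbol, Real.sqrt_mul hρx, Real.sqrt_mul hρy]
  congr 3
  push_cast; ring

lemma add_add_sq_le (a b c : ℝ) : (a + b + c) ^ 2 ≤ 3 * (a ^ 2 + b ^ 2 + c ^ 2) := by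
  nlinarith [sq_nonneg (a - b), sq_nonneg (a - c), sq_nonneg (b - c)]

set_option maxHeartbeats 1000000 in
/-- The mean square error of the `N`-step multiplier at low frequencies. -/
lemma Corr.StableWith.exists_mult_error_low {r : Corr} {κ : ℝ} (hr : r.StableWith κ)
    (μx μy : ℝ) {T : ℝ} (hT : 0 < T) : ∃ C : ℝ, 0 < C ∧
    ∀ (Ω : Type*) [MeasurableSpace Ω] (P : Measure Ω) [IsProbabilityMeasure P] (N : ℕ)
      (zx zy : Fin N → Ω → ℝ) (mx my : Ω → ℝ), IsGaussianNoise r.ρxy T zx zy mx my P →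
    ∀ (hx hy ξ η : ℝ), 1 ≤ N → 0 < hx → 0 < hy → |ξ| * hx ≤ Real.pi →
      |η| * hy ≤ Real.pi → (implicitSymbol μx μy (T / N) hx hy ξ η).re ≤ 1 →
      ∫⁻ ω, ENNReal.ofReal (‖∏ i, schemeMult r μx μy (T / N) hx hy ξ η (zx i ω) (zy i ω) -
          exactMult r μx μy T (mx ω) (my ω) ξ η‖ ^ 2) ∂P ≤
      ENNReal.ofReal (C * (hx ^ 2 + hy ^ 2 + T / N) ^ 2 *
        ((1 + (ξ ^ 2 + η ^ 2)) ^ 4 * Real.exp (-((1 - κ) * T * (ξ ^ 2 + η ^ 2) / 10)))) := by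
  obtain ⟨C₁, hC₁, htime⟩ := hr.exists_time_error μx μy hT
  set a := 5 * T / 2 + 2 * T * (|μx| + |μy|) with ha
  have ha0 : 0 ≤ a := by positivity
  -- `2 C₁` comes from the time error. The symbol error is affine in `|M^x_T|` and `|M^y_T|`;
  -- squaring it and using that their second moments are at most `T` gives `6 (a² + 8T)`.
  refine ⟨2 * C₁ + 6 * (a ^ 2 + 8 * T), by positivity, ?_⟩
  intro Ω _ P _ N zx zy mx my hnoise hx hy ξ η hN hhx hhy hξ hη hA
  have hN0 : (0 : ℝ) < N := by exact_mod_cast hN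
  set k := T / N with hk
  have hk0 : 0 < k := by positivity
  have hNk : N * k = T := by rw [hk]; field_simp
  set u := noiseSymbol r.ρx k hx ξ with hu
  set w := noiseSymbol r.ρy k hy η with hw
  set L := implicitSymbol μx μy k hx hy ξ η with hL
  set q := u ^ 2 + w ^ 2 with hq
  set s : Ω → Fin N → ℝ := fun ω i => u * zx i ω + w * zy i ω with hs
  set Q := 1 + (ξ ^ 2 + η ^ 2) with hQ
  have hQ' : 1 + ξ ^ 2 + η ^ 2 = Q := by rw [hQ]; ring
  have hQ0 : 0 ≤ Q := by positivity
  set H := hx ^ 2 + hy ^ 2 with hH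
  have hH0 : 0 ≤ H := by positivity
  have hlaw := hnoise.law u w
  set ex := Real.exp (-((1 - κ) * T * (ξ ^ 2 + η ^ 2) / 10)) with hex
  have hex0 : 0 < ex := Real.exp_pos _
  have hκ0 : 0 < 1 - κ := by linarith [hr.lt_one]
  have hb1 := htime N hx hy ξ η hN hhx hhy hξ hη hA
  have hE : Integrable (fun z : Fin N → ℝ => ‖∏ i, stepApprox q L (z i) -
      ∏ i, stepExact q L (z i)‖ ^ 2) (Measure.pi fun _ => gaussianReal 0 (corrVar r.ρxy u w)) :=
    (integral_normSq_prod_sub_prod N (memLp_stepApprox q L _) (memLp_stepExact q L _)).1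
  have hcont := continuous_normSq_prod_sub N (continuous_stepApprox q L) (continuous_stepExact q L)
  have h1 := HasLaw.lintegral_ofReal_comp hlaw hE hcont.measurable (fun _ => by positivity)
  set G := H ^ 2 * Q ^ 4 * ex with hG
  have hG0 : 0 ≤ G := by positivity
  have hpt : ∀ᵐ ω ∂P, ENNReal.ofReal (‖∏ i, schemeMult r μx μy k hx hy ξ η (zx i ω) (zy i ω) -
          exactMult r μx μy T (mx ω) (my ω) ξ η‖ ^ 2) ≤
      ENNReal.ofReal 2 * ENNReal.ofReal (‖∏ i, stepApprox q L (s ω i) -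
        ∏ i, stepExact q L (s ω i)‖ ^ 2) + (ENNReal.ofReal (6 * G * a ^ 2) +
        (ENNReal.ofReal (24 * G) * ENNReal.ofReal (mx ω ^ 2) +
          ENNReal.ofReal (24 * G) * ENNReal.ofReal (my ω ^ 2))) := by
    filter_upwards [hnoise.sum_x, hnoise.sum_y] with ω h1 h2
    rw [← ENNReal.ofReal_mul (by norm_num), ← ENNReal.ofReal_mul (by positivity),
      ← ENNReal.ofReal_mul (by positivity), ← ENNReal.ofReal_add (by positivity) (by positivity),
      ← ENNReal.ofReal_add (by positivity) (by positivity),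
      ← ENNReal.ofReal_add (by positivity) (by positivity)]
    apply ENNReal.ofReal_le_ofReal
    have e1 : ∏ i, schemeMult r μx μy k hx hy ξ η (zx i ω) (zy i ω) =
      ∏ i, stepApprox q L (s ω i) := rfl
    rw [e1]
    refine (normSq_sub_le _ (∏ i, stepExact q L (s ω i)) _).trans ?_
    have h3 := hr.norm_discExact_sub_exactMult_le (μx := μx) (μy := μy) (mx := mx ω) (my := my ω)
      hk0.le hNk hhx hhy hξ hη
    have e2 := prod_stepExact_noise (hx := hx) (hy := hy) (ξ := ξ) (η := η)
      hr.ρx_nonneg hr.ρy_nonneg L h1 h2 q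
    rw [← e2, hQ', ← ha] at h3
    have h4 : ‖∏ i, stepExact q L (s ω i) - exactMult r μx μy T (mx ω) (my ω) ξ η‖ ^ 2 ≤
        G * (3 * (a ^ 2 + (2 * |mx ω|) ^ 2 + (2 * |my ω|) ^ 2)) := by
      calc _ ≤ (Real.exp (-((1 - κ) * T * (ξ ^ 2 + η ^ 2) / 5)) *
            (H * Q ^ 2 * (a + 2 * |mx ω| + 2 * |my ω|))) ^ 2 := by gcongr
        _ = Real.exp (-((1 - κ) * T * (ξ ^ 2 + η ^ 2) / 5)) ^ 2 * (H ^ 2 * Q ^ 4) *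
            (a + 2 * |mx ω| + 2 * |my ω|) ^ 2 := by ring
        _ ≤ ex * (H ^ 2 * Q ^ 4) * (3 * (a ^ 2 + (2 * |mx ω|) ^ 2 + (2 * |my ω|) ^ 2)) := by
          gcongr
          · rw [← Real.exp_nat_mul]
            apply Real.exp_le_exp.2
            have : 0 ≤ (1 - κ) * T * (ξ ^ 2 + η ^ 2) := by positivity
            push_cast
            linarith
          · exact add_add_sq_le _ _ _
        _ = _ := by rw [hG]; ring
    rw [mul_pow, mul_pow, sq_abs, sq_abs] at h4
    linarith
  have hm1 : AEMeasurable (fun ω => ENNReal.ofReal 2 * ENNReal.ofReal (‖∏ i, stepApprox q L (s ω i) -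
        ∏ i, stepExact q L (s ω i)‖ ^ 2)) P := by
    have := hcont.measurable.comp_aemeasurable hlaw.aemeasurable
    exact (this.ennreal_ofReal).const_mul _
  have hmx := hnoise.aemeasurable_x
  have hmy := hnoise.aemeasurable_y
  refine (lintegral_mono_ae hpt).trans ?_
  rw [lintegral_add_left' hm1, lintegral_add_left' (by fun_prop), lintegral_add_left' (by fun_prop),
    lintegral_const_mul' _ _ ENNReal.ofReal_ne_top, lintegral_const_mul' _ _ ENNReal.ofReal_ne_top,
    lintegral_const_mul' _ _ ENNReal.ofReal_ne_top, lintegral_const, measure_univ, mul_one]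
  have h1' : ∫⁻ ω, ENNReal.ofReal (‖∏ i, stepApprox q L (s ω i) -
        ∏ i, stepExact q L (s ω i)‖ ^ 2) ∂P ≤ ENNReal.ofReal (C₁ * k ^ 2 * Q ^ 4 * ex) := by
    rw [h1]
    apply ENNReal.ofReal_le_ofReal
    rw [← hQ']
    exact hb1
  calc _ ≤ ENNReal.ofReal 2 * ENNReal.ofReal (C₁ * k ^ 2 * Q ^ 4 * ex) +
        (ENNReal.ofReal (6 * G * a ^ 2) + (ENNReal.ofReal (24 * G) * ENNReal.ofReal T +
          ENNReal.ofReal (24 * G) * ENNReal.ofReal T)) := by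
        gcongr
        · exact hnoise.sq_x
        · exact hnoise.sq_y
    _ = ENNReal.ofReal (2 * (C₁ * k ^ 2 * Q ^ 4 * ex) + (6 * G * a ^ 2 + (24 * G * T + 24 * G * T)))
        := by
        rw [ENNReal.ofReal_add (by positivity) (by positivity),
          ENNReal.ofReal_add (by positivity) (by positivity),
          ENNReal.ofReal_add (by positivity) (by positivity), ENNReal.ofReal_mul (p := 2) (by norm_num),
          ENNReal.ofReal_mul (p := 24 * G) (by positivity)]
    _ ≤ _ := by
        apply ENNReal.ofReal_le_ofReal
        have k1 : k ^ 2 ≤ (H + k) ^ 2 := by gcongr; linarith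
        have k2 : H ^ 2 ≤ (H + k) ^ 2 := by gcongr; linarith
        have w0 : 0 ≤ Q ^ 4 * ex := by positivity
        have w1 : 2 * C₁ * (k ^ 2 * (Q ^ 4 * ex)) ≤ 2 * C₁ * ((H + k) ^ 2 * (Q ^ 4 * ex)) := by
          gcongr
        have w2 : 6 * (a ^ 2 + 8 * T) * (H ^ 2 * (Q ^ 4 * ex)) ≤
            6 * (a ^ 2 + 8 * T) * ((H + k) ^ 2 * (Q ^ 4 * ex)) := by gcongr
        rw [hG]
        linarith

/-- The mean square error of the `N`-step multiplier at high frequencies. -/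
lemma Corr.StableWith.mult_error_high {r : Corr} {κ : ℝ} (hr : r.StableWith κ)
    (μx μy : ℝ) {T : ℝ} (hT : 0 < T)
    {Ω : Type*} [MeasurableSpace Ω] {P : Measure Ω} [IsProbabilityMeasure P] {N : ℕ}
    {zx zy : Fin N → Ω → ℝ} {mx my : Ω → ℝ} (hnoise : IsGaussianNoise r.ρxy T zx zy mx my P)
    {hx hy ξ η : ℝ} (hN : 1 ≤ N) (hhx : 0 < hx) (hhy : 0 < hy)
    (hA : 1 ≤ (implicitSymbol μx μy (T / N) hx hy ξ η).re) :
    ∫⁻ ω, ENNReal.ofReal (‖∏ i, schemeMult r μx μy (T / N) hx hy ξ η (zx i ω) (zy i ω) -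
          exactMult r μx μy T (mx ω) (my ω) ξ η‖ ^ 2) ∂P ≤
      ENNReal.ofReal (2 * (hx ^ 2 + hy ^ 2 + T / N) ^ 2 * ((1 + (ξ ^ 2 + η ^ 2)) ^ 4 *
        Real.exp (-((1 - κ) * T * (ξ ^ 2 + η ^ 2) / 10))) + 2 * ((1 + 3 * κ) / 4) ^ N) := by
  have hN0 : (0 : ℝ) < N := by exact_mod_cast hN
  set k := T / N with hk
  have hk0 : 0 < k := by positivity
  set u := noiseSymbol r.ρx k hx ξ with hu
  set w := noiseSymbol r.ρy k hy η with hw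
  set L := implicitSymbol μx μy k hx hy ξ η with hL
  set q := u ^ 2 + w ^ 2 with hq
  have hκ0 : 0 < 1 - κ := by linarith [hr.lt_one]
  have hlaw := hnoise.law u w
  have hAe : L.re = (k * symS hx ξ ^ 2 + k * symS hy η ^ 2) / 2 := implicitSymbol_re ..
  have hα := (hr.integral_normSq_stepApprox_le (L := L)
    (by positivity : 0 ≤ k * symS hx ξ ^ 2) (by positivity : 0 ≤ k * symS hy η ^ 2)
    (noiseSymbol_sq_le hr.ρx_nonneg hk0.le hx ξ) (noiseSymbol_sq_le hr.ρy_nonneg hk0.le hy η)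
    hAe).trans (growth_le_const hr.lt_one hA)
  have hI := integrable_normSq_prod N (memLp_stepApprox q L (corrVar r.ρxy u w))
  have hcont := continuous_normSq_prod N (continuous_stepApprox q L)
  have h1 := HasLaw.lintegral_ofReal_comp hlaw hI hcont.measurable (fun _ => by positivity)
  rw [integral_normSq_prod] at h1
  -- `A ≥ 1` implies `k (1 + ξ² + η²) ≥ 1`, so the square of this number may be inserted for free.
  -- The exact multiplier thereby obeys the same kind of bound as the low-frequency error.
  have hex : Real.exp (-((1 - κ) * T * (ξ ^ 2 + η ^ 2) / 2)) ^ 2 ≤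
      (hx ^ 2 + hy ^ 2 + k) ^ 2 * ((1 + (ξ ^ 2 + η ^ 2)) ^ 4 *
        Real.exp (-((1 - κ) * T * (ξ ^ 2 + η ^ 2) / 10))) := by
    have h2 : 1 ≤ k * (1 + (ξ ^ 2 + η ^ 2)) := by
      have := symS_sq_le hhx ξ
      have := symS_sq_le hhy η
      rw [hAe] at hA
      nlinarith
    have h3 : 1 ≤ (k * (1 + (ξ ^ 2 + η ^ 2))) ^ 2 := one_le_pow₀ h2
    have h4 : Real.exp (-((1 - κ) * T * (ξ ^ 2 + η ^ 2) / 2)) ^ 2 ≤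
        Real.exp (-((1 - κ) * T * (ξ ^ 2 + η ^ 2) / 10)) := by
      rw [← Real.exp_nat_mul]
      apply Real.exp_le_exp.2
      have : 0 ≤ (1 - κ) * T * (ξ ^ 2 + η ^ 2) := by positivity
      push_cast
      linarith
    have h5 : (k * (1 + (ξ ^ 2 + η ^ 2))) ^ 2 ≤
        (hx ^ 2 + hy ^ 2 + k) ^ 2 * (1 + (ξ ^ 2 + η ^ 2)) ^ 4 := by
      have hQ1 : 1 ≤ 1 + (ξ ^ 2 + η ^ 2) := by have := sq_nonneg ξ; have := sq_nonneg η; linarith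
      rw [mul_pow]
      gcongr
      · have := sq_nonneg hx; have := sq_nonneg hy; linarith
      · norm_num
    calc _ ≤ 1 * Real.exp (-((1 - κ) * T * (ξ ^ 2 + η ^ 2) / 10)) := by linarith
      _ ≤ ((hx ^ 2 + hy ^ 2 + k) ^ 2 * (1 + (ξ ^ 2 + η ^ 2)) ^ 4) *
          Real.exp (-((1 - κ) * T * (ξ ^ 2 + η ^ 2) / 10)) := by
          gcongr; exact h3.trans h5
      _ = _ := by ring
  set D := (hx ^ 2 + hy ^ 2 + k) ^ 2 * ((1 + (ξ ^ 2 + η ^ 2)) ^ 4 *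
        Real.exp (-((1 - κ) * T * (ξ ^ 2 + η ^ 2) / 10))) with hD
  have hD0 : 0 ≤ D := by positivity
  have hpt : ∀ ω, ENNReal.ofReal (‖∏ i, schemeMult r μx μy k hx hy ξ η (zx i ω) (zy i ω) -
          exactMult r μx μy T (mx ω) (my ω) ξ η‖ ^ 2) ≤
      ENNReal.ofReal 2 * ENNReal.ofReal (‖∏ i, stepApprox q L (u * zx i ω + w * zy i ω)‖ ^ 2) +
        ENNReal.ofReal (2 * D) := by
    intro ω
    rw [← ENNReal.ofReal_mul (by norm_num), ← ENNReal.ofReal_add (by positivity) (by positivity)]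
    apply ENNReal.ofReal_le_ofReal
    have h3 := normSq_sub_le (∏ i, schemeMult r μx μy k hx hy ξ η (zx i ω) (zy i ω)) 0
      (exactMult r μx μy T (mx ω) (my ω) ξ η)
    rw [sub_zero, zero_sub, norm_neg] at h3
    have h4 : ‖exactMult r μx μy T (mx ω) (my ω) ξ η‖ ^ 2 ≤ D := by
      refine le_trans ?_ hex
      gcongr
      exact hr.norm_exactMult_le hT.le _ _ _ _ _ _
    have e1 : ∏ i, schemeMult r μx μy k hx hy ξ η (zx i ω) (zy i ω) =
      ∏ i, stepApprox q L (u * zx i ω + w * zy i ω) := rfl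
    rw [e1] at h3 ⊢
    linarith
  refine (lintegral_mono hpt).trans ?_
  rw [lintegral_add_right _ measurable_const, lintegral_const, measure_univ, mul_one,
    lintegral_const_mul' _ _ ENNReal.ofReal_ne_top, h1, ← ENNReal.ofReal_mul (by norm_num),
    ← ENNReal.ofReal_add (by positivity) (by positivity)]
  apply ENNReal.ofReal_le_ofReal
  have h5 : (∫ s, ‖stepApprox q L s‖ ^ 2 ∂gaussianReal 0 (corrVar r.ρxy u w)) ^ N ≤
      ((1 + 3 * κ) / 4) ^ N := by
    gcongr
  rw [hD] at *
  linarith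

/-- The mean square error of the `N`-step multiplier. -/
theorem Corr.StableWith.exists_mult_error {r : Corr} {κ : ℝ} (hr : r.StableWith κ)
    (μx μy : ℝ) {T : ℝ} (hT : 0 < T) : ∃ C : ℝ, 0 < C ∧
    ∀ (Ω : Type*) [MeasurableSpace Ω] (P : Measure Ω) [IsProbabilityMeasure P] (N : ℕ)
      (zx zy : Fin N → Ω → ℝ) (mx my : Ω → ℝ), IsGaussianNoise r.ρxy T zx zy mx my P →
    ∀ (hx hy ξ η : ℝ), 1 ≤ N → 0 < hx → 0 < hy → |ξ| * hx ≤ Real.pi → |η| * hy ≤ Real.pi →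
      ∫⁻ ω, ENNReal.ofReal (‖∏ i, schemeMult r μx μy (T / N) hx hy ξ η (zx i ω) (zy i ω) -
          exactMult r μx μy T (mx ω) (my ω) ξ η‖ ^ 2) ∂P ≤
      ENNReal.ofReal (C * (hx ^ 2 + hy ^ 2 + T / N) ^ 2 *
        Real.exp (-((1 - κ) * T / 20 * (ξ ^ 2 + η ^ 2))) + 2 * ((1 + 3 * κ) / 4) ^ N) := by
  obtain ⟨C₁, hC₁, hlow⟩ := hr.exists_mult_error_low μx μy hT
  have hκ0 : 0 < 1 - κ := by linarith [hr.lt_one]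
  have hκ1 := hr.nonneg
  -- Half the low-frequency rate `(1-κ)T/10`; the other half is spent on the factor `(1 + ξ² +
  -- η²)⁴`.
  set c := (1 - κ) * T / 20 with hc
  have hc0 : 0 < c := by positivity
  set B := 24 / c ^ 4 * Real.exp c
  have hB : 0 < B := by positivity
  refine ⟨(C₁ + 2) * B, by positivity, ?_⟩
  intro Ω _ P _ N zx zy mx my hnoise hx hy ξ η hN hhx hhy hξ hη
  have hN0 : (0 : ℝ) < N := by exact_mod_cast hN
  have h1 := pow_mul_exp_neg_le hc0 (by positivity : 0 ≤ ξ ^ 2 + η ^ 2)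
  rw [show 2 * c * (ξ ^ 2 + η ^ 2) = (1 - κ) * T * (ξ ^ 2 + η ^ 2) / 10 by rw [hc]; ring] at h1
  have hp : 0 ≤ ((1 + 3 * κ) / 4) ^ N := by positivity
  have hM : 0 ≤ (hx ^ 2 + hy ^ 2 + T / N) ^ 2 := by positivity
  set M := (hx ^ 2 + hy ^ 2 + T / N) ^ 2
  have hMB := mul_le_mul_of_nonneg_left h1 hM
  have hMe : 0 ≤ M * (B * Real.exp (-(c * (ξ ^ 2 + η ^ 2)))) := by positivity
  rcases le_total (implicitSymbol μx μy (T / N) hx hy ξ η).re 1 with hA | hA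
  · refine (hlow Ω P N zx zy mx my hnoise hx hy ξ η hN hhx hhy hξ hη hA).trans ?_
    apply ENNReal.ofReal_le_ofReal
    have := mul_le_mul_of_nonneg_left hMB hC₁.le
    linarith
  · refine (hr.mult_error_high μx μy hT hnoise hN hhx hhy hA).trans ?_
    apply ENNReal.ofReal_le_ofReal
    have : 0 ≤ C₁ * (M * (B * Real.exp (-(c * (ξ ^ 2 + η ^ 2))))) := by positivity
    linarith

/-! ### The increments of the Brownian motions -/

lemma map_linear_comb_gaussianReal_prod (a b : ℝ) :
    ((gaussianReal 0 1).prod (gaussianReal 0 1)).map (fun p : ℝ × ℝ => a * p.1 + b * p.2) =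
      gaussianReal 0 (Real.toNNReal (a ^ 2 + b ^ 2)) := by
  have hi : IndepFun (fun p : ℝ × ℝ => p.1) (fun p : ℝ × ℝ => p.2)
      ((gaussianReal 0 1).prod (gaussianReal 0 1)) :=
    indepFun_prod (X := id) (Y := id) measurable_id measurable_id
  have h1 : HasLaw (fun p : ℝ × ℝ => p.1) (gaussianReal 0 1)
      ((gaussianReal 0 1).prod (gaussianReal 0 1)) :=
    ⟨by fun_prop, measurePreserving_fst.map_eq⟩
  have h2 : HasLaw (fun p : ℝ × ℝ => p.2) (gaussianReal 0 1)
      ((gaussianReal 0 1).prod (gaussianReal 0 1)) :=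
    ⟨by fun_prop, measurePreserving_snd.map_eq⟩
  have h1a := gaussianReal_const_mul h1 a
  have h2b := gaussianReal_const_mul h2 b
  have hab := hi.comp (φ := fun x => a * x) (ψ := fun x => b * x) (by fun_prop) (by fun_prop)
  have := gaussianReal_add_gaussianReal_of_indepFun hab h1a.map_eq h2b.map_eq
  refine this.trans ?_
  congr 1
  · simp
  · ext
    rw [Real.coe_toNNReal _ (by positivity)]
    simp

/-- Regrouping two independent Gaussian vectors as a vector of independent pairs makes the map act
coordinatewise. -/
lemma map_linear_comb_pi_gaussianReal (N : ℕ) (a b : ℝ) :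
    ((Measure.pi fun _ : Fin N => gaussianReal 0 1).prod
      (Measure.pi fun _ : Fin N => gaussianReal 0 1)).map
        (fun p : (Fin N → ℝ) × (Fin N → ℝ) => fun i => a * p.1 i + b * p.2 i) =
      Measure.pi fun _ : Fin N => gaussianReal 0 (Real.toNNReal (a ^ 2 + b ^ 2)) := by
  have h := (measurePreserving_arrowProdEquivProdArrow ℝ ℝ (Fin N)
    (fun _ => gaussianReal 0 1) (fun _ => gaussianReal 0 1)).map_eq
  rw [← h, Measure.map_map (by fun_prop) (MeasurableEquiv.measurable _)]
  have h2 := Measure.pi_map_pi (μ := fun _ : Fin N => (gaussianReal 0 1).prod (gaussianReal 0 1))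
    (f := fun _ => fun p : ℝ × ℝ => a * p.1 + b * p.2)
    (hμ := fun i => by rw [map_linear_comb_gaussianReal_prod]; infer_instance) (by fun_prop)
  simp only [map_linear_comb_gaussianReal_prod] at h2
  rw [← h2]
  rfl

lemma gridTime_mono (T : ℝ≥0) (N : ℕ) : Monotone (gridTime T N) := by
  intro m n h
  unfold gridTime
  gcongr

lemma gridTime_self (T : ℝ≥0) {N : ℕ} (hN : 1 ≤ N) : gridTime T N N = T := by
  unfold gridTime
  have : (N : ℝ≥0) ≠ 0 := by positivity
  field_simp

lemma nndist_gridTime (T : ℝ≥0) (N n : ℕ) :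
    nndist (gridTime T N (n + 1)).1 (gridTime T N n).1 = T / N := by
  ext
  rw [coe_nndist, Real.dist_eq]
  have h : (gridTime T N (n + 1)).1 - (gridTime T N n).1 = (T : ℝ) / N := by
    unfold gridTime
    show ((((n + 1 : ℕ) : ℝ≥0) * (T / N) : ℝ≥0) : ℝ) - (((n : ℝ≥0) * (T / N) : ℝ≥0) : ℝ) = _
    push_cast
    ring
  rw [h, abs_of_nonneg (by positivity)]
  simp

section

lemma normIncr_noiseY {Ω : Type*} (r : Corr) (T : ℝ≥0) (N : ℕ) (W₁ W₂ : ℝ≥0 → Ω → ℝ) (n : ℕ) (ω : Ω) :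
    normIncr T N (noiseY r W₁ W₂) n ω =
      r.ρxy * normIncr T N W₁ n ω + √(1 - r.ρxy ^ 2) * normIncr T N W₂ n ω := by
  unfold normIncr noiseY; ring

lemma sum_normIncr {Ω : Type*} {T : ℝ≥0} (hT : 0 < T) {N : ℕ} (hN : 1 ≤ N) {M : ℝ≥0 → Ω → ℝ} {ω : Ω}
    (h0 : M 0 ω = 0) : √((T : ℝ) / N) * ∑ i : Fin N, normIncr T N M i ω = M T ω := by
  have hN0 : (0 : ℝ) < N := by exact_mod_cast hN
  have hT0 : (0 : ℝ) < T := by exact_mod_cast hT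
  have hs : √((T : ℝ) / N) ≠ 0 := by positivity
  rw [Finset.mul_sum]
  have : ∀ i : Fin N, √((T : ℝ) / N) * normIncr T N M i ω =
      (fun n : ℕ => M (gridTime T N (n + 1)) ω - M (gridTime T N n) ω) i := by
    intro i; unfold normIncr; field_simp
  simp_rw [this]
  rw [Fin.sum_univ_eq_sum_range (fun n : ℕ => M (gridTime T N (n + 1)) ω - M (gridTime T N n) ω),
    Finset.sum_range_sub (fun n => M (gridTime T N n) ω), gridTime_self T hN]
  have : gridTime T N 0 = 0 := by simp [gridTime]
  rw [this, h0, sub_zero]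

variable {Ω : Type*} [MeasurableSpace Ω] {P : Measure Ω}

lemma hasLaw_normIncr {W : ℝ≥0 → Ω → ℝ} (hW : IsBrownianReal W P) {T : ℝ≥0} (hT : 0 < T)
    {N : ℕ} (hN : 1 ≤ N) (n : ℕ) : HasLaw (normIncr T N W n) (gaussianReal 0 1) P := by
  have h1 := hW.hasLaw_sub (gridTime T N (n + 1)) (gridTime T N n)
  rw [nndist_gridTime] at h1
  have h2 := gaussianReal_div_const h1 √((T : ℝ) / N)
  have hN0 : (0 : ℝ) < N := by exact_mod_cast hN
  have hT0 : (0 : ℝ) < T := by exact_mod_cast hT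
  have e : gaussianReal (0 / √((T : ℝ) / N)) (T / N / .mk (√((T : ℝ) / N) ^ 2) (sq_nonneg _)) =
      gaussianReal 0 1 := by
    congr 1
    · simp
    ext
    simp only [NNReal.coe_div, NNReal.coe_one, NNReal.coe_natCast, NNReal.coe_mk]
    rw [Real.sq_sqrt (by positivity)]
    field_simp
  rw [e] at h2
  exact h2

lemma hasLaw_normIncr_pi [IsProbabilityMeasure P] {W : ℝ≥0 → Ω → ℝ} (hW : IsBrownianReal W P)
    {T : ℝ≥0} (hT : 0 < T) {N : ℕ} (hN : 1 ≤ N) :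
    HasLaw (fun ω (i : Fin N) => normIncr T N W i ω)
      (Measure.pi fun _ : Fin N => gaussianReal 0 1) P := by
  have hi : iIndepFun (fun (i : Fin N) ω => normIncr T N W i ω) P := by
    have h := (hW.hasIndepIncrements.nat (gridTime_mono T N)).precomp
      (g := fun i : Fin N => (i : ℕ)) Fin.val_injective
    exact h.comp (fun _ x => x / √((T : ℝ) / N)) (by fun_prop)
  have hm : ∀ i : Fin N, AEMeasurable (fun ω => normIncr T N W i ω) P :=
    fun i => (hasLaw_normIncr hW hT hN i).aemeasurable
  refine ⟨aemeasurable_pi_lambda _ hm, ?_⟩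
  rw [(iIndepFun_iff_map_fun_eq_pi_map hm).1 hi]
  congr 1
  ext1 i
  exact (hasLaw_normIncr hW hT hN i).map_eq

lemma lintegral_sq_of_hasLaw {X : Ω → ℝ} {v : ℝ≥0} (h : HasLaw X (gaussianReal 0 v) P) :
    ∫⁻ ω, ENNReal.ofReal (X ω ^ 2) ∂P = ENNReal.ofReal v := by
  have := HasLaw.lintegral_ofReal_comp h (integrable_pow_gaussianReal v 2) (by fun_prop)
    (fun x => sq_nonneg x)
  rw [this, (integral_even_pow_gaussianReal v).1]

/-- With `ρ = r.ρxy`, the combination `a Z + b Z̃` equals `(a + bρ) Z + b √(1-ρ²) Z'` for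
independent standard Gaussian vectors `Z, Z'`. Its coordinates are therefore independent with
variance `a² + b² + 2ρab`. -/
theorem IsBrownianPair.isGaussianNoise [IsProbabilityMeasure P] {W₁ W₂ : ℝ≥0 → Ω → ℝ}
    (hW : IsBrownianPair W₁ W₂ P) {r : Corr} (hr : |r.ρxy| ≤ 1) {T : ℝ≥0} (hT : 0 < T) {N : ℕ}
    (hN : 1 ≤ N) :
    IsGaussianNoise r.ρxy T (fun i : Fin N => normIncr T N W₁ i)
      (fun i : Fin N => normIncr T N (noiseY r W₁ W₂) i) (W₁ T) (noiseY r W₁ W₂ T) P := by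
  have hρ : 0 ≤ 1 - r.ρxy ^ 2 := by
    have := (sq_le_one_iff_abs_le_one r.ρxy).2 hr
    linarith
  have hY : HasLaw (noiseY r W₁ W₂ T) (gaussianReal 0 T) P := by
    have h1 := gaussianReal_const_mul (hW.fst.hasLaw_eval T) r.ρxy
    have h2 := gaussianReal_const_mul (hW.snd.hasLaw_eval T) √(1 - r.ρxy ^ 2)
    have hi : IndepFun (fun ω => r.ρxy * W₁ T ω) (fun ω => √(1 - r.ρxy ^ 2) * W₂ T ω) P :=
      hW.indep.comp (φ := fun f : ℝ≥0 → ℝ => r.ρxy * f T)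
        (ψ := fun f : ℝ≥0 → ℝ => √(1 - r.ρxy ^ 2) * f T)
        (by fun_prop) (by fun_prop)
    refine ⟨h1.aemeasurable.add h2.aemeasurable, ?_⟩
    have := gaussianReal_add_gaussianReal_of_indepFun hi h1.map_eq h2.map_eq
    refine Eq.trans this ?_
    congr 1
    · simp
    · ext
      simp only [NNReal.coe_add, NNReal.coe_mul, NNReal.coe_mk]
      rw [Real.sq_sqrt hρ]; ring
  refine ⟨fun a b => ?_, (hW.fst.hasLaw_eval T).aemeasurable, hY.aemeasurable, ?_, ?_, ?_, ?_⟩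
  · have hU := hasLaw_normIncr_pi hW.fst hT hN
    have hV := hasLaw_normIncr_pi hW.snd hT hN
    have hUV : IndepFun (fun ω (i : Fin N) => normIncr T N W₁ i ω)
        (fun ω (i : Fin N) => normIncr T N W₂ i ω) P := by
      have hm : Measurable fun (f : ℝ≥0 → ℝ) (i : Fin N) =>
          (f (gridTime T N (i + 1)) - f (gridTime T N i)) / √((T : ℝ) / N) := by fun_prop
      exact hW.indep.comp hm hm
    have hmap := (indepFun_iff_map_prod_eq_prod_map_map hU.aemeasurable hV.aemeasurable).1 hUV
    rw [hU.map_eq, hV.map_eq] at hmap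
    have key := map_linear_comb_pi_gaussianReal N (a + b * r.ρxy) (b * √(1 - r.ρxy ^ 2))
    rw [← hmap, AEMeasurable.map_map_of_aemeasurable (by fun_prop)
      (hU.aemeasurable.prodMk hV.aemeasurable)] at key
    have hv : corrVar r.ρxy a b =
        Real.toNNReal ((a + b * r.ρxy) ^ 2 + (b * √(1 - r.ρxy ^ 2)) ^ 2) := by
      rw [corrVar, mul_pow, Real.sq_sqrt hρ]; congr 1; ring
    have he : (fun ω (i : Fin N) =>
        a * normIncr T N W₁ i ω + b * normIncr T N (noiseY r W₁ W₂) i ω) =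
        (fun p : (Fin N → ℝ) × (Fin N → ℝ) =>
          fun i => (a + b * r.ρxy) * p.1 i + b * √(1 - r.ρxy ^ 2) * p.2 i) ∘
        (fun ω => (fun i : Fin N => normIncr T N W₁ i ω, fun i : Fin N => normIncr T N W₂ i ω)) := by
      ext ω i
      simp only [Function.comp, normIncr_noiseY]; ring
    rw [hv, he]
    refine ⟨?_, key⟩
    exact Measurable.comp_aemeasurable (by fun_prop) (hU.aemeasurable.prodMk hV.aemeasurable)
  -- The increments sum to `W₁ T - W₁ 0`, and the starting value vanishes only almost surely.
  · filter_upwards [hW.fst.eval_zero_ae_eq_zero] with ω h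
    exact sum_normIncr hT hN h
  · filter_upwards [hW.fst.eval_zero_ae_eq_zero, hW.snd.eval_zero_ae_eq_zero] with ω h h'
    exact sum_normIncr hT hN (by simp [noiseY, h, h'])
  · exact (lintegral_sq_of_hasLaw (hW.fst.hasLaw_eval T)).le
  · exact (lintegral_sq_of_hasLaw hY).le

end

/-! ### Plane waves on a frequency box -/

/-- The plane wave `w ↦ exp (2πi (x w₁ + y w₂))`. -/
def wave (x y : ℝ) (w : ℝ × ℝ) : ℂ := cexp ((2 * Real.pi * (x * w.1 + y * w.2) : ℝ) * I)

@[fun_prop]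
lemma continuous_wave (x y : ℝ) : Continuous (wave x y) := by
  unfold wave
  fun_prop

lemma norm_wave (x y : ℝ) (w : ℝ × ℝ) : ‖wave x y w‖ = 1 := by
  unfold wave
  exact norm_exp_ofReal_mul_I _

lemma enorm_wave (x y : ℝ) (w : ℝ × ℝ) : ‖wave x y w‖ₑ = 1 := by
  rw [← ofReal_norm, norm_wave, ENNReal.ofReal_one]

lemma wave_add (x x' y y' : ℝ) (w : ℝ × ℝ) :
    wave (x + x') (y + y') w = wave x y w * wave x' y' w := by
  unfold wave
  rw [← Complex.exp_add]
  congr 1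
  push_cast
  ring

lemma conj_wave (x y : ℝ) (w : ℝ × ℝ) : conj (wave x y w) = wave (-x) (-y) w := by
  unfold wave
  rw [← Complex.exp_conj]
  congr 1
  simp only [map_mul, conj_ofReal, conj_I]
  push_cast
  ring

/-- The plane wave of the grid point with index `p`. -/
def gridWave (hx hy : ℝ) (p : ℤ × ℤ) : ℝ × ℝ → ℂ := wave (p.1 * hx) (p.2 * hy)

/-- The half-open box with lower corner `(a, b)` and side lengths `1/hx`, `1/hy`. -/
def freqBox (hx hy a b : ℝ) : Set (ℝ × ℝ) :=
  Set.Ioc a (a + 1 / hx) ×ˢ Set.Ioc b (b + 1 / hy)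

lemma measurableSet_freqBox (hx hy a b : ℝ) : MeasurableSet (freqBox hx hy a b) :=
  measurableSet_Ioc.prod measurableSet_Ioc

lemma volume_freqBox (hx hy a b : ℝ) :
    volume (freqBox hx hy a b) = ENNReal.ofReal (1 / hx) * ENNReal.ofReal (1 / hy) := by
  rw [freqBox, Measure.volume_eq_prod, Measure.prod_prod, Real.volume_Ioc, Real.volume_Ioc]
  simp

instance (hx hy a b : ℝ) : IsFiniteMeasure (volume.restrict (freqBox hx hy a b)) :=
  ⟨by
    rw [Measure.restrict_apply_univ, volume_freqBox]
    exact ENNReal.mul_lt_top ENNReal.ofReal_lt_top ENNReal.ofReal_lt_top⟩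

lemma setIntegral_exp_period {h : ℝ} (hh : 0 < h) (a : ℝ) (n : ℤ) :
    ∫ x in Set.Ioc a (a + 1 / h), cexp ((2 * Real.pi * (n * h * x) : ℝ) * I) =
      if n = 0 then ((1 / h : ℝ) : ℂ) else 0 := by
  split_ifs with hn
  · subst hn
    have : 0 ≤ h⁻¹ := by positivity
    simp [this]
  · rw [← intervalIntegral.integral_of_le (by simp [hh.le])]
    have hne : (2 * Real.pi * n * h * I : ℂ) ≠ 0 := by
      simp [hn, hh.ne', Real.pi_ne_zero, I_ne_zero]
    have := integral_exp_mul_complex (a := a) (b := a + 1 / h) hne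
    rw [show (fun x : ℝ => cexp ((2 * Real.pi * (n * h * x) : ℝ) * I)) =
      fun x : ℝ => cexp ((2 * Real.pi * n * h * I : ℂ) * x) from by
        funext x; congr 1; push_cast; ring, this]
    have hp : cexp ((2 * Real.pi * n * h * I : ℂ) * ((a + 1 / h : ℝ) : ℂ)) =
        cexp ((2 * Real.pi * n * h * I : ℂ) * a) := by
      rw [Complex.exp_eq_exp_iff_exists_int]
      refine ⟨n, ?_⟩
      push_cast
      have : (h : ℂ) ≠ 0 := by exact_mod_cast hh.ne'
      field_simp
    rw [hp, sub_self, zero_div]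

/-- The side lengths of the box are periods of every grid wave, so orthogonality holds on a box in
any position. This permits Bessel's inequality on the aliased boxes as well as on the central one.
-/
lemma setIntegral_gridWave {hx hy : ℝ} (hhx : 0 < hx) (hhy : 0 < hy) (a b : ℝ) (p : ℤ × ℤ) :
    ∫ w in freqBox hx hy a b, gridWave hx hy p w =
      if p = 0 then ((1 / (hx * hy) : ℝ) : ℂ) else 0 := by
  have h := setIntegral_prod_mul (μ := volume) (ν := volume)
    (fun x : ℝ => cexp ((2 * Real.pi * (p.1 * hx * x) : ℝ) * I))
    (fun x : ℝ => cexp ((2 * Real.pi * (p.2 * hy * x) : ℝ) * I))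
    (Set.Ioc a (a + 1 / hx)) (Set.Ioc b (b + 1 / hy))
  rw [setIntegral_exp_period hhx, setIntegral_exp_period hhy, ← Measure.volume_eq_prod] at h
  rw [freqBox]
  refine Eq.trans ?_ (h.trans ?_)
  · congr 1
    funext w
    rw [gridWave, wave, ← Complex.exp_add]
    congr 1
    push_cast
    ring
  · rcases p with ⟨i, j⟩
    by_cases h1 : i = 0 <;> by_cases h2 : j = 0 <;> simp [h1, h2, mul_comm]

lemma lintegral_enorm_sq_eq {α : Type*} [MeasurableSpace α] (μ : Measure α) (G : α → ℂ) :
    ∫⁻ x, ‖G x‖ₑ ^ 2 ∂μ = eLpNorm G 2 μ ^ 2 := by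
  have := eLpNorm_nnreal_pow_eq_lintegral (f := G) (μ := μ) (p := 2) (by norm_num)
  simpa using this.symm

/-- Bessel's inequality for the plane waves on a frequency box. -/
lemma tsum_enorm_setIntegral_gridWave_le {hx hy : ℝ} (hhx : 0 < hx) (hhy : 0 < hy) (a b : ℝ)
    {G : ℝ × ℝ → ℂ} (hG : AEStronglyMeasurable G (volume.restrict (freqBox hx hy a b))) :
    ∑' p : ℤ × ℤ, ‖∫ w in freqBox hx hy a b, G w * gridWave hx hy p w‖ₑ ^ 2
        * ENNReal.ofReal (hx * hy) ≤ ∫⁻ w in freqBox hx hy a b, ‖G w‖ₑ ^ 2 := by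
  set μ := volume.restrict (freqBox hx hy a b) with hμ
  by_cases hfin : ∫⁻ w, ‖G w‖ₑ ^ 2 ∂μ = ∞
  · rw [hfin]; exact le_top
  rw [lintegral_enorm_sq_eq] at hfin ⊢
  have hG2 : MemLp G 2 μ := ⟨hG, by
    rw [lt_top_iff_ne_top]
    intro h
    exact hfin (by simp [h])⟩
  -- Normalises the waves: the box has area `1/(hx hy)`.
  set c : ℝ := √(hx * hy) with hc
  have hc2 : c ^ 2 = hx * hy := Real.sq_sqrt (by positivity)
  have hwm (p : ℤ × ℤ) : MemLp (fun w => (c : ℂ) * conj (gridWave hx hy p w)) 2 μ := by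
    refine MemLp.of_bound (C := c) ?_ ?_
    · refine Continuous.aestronglyMeasurable ?_
      unfold gridWave
      fun_prop
    · refine Filter.Eventually.of_forall fun w => ?_
      rw [norm_mul, RCLike.norm_conj, gridWave, norm_wave, norm_real, mul_one]
      simp [hc, abs_of_nonneg]
  set v : ℤ × ℤ → Lp ℂ 2 μ := fun p => (hwm p).toLp _ with hv
  have hort : Orthonormal ℂ v := by
    rw [orthonormal_iff_ite]
    intro p q
    rw [L2.inner_def]
    have : ∫ w, inner ℂ (v p w) (v q w) ∂μ =
        ∫ w, ((hx * hy : ℝ) : ℂ) * gridWave hx hy (p - q) w ∂μ := by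
      refine integral_congr_ae ?_
      filter_upwards [(hwm p).coeFn_toLp, (hwm q).coeFn_toLp] with w h1 h2
      rw [hv]
      simp only
      rw [h1, h2, RCLike.inner_apply, ← hc2]
      simp only [map_mul, conj_ofReal, gridWave, conj_wave]
      rw [show ((p - q).1 : ℤ) * hx = p.1 * hx + -(q.1 * hx) by simp; ring,
        show ((p - q).2 : ℤ) * hy = p.2 * hy + -(q.2 * hy) by simp; ring, wave_add]
      push_cast
      ring_nf
    rw [this, integral_const_mul, setIntegral_gridWave hhx hhy]
    have h0 : (hx : ℂ) * hy ≠ 0 := by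
      exact_mod_cast (mul_pos hhx hhy).ne'
    by_cases hpq : p = q
    · simp only [hpq, sub_self, if_true]
      push_cast
      rw [mul_one_div, div_self h0]
    · simp [hpq, sub_eq_zero]
  have hin (p : ℤ × ℤ) : inner ℂ (v p) (hG2.toLp G) = c * ∫ w, G w * gridWave hx hy p w ∂μ := by
    rw [L2.inner_def, ← integral_const_mul]
    refine integral_congr_ae ?_
    filter_upwards [(hwm p).coeFn_toLp, hG2.coeFn_toLp] with w h1 h2
    rw [hv]
    simp only
    rw [h1, h2, RCLike.inner_apply]
    simp only [map_mul, conj_ofReal, conj_conj]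
    ring
  have hb := hort.tsum_inner_products_le (x := hG2.toLp G)
  have hs := hort.inner_products_summable (x := hG2.toLp G)
  have key : ENNReal.ofReal (‖hG2.toLp G‖ ^ 2) = eLpNorm G 2 μ ^ 2 := by
    rw [Lp.norm_toLp, ENNReal.ofReal_pow ENNReal.toReal_nonneg, ENNReal.ofReal_toReal hG2.2.ne]
  rw [← key]
  refine le_trans (le_of_eq ?_) (ENNReal.ofReal_le_ofReal hb)
  rw [ENNReal.ofReal_tsum_of_nonneg (fun _ => by positivity) hs]
  refine tsum_congr fun p => ?_
  rw [hin, norm_mul, mul_pow, norm_real, Real.norm_eq_abs, sq_abs, hc2, mul_comm,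
    ENNReal.ofReal_mul (p := hx * hy) (by positivity), ENNReal.ofReal_pow (norm_nonneg _), ofReal_norm]

/-! ### Summation over shifted boxes -/

/-- Cauchy–Schwarz in `ℓ²`, as Hölder's inequality for the counting measure. -/
lemma tsum_mul_le_of_sq_le {ι : Type*} (x y : ι → ℝ≥0∞) {a b G : ℝ≥0∞}
    (hx : ∑' i, x i ^ 2 ≤ a ^ 2 * G) (hy : ∑' i, y i ^ 2 ≤ b ^ 2 * G) :
    ∑' i, x i * y i ≤ a * b * G := by
  let _ : MeasurableSpace ι := ⊤
  have h := ENNReal.lintegral_mul_le_Lp_mul_Lq (Measure.count : Measure ι)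
    Real.HolderConjugate.two_two (f := x) (g := y)
    (measurable_from_top).aemeasurable (measurable_from_top).aemeasurable
  simp only [lintegral_count, Pi.mul_apply, ENNReal.rpow_two] at h
  refine h.trans ?_
  have hr (c : ℝ≥0∞) : (c ^ 2 * G) ^ (1 / 2 : ℝ) = c * G ^ (1 / 2 : ℝ) := by
    rw [ENNReal.mul_rpow_of_nonneg _ _ (by norm_num), ← ENNReal.rpow_two, ← ENNReal.rpow_mul]
    norm_num
  have hG : G ^ (1 / 2 : ℝ) * G ^ (1 / 2 : ℝ) = G := by
    rw [← ENNReal.rpow_add_of_nonneg _ _ (by norm_num) (by norm_num)]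
    norm_num
  calc _ ≤ (a ^ 2 * G) ^ (1 / 2 : ℝ) * (b ^ 2 * G) ^ (1 / 2 : ℝ) := by gcongr
    _ = a * b * (G ^ (1 / 2 : ℝ) * G ^ (1 / 2 : ℝ)) := by rw [hr, hr]; ring
    _ = _ := by rw [hG]

/-- Minkowski's inequality in `ℓ²(ι)` for infinitely many summands: expand the square and apply
Cauchy–Schwarz to each pair. Extended values dispense with summability conditions. -/
lemma tsum_tsum_sq_le {ι κ : Type*} (x : ι → κ → ℝ≥0∞) (A : κ → ℝ≥0∞) (G : ℝ≥0∞)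
    (h : ∀ k, ∑' i, x i k ^ 2 ≤ A k ^ 2 * G) :
    ∑' i, (∑' k, x i k) ^ 2 ≤ (∑' k, A k) ^ 2 * G := by
  calc ∑' i, (∑' k, x i k) ^ 2 = ∑' i, ∑' k, ∑' l, x i k * x i l := by
        refine tsum_congr fun i => ?_
        rw [sq, ← ENNReal.tsum_mul_right]
        exact tsum_congr fun k => ENNReal.tsum_mul_left.symm
    _ = ∑' k, ∑' l, ∑' i, x i k * x i l := by
        rw [ENNReal.tsum_comm]
        exact tsum_congr fun k => ENNReal.tsum_comm
    _ ≤ ∑' k, ∑' l, A k * A l * G :=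
        ENNReal.tsum_le_tsum fun k => ENNReal.tsum_le_tsum fun l =>
          tsum_mul_le_of_sq_le _ _ (h k) (h l)
    _ = (∑' k, A k) ^ 2 * G := by
        simp_rw [ENNReal.tsum_mul_right, ENNReal.tsum_mul_left]
        rw [ENNReal.tsum_mul_right, sq]

/-- The frequency box centred at `(k / hx, l / hy)`, for `q = (k, l)`. -/
def shiftBox (hx hy : ℝ) (q : ℤ × ℤ) : Set (ℝ × ℝ) :=
  freqBox hx hy (-(1 / (2 * hx)) + q.1 * (1 / hx)) (-(1 / (2 * hy)) + q.2 * (1 / hy))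

lemma measurableSet_shiftBox (hx hy : ℝ) (q : ℤ × ℤ) : MeasurableSet (shiftBox hx hy q) :=
  measurableSet_freqBox ..

lemma iUnion_shiftBox {hx hy : ℝ} (hhx : 0 < hx) (hhy : 0 < hy) :
    ⋃ q, shiftBox hx hy q = Set.univ := by
  have h1 := iUnion_Ioc_add_zsmul (show 0 < 1 / hx by positivity) (-(1 / (2 * hx)))
  have h2 := iUnion_Ioc_add_zsmul (show 0 < 1 / hy by positivity) (-(1 / (2 * hy)))
  refine Set.eq_univ_of_forall fun w => ?_
  obtain ⟨k, hk⟩ := Set.mem_iUnion.mp (h1.symm ▸ Set.mem_univ w.1)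
  obtain ⟨l, hl⟩ := Set.mem_iUnion.mp (h2.symm ▸ Set.mem_univ w.2)
  refine Set.mem_iUnion.mpr ⟨(k, l), ?_⟩
  simp only [zsmul_eq_mul, Int.cast_add, Int.cast_one, add_mul, one_mul, ← add_assoc] at hk hl
  exact ⟨hk, hl⟩

lemma pairwise_disjoint_shiftBox (hx hy : ℝ) :
    Pairwise (Function.onFun Disjoint (shiftBox hx hy)) := by
  have h1 := Set.pairwise_disjoint_Ioc_add_zsmul (-(1 / (2 * hx))) (1 / hx)
  have h2 := Set.pairwise_disjoint_Ioc_add_zsmul (-(1 / (2 * hy))) (1 / hy)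
  simp only [zsmul_eq_mul, Int.cast_add, Int.cast_one, add_mul, one_mul, ← add_assoc] at h1 h2
  intro p q hpq
  refine Set.disjoint_prod.mpr ?_
  rcases ne_or_eq p.1 q.1 with h | h
  · exact Or.inl (h1 h)
  · refine Or.inr (h2 fun h' => hpq (Prod.ext h h'))

/-- A point of the `k`-th interval lies within `1/(2h)` of `k/h`, so `|x| ≥ |k|/(2h)` when `k ≠ 0`.
Decay in the frequency thus becomes decay in the index of the box. -/
lemma abs_le_two_mul_of_mem_Ioc {h : ℝ} (hh : 0 < h) {k : ℤ} {x : ℝ}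
    (hx : x ∈ Set.Ioc (-(1 / (2 * h)) + k * (1 / h)) (-(1 / (2 * h)) + k * (1 / h) + 1 / h)) :
    |(k : ℝ)| ≤ 2 * h * |x| := by
  obtain ⟨h1, h2⟩ := hx
  have e1 : (k : ℝ) - 1 / 2 < h * x := by
    have := mul_lt_mul_of_pos_left h1 hh
    field_simp at this
    linarith
  have e2 : h * x ≤ k + 1 / 2 := by
    have := mul_le_mul_of_nonneg_left h2 hh.le
    field_simp at this
    linarith
  have e3 : 2 * h * |x| = 2 * |h * x| := by rw [abs_mul, abs_of_pos hh]; ring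
  rw [e3]
  rcases lt_trichotomy k 0 with hk | hk | hk
  · have : (k : ℝ) ≤ -1 := by exact_mod_cast (by omega : k ≤ -1)
    rw [abs_of_nonpos (by linarith), abs_of_nonpos (by linarith)]
    linarith
  · simp only [hk, Int.cast_zero, abs_zero]
    positivity
  · have : (1 : ℝ) ≤ k := by exact_mod_cast hk
    rw [abs_of_nonneg (by linarith), abs_of_nonneg (by linarith)]
    linarith

/-! ### Gaussian sums over the lattice of boxes, and aliasing. -/

lemma tsum_int_eq_two_mul (f : ℤ → ℝ≥0∞) (h0 : f 0 = 0) (hs : ∀ k, f (-k) = f k) :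
    ∑' k, f k = 2 * ∑' n : ℕ, f (n + 1) := by
  have h := HasSum.of_add_one_of_neg_add_one (f := f) (ENNReal.summable.hasSum)
    (ENNReal.summable.hasSum)
  rw [h.tsum_eq, h0, add_zero, two_mul]
  congr 1
  exact tsum_congr fun n => hs _

/-- The Gaussian weight `exp (-c k² / h²)` of the `k`-th frequency interval, `k ≠ 0`. -/
def gaussWeight (c h : ℝ) (k : ℤ) : ℝ≥0∞ :=
  if k = 0 then 0 else ENNReal.ofReal (Real.exp (-(c * (k / h) ^ 2)))

lemma tsum_gaussWeight (c h : ℝ) : ∑' k, gaussWeight c h k =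
    2 * ∑' n : ℕ, ENNReal.ofReal (Real.exp (-(c * ((n + 1 : ℝ) / h) ^ 2))) := by
  rw [tsum_int_eq_two_mul _ (by simp [gaussWeight]) (fun k => by simp [gaussWeight, neg_div])]
  congr 1
  refine tsum_congr fun n => ?_
  rw [gaussWeight, if_neg (by omega)]
  push_cast
  rfl

/-- `y² ≥ 2y - 1` dominates the Gaussian sum by a geometric series of ratio `exp(-2c/h)`, whose sum
is estimated through `exp(2c/h) ≥ 1 + 2c/h`. -/
lemma tsum_gaussWeight_le_linear {c h : ℝ} (hc : 0 < c) (hh : 0 < h) :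
    ∑' k, gaussWeight c h k ≤ ENNReal.ofReal (Real.exp c / c * h) := by
  have hr0 : 0 < Real.exp (-(2 * c / h)) := Real.exp_pos _
  have hr1 : Real.exp (-(2 * c / h)) < 1 := by
    refine (Real.exp_lt_exp.mpr ?_).trans_eq Real.exp_zero
    have : 0 < 2 * c / h := by positivity
    linarith
  set q := Real.exp (-(2 * c / h)) with hq
  have hterm (n : ℕ) : Real.exp (-(c * ((n + 1 : ℝ) / h) ^ 2)) ≤ Real.exp c * q * q ^ n := by
    rw [hq, mul_assoc, ← pow_succ', ← Real.exp_nat_mul, ← Real.exp_add]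
    refine Real.exp_le_exp.mpr ?_
    have : 0 ≤ c * ((n + 1 : ℝ) / h - 1) ^ 2 := by positivity
    have e : ((n + 1 : ℕ) : ℝ) * -(2 * c / h) = -(2 * c * ((n + 1 : ℝ) / h)) := by
      push_cast; ring
    rw [e]
    linarith
  have hsum : ∑' n : ℕ, ENNReal.ofReal (Real.exp c * q * q ^ n) =
      ENNReal.ofReal (Real.exp c * q * (1 - q)⁻¹) := by
    rw [← ENNReal.ofReal_tsum_of_nonneg (fun n => by positivity)
      ((summable_geometric_of_lt_one hr0.le hr1).mul_left _), tsum_mul_left,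
      tsum_geometric_of_lt_one hr0.le hr1]
  have hfin : q * (1 - q)⁻¹ ≤ h / (2 * c) := by
    rw [← div_eq_mul_inv, div_le_div_iff₀ (by linarith) (by positivity)]
    have h1 : q * Real.exp (2 * c / h) = 1 := by rw [hq, ← Real.exp_add]; simp
    have h2 := Real.add_one_le_exp (2 * c / h)
    have h3 : q * (2 * c / h + 1) ≤ 1 := by
      exact (mul_le_mul_of_nonneg_left h2 hr0.le).trans_eq h1
    have h4 : h * (2 * c / h) = 2 * c := by field_simp
    calc q * (2 * c) = h * (q * (2 * c / h + 1) - q) := by linear_combination -q * h4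
      _ ≤ h * (1 - q) := by gcongr
  rw [tsum_gaussWeight]
  calc _ ≤ 2 * ∑' n : ℕ, ENNReal.ofReal (Real.exp c * q * q ^ n) := by
        gcongr with n
        exact hterm n
    _ = ENNReal.ofReal (2 * (Real.exp c * (q * (1 - q)⁻¹))) := by
        rw [hsum, ENNReal.ofReal_mul (p := 2) (by norm_num), mul_assoc]
        simp
    _ ≤ ENNReal.ofReal (2 * (Real.exp c * (h / (2 * c)))) := by gcongr
    _ = _ := by congr 1; field_simp

/-- `exp(-y) ≤ 1/y` compares the weights with `h² / (c n²)`, a summable series. -/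
lemma exists_tsum_gaussWeight_le_sq {c : ℝ} (hc : 0 < c) :
    ∃ C > 0, ∀ h > 0, ∑' k, gaussWeight c h k ≤ ENNReal.ofReal (C * h ^ 2) := by
  have hS : Summable fun n : ℕ => 1 / ((n + 1 : ℝ)) ^ 2 := by
    have := (summable_nat_add_iff 1).mpr (Real.summable_one_div_nat_pow.mpr one_lt_two)
    simpa using this
  have hS0 : 0 < ∑' n : ℕ, 1 / ((n + 1 : ℝ)) ^ 2 :=
    hS.tsum_pos (fun n => by positivity) 0 (by norm_num)
  refine ⟨2 * (1 / c * ∑' n : ℕ, 1 / ((n + 1 : ℝ)) ^ 2), by positivity, fun h hh => ?_⟩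
  have hterm (n : ℕ) : Real.exp (-(c * ((n + 1 : ℝ) / h) ^ 2)) ≤
      h ^ 2 / c * (1 / ((n + 1 : ℝ)) ^ 2) := by
    have hpos : 0 < c * ((n + 1 : ℝ) / h) ^ 2 := by positivity
    calc Real.exp (-(c * ((n + 1 : ℝ) / h) ^ 2))
        = (Real.exp (c * ((n + 1 : ℝ) / h) ^ 2))⁻¹ := Real.exp_neg _
      _ ≤ (c * ((n + 1 : ℝ) / h) ^ 2)⁻¹ := by
        gcongr
        linarith [Real.add_one_le_exp (c * ((n + 1 : ℝ) / h) ^ 2)]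
      _ = _ := by field_simp
  rw [tsum_gaussWeight]
  calc _ ≤ 2 * ∑' n : ℕ, ENNReal.ofReal (h ^ 2 / c * (1 / ((n + 1 : ℝ)) ^ 2)) := by
        gcongr with n
        exact hterm n
    _ = 2 * ENNReal.ofReal (h ^ 2 / c * ∑' n : ℕ, 1 / ((n + 1 : ℝ)) ^ 2) := by
        rw [← ENNReal.ofReal_tsum_of_nonneg (fun n => by positivity) (hS.mul_left _),
          tsum_mul_left]
    _ = _ := by
        rw [show (2 : ℝ≥0∞) = ENNReal.ofReal 2 by simp, ← ENNReal.ofReal_mul (by norm_num)]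
        congr 1
        ring

/-- Boxes other than the central one are sorted by which of the two indices vanish. If neither does,
the linear bound is applied in each variable: `hx hy ≤ hx² + hy²` for all mesh sizes, whereas `hx²
hy²` would not be controlled for large meshes. -/
lemma exists_tsum_gaussWeight_prod_le {c : ℝ} (hc : 0 < c) :
    ∃ C > 0, ∀ hx > 0, ∀ hy > 0, ∑' q : ℤ × ℤ,
      (gaussWeight c hx q.1 * gaussWeight c hy q.2
        + gaussWeight c hx q.1 * (if q.2 = 0 then 1 else 0)
        + (if q.1 = 0 then 1 else 0) * gaussWeight c hy q.2) ≤
      ENNReal.ofReal (C * (hx ^ 2 + hy ^ 2)) := by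
  obtain ⟨C, hC, hC2⟩ := exists_tsum_gaussWeight_le_sq hc
  set D := Real.exp c / c with hD
  have hD0 : 0 < D := by positivity
  refine ⟨D ^ 2 + C, by positivity, fun hx hhx hy hhy => ?_⟩
  have hp (f g : ℤ → ℝ≥0∞) : ∑' q : ℤ × ℤ, f q.1 * g q.2 = (∑' k, f k) * ∑' l, g l := by
    rw [ENNReal.tsum_prod (f := fun k l => f k * g l)]
    simp_rw [ENNReal.tsum_mul_left, ENNReal.tsum_mul_right]
  rw [ENNReal.tsum_add, ENNReal.tsum_add, hp, hp _ (fun l => if l = 0 then 1 else 0),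
    hp (fun l => if l = 0 then 1 else 0), tsum_ite_eq, mul_one, one_mul]
  calc _ ≤ ENNReal.ofReal (D * hx) * ENNReal.ofReal (D * hy) + ENNReal.ofReal (C * hx ^ 2)
        + ENNReal.ofReal (C * hy ^ 2) := by
        gcongr
        · exact tsum_gaussWeight_le_linear hc hhx
        · exact tsum_gaussWeight_le_linear hc hhy
        · exact hC2 hx hhx
        · exact hC2 hy hhy
    _ = ENNReal.ofReal (D * hx * (D * hy) + C * hx ^ 2 + C * hy ^ 2) := by
        rw [← ENNReal.ofReal_mul (by positivity), ← ENNReal.ofReal_add (by positivity)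
          (by positivity), ← ENNReal.ofReal_add (by positivity) (by positivity)]
    _ ≤ _ := by
        refine ENNReal.ofReal_le_ofReal ?_
        have : D ^ 2 * (hx * hy) ≤ D ^ 2 * (hx ^ 2 + hy ^ 2) := by
          gcongr
          nlinarith [sq_nonneg (hx - hy), sq_nonneg hx, sq_nonneg hy]
        nlinarith

/-- On the box `q = (k, l)` one has `|w.1| ≥ |k|/(2 hx)` and `|w.2| ≥ |l|/(2 hy)`, which turns the
rate `c` into `c/4`. The weights are squared on the right, hence `c/8`. -/
lemma lintegral_shiftBox_le {c hx hy : ℝ} (hc : 0 < c) (hhx : 0 < hx) (hhy : 0 < hy)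
    {H : ℝ × ℝ → ℂ} {F : ℝ × ℝ → ℝ≥0∞}
    (hHF : ∀ w, ‖H w‖ₑ ^ 2 ≤ F w * ENNReal.ofReal (Real.exp (-(c * (w.1 ^ 2 + w.2 ^ 2)))))
    (q : ℤ × ℤ) :
    ∫⁻ w in shiftBox hx hy q, ‖H w‖ₑ ^ 2 ≤
      (ENNReal.ofReal (Real.exp (-(c / 8 * (q.1 / hx) ^ 2))) *
        ENNReal.ofReal (Real.exp (-(c / 8 * (q.2 / hy) ^ 2)))) ^ 2 * ∫⁻ w, F w := by
  have key (w : ℝ × ℝ) (hw : w ∈ shiftBox hx hy q) : ‖H w‖ₑ ^ 2 ≤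
      (ENNReal.ofReal (Real.exp (-(c / 8 * (q.1 / hx) ^ 2))) *
        ENNReal.ofReal (Real.exp (-(c / 8 * (q.2 / hy) ^ 2)))) ^ 2 * F w := by
    refine (hHF w).trans ?_
    rw [mul_comm]
    gcongr
    rw [← ENNReal.ofReal_mul (Real.exp_nonneg _), ← Real.exp_add,
      ← ENNReal.ofReal_pow (Real.exp_nonneg _), ← Real.exp_nat_mul]
    refine ENNReal.ofReal_le_ofReal (Real.exp_le_exp.mpr ?_)
    have hsq {h x : ℝ} {k : ℤ} (hh : 0 < h) (h1 : |(k : ℝ)| ≤ 2 * h * |x|) :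
        (k / h) ^ 2 ≤ 4 * x ^ 2 := by
      rw [div_pow, div_le_iff₀ (by positivity), ← sq_abs (k : ℝ), ← sq_abs x]
      calc |(k : ℝ)| ^ 2 ≤ (2 * h * |x|) ^ 2 := by gcongr
        _ = _ := by ring
    have h1 := hsq hhx (abs_le_two_mul_of_mem_Ioc hhx hw.1)
    have h2 := hsq hhy (abs_le_two_mul_of_mem_Ioc hhy hw.2)
    push_cast
    nlinarith
  calc ∫⁻ w in shiftBox hx hy q, ‖H w‖ₑ ^ 2
      ≤ ∫⁻ w in shiftBox hx hy q, (ENNReal.ofReal (Real.exp (-(c / 8 * (q.1 / hx) ^ 2))) *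
        ENNReal.ofReal (Real.exp (-(c / 8 * (q.2 / hy) ^ 2)))) ^ 2 * F w :=
        setLIntegral_mono' (measurableSet_shiftBox ..) key
    _ ≤ ∫⁻ w, (ENNReal.ofReal (Real.exp (-(c / 8 * (q.1 / hx) ^ 2))) *
        ENNReal.ofReal (Real.exp (-(c / 8 * (q.2 / hy) ^ 2)))) ^ 2 * F w :=
        setLIntegral_le_lintegral _ _
    _ = _ := by
        rw [lintegral_const_mul' _ _ (by finiteness)]

/-- The frequencies outside the central box contribute little to the values at the grid points. -/
theorem exists_alias_le {c : ℝ} (hc : 0 < c) : ∃ C > 0, ∀ hx > 0, ∀ hy > 0,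
    ∀ (H : ℝ × ℝ → ℂ) (F : ℝ × ℝ → ℝ≥0∞), Integrable H →
    (∀ w, ‖H w‖ₑ ^ 2 ≤ F w * ENNReal.ofReal (Real.exp (-(c * (w.1 ^ 2 + w.2 ^ 2))))) →
    ∑' p : ℤ × ℤ, ‖∫ w in (shiftBox hx hy 0)ᶜ, H w * gridWave hx hy p w‖ₑ ^ 2
      * ENNReal.ofReal (hx * hy) ≤
      ENNReal.ofReal (C * (hx ^ 2 + hy ^ 2)) ^ 2 * ∫⁻ w, F w := by
  obtain ⟨C, hC, hCs⟩ := exists_tsum_gaussWeight_prod_le (show 0 < c / 8 by positivity)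
  refine ⟨C, hC, fun hx hhx hy hhy H F hH hHF => ?_⟩
  have hm0 : MeasurableSet (shiftBox hx hy 0)ᶜ := (measurableSet_shiftBox ..).compl
  -- Cutting off the central box allows summation over all translates, with zero contribution from
  -- `q = 0`.
  set H' : ℝ × ℝ → ℂ := (shiftBox hx hy 0)ᶜ.indicator H with hH'
  have hH'i : Integrable H' := hH.indicator hm0
  set s : ℝ≥0∞ := ENNReal.ofReal (√(hx * hy)) with hs
  have hs2 : s ^ 2 = ENNReal.ofReal (hx * hy) := by
    rw [hs, ← ENNReal.ofReal_pow (Real.sqrt_nonneg _), Real.sq_sqrt (by positivity)]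
  set A : ℤ × ℤ → ℝ≥0∞ := fun q => gaussWeight (c / 8) hx q.1 * gaussWeight (c / 8) hy q.2
        + gaussWeight (c / 8) hx q.1 * (if q.2 = 0 then 1 else 0)
        + (if q.1 = 0 then 1 else 0) * gaussWeight (c / 8) hy q.2 with hA
  have hcont (p : ℤ × ℤ) : Continuous (gridWave hx hy p) := by
    unfold gridWave
    fun_prop
  have hsplit (p : ℤ × ℤ) : ‖∫ w in (shiftBox hx hy 0)ᶜ, H w * gridWave hx hy p w‖ₑ ≤
      ∑' q, ‖∫ w in shiftBox hx hy q, H' w * gridWave hx hy p w‖ₑ := by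
    have hint : Integrable fun w => H' w * gridWave hx hy p w := by
      refine hH'i.mul_bdd (c := 1) (hcont p).aestronglyMeasurable ?_
      exact Filter.Eventually.of_forall fun w => (norm_wave _ _ _).le
    have h1 : ∫ w in (shiftBox hx hy 0)ᶜ, H w * gridWave hx hy p w =
        ∫ w, H' w * gridWave hx hy p w := by
      rw [← integral_indicator hm0]
      congr 1
      funext w
      rw [hH']
      by_cases hw : w ∈ (shiftBox hx hy 0)ᶜ <;> simp [Set.indicator, hw]
    have h2 := integral_iUnion (f := fun w => H' w * gridWave hx hy p w)
      (fun q => measurableSet_shiftBox hx hy q) (pairwise_disjoint_shiftBox hx hy)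
      hint.integrableOn
    rw [iUnion_shiftBox hhx hhy, Measure.restrict_univ] at h2
    rw [h1, h2]
    exact enorm_tsum_le_tsum_enorm
  have hbox (q : ℤ × ℤ) : ∑' p : ℤ × ℤ,
      (‖∫ w in shiftBox hx hy q, H' w * gridWave hx hy p w‖ₑ * s) ^ 2 ≤
        A q ^ 2 * ∫⁻ w, F w := by
    simp_rw [mul_pow, hs2]
    have hb := tsum_enorm_setIntegral_gridWave_le hhx hhy (-(1 / (2 * hx)) + q.1 * (1 / hx))
      (-(1 / (2 * hy)) + q.2 * (1 / hy)) hH'i.1.restrict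
    refine hb.trans ?_
    by_cases hq : q = 0
    · have : ∫⁻ w in shiftBox hx hy q, ‖H' w‖ₑ ^ 2 = 0 := by
        rw [setLIntegral_congr_fun (g := 0) (measurableSet_shiftBox ..)]
        · simp
        · intro w hw
          rw [hq] at hw
          simp [hH', hw]
      exact this.trans_le zero_le
    · have hH'F (w : ℝ × ℝ) : ‖H' w‖ₑ ^ 2 ≤
          F w * ENNReal.ofReal (Real.exp (-(c * (w.1 ^ 2 + w.2 ^ 2)))) := by
        refine le_trans ?_ (hHF w)
        gcongr
        exact enorm_indicator_le_enorm_self _ _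
      refine (lintegral_shiftBox_le hc hhx hhy hH'F q).trans ?_
      gcongr
      rw [hA]
      simp only [gaussWeight]
      rcases q with ⟨k, l⟩
      by_cases h1 : k = 0 <;> by_cases h2 : l = 0
      · exact absurd (by rw [h1, h2]; rfl) hq
      all_goals simp [h1, h2]
  calc _ = ∑' p : ℤ × ℤ, (‖∫ w in (shiftBox hx hy 0)ᶜ, H w * gridWave hx hy p w‖ₑ * s) ^ 2 := by
        simp_rw [mul_pow, hs2]
    _ ≤ ∑' p : ℤ × ℤ,
        (∑' q, ‖∫ w in shiftBox hx hy q, H' w * gridWave hx hy p w‖ₑ * s) ^ 2 := by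
        refine ENNReal.tsum_le_tsum fun p => ?_
        rw [ENNReal.tsum_mul_right]
        gcongr
        exact hsplit p
    _ ≤ (∑' q, A q) ^ 2 * ∫⁻ w, F w := tsum_tsum_sq_le _ _ _ hbox
    _ ≤ _ := by
        gcongr
        exact hCs hx hhx hy hhy

/-! ### Uniqueness of square summable solutions of the implicit step -/

section Energy

variable {v : ℤ × ℤ → ℝ}

lemma summable_mul_shift (hv : Summable fun p => v p ^ 2) (e : ℤ × ℤ) :
    Summable fun p => v p * v (p + e) := by
  have h2 : Summable fun p => v (p + e) ^ 2 := (Equiv.addRight e).summable_iff.mpr hv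
  refine Summable.of_norm_bounded (hv.add h2) fun p => ?_
  rw [Real.norm_eq_abs, abs_le]
  constructor <;> nlinarith [sq_nonneg (v p + v (p + e)), sq_nonneg (v p - v (p + e))]

lemma hasSum_mul_shift_neg {e : ℤ × ℤ} {s : ℝ} (h : HasSum (fun p => v p * v (p + e)) s) :
    HasSum (fun p => v p * v (p - e)) s := by
  have := (Equiv.addRight (-e)).hasSum_iff.mpr h
  refine this.congr_fun fun p => ?_
  simp [← sub_eq_add_neg, mul_comm]

lemma hasSum_mul_shift_le {e : ℤ × ℤ} {s S : ℝ} (hS : HasSum (fun p => v p ^ 2) S)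
    (h : HasSum (fun p => v p * v (p + e)) s) : s ≤ S := by
  have h2 : HasSum (fun p => v (p + e) ^ 2) S := (Equiv.addRight e).hasSum_iff.mpr hS
  have := hasSum_le (fun p => ?_) (h.mul_left 2) (hS.add h2)
  · linarith
  · nlinarith [sq_nonneg (v p - v (p + e))]

end Energy

/-- Energy argument: in the pairing of the equation with `V`, the central differences are skew and
contribute nothing, while minus the second differences are nonnegative. Hence `∑ V² ≤ 0`. -/
lemma eq_zero_of_implicitOp_eq_zero (μx μy : ℝ) {k : ℝ} (hk : 0 ≤ k) (hx hy : ℝ) {V : Grid}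
    (hV : Summable fun p : ℤ × ℤ => V p.1 p.2 ^ 2)
    (h0 : implicitOp μx μy k hx hy V = 0) : V = 0 := by
  obtain ⟨S, hS⟩ := hV
  have hPx := (summable_mul_shift (v := fun p => V p.1 p.2) ⟨S, hS⟩ (1, 0)).hasSum
  have hPy := (summable_mul_shift (v := fun p => V p.1 p.2) ⟨S, hS⟩ (0, 1)).hasSum
  set X := ∑' p : ℤ × ℤ, V p.1 p.2 * V (p + (1, 0)).1 (p + (1, 0)).2
  set Y := ∑' p : ℤ × ℤ, V p.1 p.2 * V (p + (0, 1)).1 (p + (0, 1)).2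
  have hPx' := hasSum_mul_shift_neg (v := fun p => V p.1 p.2) hPx
  have hPy' := hasSum_mul_shift_neg (v := fun p => V p.1 p.2) hPy
  have hX := hasSum_mul_shift_le (v := fun p => V p.1 p.2) hS hPx
  have hY := hasSum_mul_shift_le (v := fun p => V p.1 p.2) hS hPy
  -- The equation multiplied by `V` and summed, written through the correlations `X`, `Y` of `V`
  -- with its shifts, which satisfy `X ≤ S` and `Y ≤ S`.
  have hsum := ((((hS.add ((hPx.sub hPx').mul_left (μx * k / (2 * hx)))).add
    ((hPy.sub hPy').mul_left (μy * k / (2 * hy)))).sub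
    (((hPx.sub (hS.mul_left 2)).add hPx').mul_left (k / (2 * hx ^ 2)))).sub
    (((hPy.sub (hS.mul_left 2)).add hPy').mul_left (k / (2 * hy ^ 2))))
  have hz := hsum.unique (hasSum_zero.congr_fun fun p => by
    have := congrFun (congrFun h0 p.1) p.2
    simp only [implicitOp, Dx, Dy, Dxx, Dyy, Pi.add_apply, Pi.sub_apply, Pi.smul_apply,
      smul_eq_mul, Pi.zero_apply] at this
    simp only [Prod.fst_add, Prod.snd_add, Prod.fst_sub, Prod.snd_sub, add_zero, sub_zero]
    linear_combination V p.1 p.2 * this)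
  have hSle : S ≤ 0 := by
    have a1 : 0 ≤ k / (2 * hx ^ 2) * (2 * (S - X)) :=
      mul_nonneg (by positivity) (by linarith)
    have a2 : 0 ≤ k / (2 * hy ^ 2) * (2 * (S - Y)) :=
      mul_nonneg (by positivity) (by linarith)
    linarith
  funext i j
  have h1 : V i j ^ 2 ≤ S := le_hasSum hS (i, j) fun q _ => sq_nonneg _
  have h2 : V i j ^ 2 = 0 := le_antisymm (h1.trans hSle) (sq_nonneg _)
  simpa using h2

lemma implicitOp_sub (μx μy k hx hy : ℝ) (U V : Grid) :
    implicitOp μx μy k hx hy (U - V) =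
      implicitOp μx μy k hx hy U - implicitOp μx μy k hx hy V := by
  funext i j
  simp only [implicitOp, Dx, Dy, Dxx, Dyy, Pi.add_apply, Pi.sub_apply, Pi.smul_apply,
    smul_eq_mul]
  ring

lemma implicitOp_injOn (μx μy : ℝ) {k : ℝ} (hk : 0 ≤ k) (hx hy : ℝ) {U V : Grid}
    (hU : Summable fun p : ℤ × ℤ => U p.1 p.2 ^ 2) (hV : Summable fun p : ℤ × ℤ => V p.1 p.2 ^ 2)
    (h : implicitOp μx μy k hx hy U = implicitOp μx μy k hx hy V) : U = V := by
  rw [← sub_eq_zero]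
  refine eq_zero_of_implicitOp_eq_zero μx μy hk hx hy ?_ (by rw [implicitOp_sub, h, sub_self])
  refine Summable.of_nonneg_of_le (fun _ => sq_nonneg _) (fun p => ?_)
    ((hU.mul_left 2).add (hV.mul_left 2))
  simp only [Pi.sub_apply]
  nlinarith [sq_nonneg (U p.1 p.2 + V p.1 p.2)]

/-! ### Grid functions with a given discrete Fourier transform -/

/-- The grid function with discrete Fourier transform `G`. -/
def synth (hx hy : ℝ) (G : ℝ × ℝ → ℂ) : Grid := fun i j =>
  (∫ w in shiftBox hx hy 0, G w * gridWave hx hy (i, j) w).re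

lemma shiftBox_subset (hx hy : ℝ) (q : ℤ × ℤ) : ∃ K : Set (ℝ × ℝ), IsCompact K ∧
    shiftBox hx hy q ⊆ K :=
  ⟨_, isCompact_Icc.prod isCompact_Icc,
    Set.prod_mono Set.Ioc_subset_Icc_self Set.Ioc_subset_Icc_self⟩

lemma exists_bound_shiftBox (hx hy : ℝ) (q : ℤ × ℤ) {M : ℝ × ℝ → ℂ} (hM : Continuous M) :
    ∃ C, ∀ w ∈ shiftBox hx hy q, ‖M w‖ ≤ C := by
  obtain ⟨K, hK, hsub⟩ := shiftBox_subset hx hy q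
  obtain ⟨C, hC⟩ := hK.exists_bound_of_continuousOn hM.continuousOn
  exact ⟨C, fun w hw => hC w (hsub hw)⟩

variable {hx hy : ℝ}

lemma memLp_mul_continuous {G M : ℝ × ℝ → ℂ} {p : ℝ≥0∞}
    (hG : MemLp G p (volume.restrict (shiftBox hx hy 0))) (hM : Continuous M) :
    MemLp (fun w => G w * M w) p (volume.restrict (shiftBox hx hy 0)) := by
  obtain ⟨C, hC⟩ := exists_bound_shiftBox hx hy 0 hM
  refine MemLp.mul (p := p) (q := ∞) ?_ hG
  exact memLp_top_of_bound hM.aestronglyMeasurable C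
    ((ae_restrict_iff' (measurableSet_shiftBox ..)).mpr (Filter.Eventually.of_forall hC))

instance (hx hy : ℝ) (q : ℤ × ℤ) : IsFiniteMeasure (volume.restrict (shiftBox hx hy q)) := by
  unfold shiftBox
  infer_instance

lemma integrable_mul_gridWave {G : ℝ × ℝ → ℂ}
    (hG : Integrable G (volume.restrict (shiftBox hx hy 0))) (p : ℤ × ℤ) :
    Integrable (fun w => G w * gridWave hx hy p w) (volume.restrict (shiftBox hx hy 0)) := by
  rw [← memLp_one_iff_integrable] at hG ⊢
  refine memLp_mul_continuous hG ?_
  unfold gridWave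
  fun_prop

lemma integrable_mul_continuous {G M : ℝ × ℝ → ℂ}
    (hG : Integrable G (volume.restrict (shiftBox hx hy 0))) (hM : Continuous M) :
    Integrable (fun w => G w * M w) (volume.restrict (shiftBox hx hy 0)) := by
  rw [← memLp_one_iff_integrable] at hG ⊢
  exact memLp_mul_continuous hG hM

lemma synth_add {G G' : ℝ × ℝ → ℂ} (hG : Integrable G (volume.restrict (shiftBox hx hy 0)))
    (hG' : Integrable G' (volume.restrict (shiftBox hx hy 0))) :
    synth hx hy (G + G') = synth hx hy G + synth hx hy G' := by
  funext i j
  simp only [synth, Pi.add_apply, add_mul]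
  rw [integral_add (integrable_mul_gridWave hG _) (integrable_mul_gridWave hG' _), add_re]

lemma synth_smul (a : ℝ) (G : ℝ × ℝ → ℂ) :
    synth hx hy (fun w => (a : ℂ) * G w) = a • synth hx hy G := by
  funext i j
  simp only [synth, Pi.smul_apply, mul_assoc, smul_eq_mul]
  rw [integral_const_mul, re_ofReal_mul]

/-- Translation on the grid is multiplication by a plane wave on the Fourier side; the symbols of
all difference operators follow. -/
lemma synth_shift (G : ℝ × ℝ → ℂ) (a b i j : ℤ) :
    synth hx hy G (i + a) (j + b) = synth hx hy (fun w => G w * wave (a * hx) (b * hy) w) i j := by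
  simp only [synth, gridWave]
  congr 2
  funext w
  push_cast
  rw [add_mul, add_mul, wave_add]
  ring

/-! ### Symbols of the difference operators and of the two sides of the scheme. -/

/-- The symbol of `Dx`. -/
def symDx (hx : ℝ) (w : ℝ × ℝ) : ℂ := wave hx 0 w - wave (-hx) 0 w

/-- The symbol of `Dy`. -/
def symDy (hy : ℝ) (w : ℝ × ℝ) : ℂ := wave 0 hy w - wave 0 (-hy) w

/-- The symbol of `Dxx`. -/
def symDxx (hx : ℝ) (w : ℝ × ℝ) : ℂ := wave hx 0 w - 2 + wave (-hx) 0 w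

/-- The symbol of `Dyy`. -/
def symDyy (hy : ℝ) (w : ℝ × ℝ) : ℂ := wave 0 hy w - 2 + wave 0 (-hy) w

@[fun_prop] lemma continuous_symDx (h : ℝ) : Continuous (symDx h) := by
  unfold symDx; fun_prop

@[fun_prop] lemma continuous_symDy (h : ℝ) : Continuous (symDy h) := by
  unfold symDy; fun_prop

@[fun_prop] lemma continuous_symDxx (h : ℝ) : Continuous (symDxx h) := by
  unfold symDxx; fun_prop

@[fun_prop] lemma continuous_symDyy (h : ℝ) : Continuous (symDyy h) := by
  unfold symDyy; fun_prop

lemma wave_fst_eq (h : ℝ) (w : ℝ × ℝ) :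
    wave h 0 w = (Real.cos (2 * Real.pi * w.1 * h) : ℂ) + (Real.sin (2 * Real.pi * w.1 * h) : ℂ) * I := by
  rw [wave, exp_mul_I, ← ofReal_cos, ← ofReal_sin]
  congr 3 <;> ring_nf

lemma wave_snd_eq (h : ℝ) (w : ℝ × ℝ) :
    wave 0 h w = (Real.cos (2 * Real.pi * w.2 * h) : ℂ) + (Real.sin (2 * Real.pi * w.2 * h) : ℂ) * I := by
  rw [wave, exp_mul_I, ← ofReal_cos, ← ofReal_sin]
  congr 3 <;> ring_nf

lemma mul_symC {h : ℝ} (hh : h ≠ 0) (ξ : ℝ) : h * symC h ξ = Real.sin (ξ * h) := by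
  rw [symC]; field_simp

lemma sq_mul_symS_sq {h : ℝ} (hh : h ≠ 0) (ξ : ℝ) :
    h ^ 2 * symS h ξ ^ 2 = 2 - 2 * Real.cos (ξ * h) := by
  have h1 : h * symS h ξ = 2 * Real.sin (ξ * h / 2) := by rw [symS]; field_simp
  have h2 := Real.cos_sq (ξ * h / 2)
  rw [show 2 * (ξ * h / 2) = ξ * h by ring] at h2
  rw [← mul_pow, h1, mul_pow, Real.sin_sq, h2]
  ring

lemma symDx_eq (hhx : hx ≠ 0) (w : ℝ × ℝ) :
    symDx hx w = ((2 * hx * symC hx (2 * Real.pi * w.1) : ℝ) : ℂ) * I := by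
  rw [mul_assoc, mul_symC hhx, symDx, wave_fst_eq, wave_fst_eq, mul_neg, Real.cos_neg,
    Real.sin_neg]
  push_cast; ring

lemma symDy_eq (hhy : hy ≠ 0) (w : ℝ × ℝ) :
    symDy hy w = ((2 * hy * symC hy (2 * Real.pi * w.2) : ℝ) : ℂ) * I := by
  rw [mul_assoc, mul_symC hhy, symDy, wave_snd_eq, wave_snd_eq, mul_neg, Real.cos_neg,
    Real.sin_neg]
  push_cast; ring

lemma symDxx_eq (hhx : hx ≠ 0) (w : ℝ × ℝ) :
    symDxx hx w = ((-(hx ^ 2 * symS hx (2 * Real.pi * w.1) ^ 2) : ℝ) : ℂ) := by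
  rw [sq_mul_symS_sq hhx, symDxx, wave_fst_eq, wave_fst_eq, mul_neg, Real.cos_neg, Real.sin_neg]
  push_cast; ring

lemma symDyy_eq (hhy : hy ≠ 0) (w : ℝ × ℝ) :
    symDyy hy w = ((-(hy ^ 2 * symS hy (2 * Real.pi * w.2) ^ 2) : ℝ) : ℂ) := by
  rw [sq_mul_symS_sq hhy, symDyy, wave_snd_eq, wave_snd_eq, mul_neg, Real.cos_neg, Real.sin_neg]
  push_cast; ring

section Operators

variable {G : ℝ × ℝ → ℂ}

lemma synth_sub {G' : ℝ × ℝ → ℂ} (hG : Integrable G (volume.restrict (shiftBox hx hy 0)))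
    (hG' : Integrable G' (volume.restrict (shiftBox hx hy 0))) :
    synth hx hy (G - G') = synth hx hy G - synth hx hy G' := by
  have h := synth_add (hx := hx) (hy := hy) hG (hG'.const_mul ((-1 : ℝ) : ℂ))
  rw [synth_smul] at h
  rw [neg_one_smul, ← sub_eq_add_neg] at h
  rw [← h]
  congr 1
  funext w
  simp only [Pi.sub_apply, Pi.add_apply]
  push_cast
  ring

lemma Dx_synth (hG : Integrable G (volume.restrict (shiftBox hx hy 0))) :
    Dx (synth hx hy G) = synth hx hy (fun w => G w * symDx hx w) := by
  funext i j
  have h1 := synth_shift (hx := hx) (hy := hy) G 1 0 i j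
  have h2 := synth_shift (hx := hx) (hy := hy) G (-1) 0 i j
  simp only [add_zero, Int.cast_zero, zero_mul, Int.cast_one, one_mul, Int.cast_neg,
    neg_mul, ← sub_eq_add_neg] at h1 h2
  have e : (fun w => G w * symDx hx w) =
      (fun w => G w * wave hx 0 w) - fun w => G w * wave (-hx) 0 w := by
    funext w
    simp only [symDx, Pi.sub_apply]
    ring
  rw [Dx, h1, h2, e, synth_sub (integrable_mul_continuous hG (by fun_prop))
    (integrable_mul_continuous hG (by fun_prop))]
  rfl

lemma Dy_synth (hG : Integrable G (volume.restrict (shiftBox hx hy 0))) :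
    Dy (synth hx hy G) = synth hx hy (fun w => G w * symDy hy w) := by
  funext i j
  have h1 := synth_shift (hx := hx) (hy := hy) G 0 1 i j
  have h2 := synth_shift (hx := hx) (hy := hy) G 0 (-1) i j
  simp only [add_zero, Int.cast_zero, zero_mul, Int.cast_one, one_mul, Int.cast_neg,
    neg_mul, ← sub_eq_add_neg] at h1 h2
  have e : (fun w => G w * symDy hy w) =
      (fun w => G w * wave 0 hy w) - fun w => G w * wave 0 (-hy) w := by
    funext w
    simp only [symDy, Pi.sub_apply]
    ring
  rw [Dy, h1, h2, e, synth_sub (integrable_mul_continuous hG (by fun_prop))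
    (integrable_mul_continuous hG (by fun_prop))]
  rfl

lemma Dxx_synth (hG : Integrable G (volume.restrict (shiftBox hx hy 0))) :
    Dxx (synth hx hy G) = synth hx hy (fun w => G w * symDxx hx w) := by
  funext i j
  have h1 := synth_shift (hx := hx) (hy := hy) G 1 0 i j
  have h2 := synth_shift (hx := hx) (hy := hy) G (-1) 0 i j
  simp only [add_zero, Int.cast_zero, zero_mul, Int.cast_one, one_mul, Int.cast_neg,
    neg_mul, ← sub_eq_add_neg] at h1 h2
  have e : (fun w => G w * symDxx hx w) =
      (fun w => G w * wave hx 0 w) - (fun w => ((2 : ℝ) : ℂ) * G w) + fun w => G w * wave (-hx) 0 w := by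
    funext w
    simp only [symDxx, Pi.sub_apply, Pi.add_apply]
    push_cast
    ring
  have i1 := integrable_mul_continuous hG (continuous_wave hx 0)
  rw [Dxx, h1, h2, e, synth_add (i1.sub (hG.const_mul _))
    (integrable_mul_continuous hG (by fun_prop)), synth_sub i1 (hG.const_mul _), synth_smul]
  rfl

lemma Dyy_synth (hG : Integrable G (volume.restrict (shiftBox hx hy 0))) :
    Dyy (synth hx hy G) = synth hx hy (fun w => G w * symDyy hy w) := by
  funext i j
  have h1 := synth_shift (hx := hx) (hy := hy) G 0 1 i j
  have h2 := synth_shift (hx := hx) (hy := hy) G 0 (-1) i j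
  simp only [add_zero, Int.cast_zero, zero_mul, Int.cast_one, one_mul, Int.cast_neg,
    neg_mul, ← sub_eq_add_neg] at h1 h2
  have e : (fun w => G w * symDyy hy w) =
      (fun w => G w * wave 0 hy w) - (fun w => ((2 : ℝ) : ℂ) * G w) + fun w => G w * wave 0 (-hy) w := by
    funext w
    simp only [symDyy, Pi.sub_apply, Pi.add_apply]
    push_cast
    ring
  have i1 := integrable_mul_continuous hG (continuous_wave 0 hy)
  rw [Dyy, h1, h2, e, synth_add (i1.sub (hG.const_mul _))
    (integrable_mul_continuous hG (by fun_prop)), synth_sub i1 (hG.const_mul _), synth_smul]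
  rfl

lemma Dxy_eq (V : Grid) : Dxy V = Dx (Dy V) := by
  funext i j
  simp only [Dxy, Dx, Dy]
  ring

lemma implicitOp_synth (hhx : 0 < hx) (hhy : 0 < hy) (μx μy k : ℝ)
    (hG : Integrable G (volume.restrict (shiftBox hx hy 0))) :
    implicitOp μx μy k hx hy (synth hx hy G) = synth hx hy (fun w =>
      G w * (1 + implicitSymbol μx μy k hx hy (2 * Real.pi * w.1) (2 * Real.pi * w.2))) := by
  have i1 := integrable_mul_continuous hG (continuous_symDx hx)
  have i2 := integrable_mul_continuous hG (continuous_symDy hy)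
  have i3 := integrable_mul_continuous hG (continuous_symDxx hx)
  have i4 := integrable_mul_continuous hG (continuous_symDyy hy)
  rw [implicitOp, Dx_synth hG, Dy_synth hG, Dxx_synth hG, Dyy_synth hG]
  simp only [← synth_smul]
  rw [← synth_add hG (i1.const_mul _), ← synth_add (hG.add (i1.const_mul _)) (i2.const_mul _),
    ← synth_sub ((hG.add (i1.const_mul _)).add (i2.const_mul _)) (i3.const_mul _),
    ← synth_sub (((hG.add (i1.const_mul _)).add (i2.const_mul _)).sub (i3.const_mul _))
      (i4.const_mul _)]
  congr 1
  funext w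
  simp only [Pi.sub_apply, Pi.add_apply]
  rw [symDx_eq hhx.ne', symDy_eq hhy.ne', symDxx_eq hhx.ne', symDyy_eq hhy.ne', implicitSymbol]
  have h1 : (hx : ℂ) ≠ 0 := by exact_mod_cast hhx.ne'
  have h2 : (hy : ℂ) ≠ 0 := by exact_mod_cast hhy.ne'
  push_cast
  field_simp
  ring

/-- The mixed difference enters with coefficient `√(ρx ρy) k = √(ρx k) √(ρy k)`, so the quadratic
noise terms complete a square. The symbol depends on both increments only through one scalar `s`;
the `-1` in the Milstein corrections produces the `q/2`. -/
lemma explicitOp_synth (hhx : 0 < hx) (hhy : 0 < hy) {r : Corr} (hρx : 0 ≤ r.ρx)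
    (hρy : 0 ≤ r.ρy) {k : ℝ} (hk : 0 ≤ k) (zx zy : ℝ)
    (hG : Integrable G (volume.restrict (shiftBox hx hy 0))) :
    explicitOp r k hx hy zx zy (synth hx hy G) = synth hx hy (fun w =>
      G w * stepNum (noiseSymbol r.ρx k hx (2 * Real.pi * w.1) ^ 2
        + noiseSymbol r.ρy k hy (2 * Real.pi * w.2) ^ 2)
        (noiseSymbol r.ρx k hx (2 * Real.pi * w.1) * zx
          + noiseSymbol r.ρy k hy (2 * Real.pi * w.2) * zy)) := by
  have i1 := integrable_mul_continuous hG (continuous_symDx hx)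
  have i2 := integrable_mul_continuous hG (continuous_symDy hy)
  have i3 := integrable_mul_continuous i1 (continuous_symDx hx)
  have i4 := integrable_mul_continuous i2 (continuous_symDy hy)
  have i5 := integrable_mul_continuous i2 (continuous_symDx hx)
  rw [explicitOp, Dxy_eq, Dx_synth hG, Dy_synth hG, Dx_synth i1, Dy_synth i2, Dx_synth i2]
  simp only [← synth_smul]
  rw [← synth_sub hG (i1.const_mul _), ← synth_sub (hG.sub (i1.const_mul _)) (i2.const_mul _),
    ← synth_add ((hG.sub (i1.const_mul _)).sub (i2.const_mul _)) (i3.const_mul _),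
    ← synth_add (((hG.sub (i1.const_mul _)).sub (i2.const_mul _)).add (i3.const_mul _))
      (i4.const_mul _),
    ← synth_add ((((hG.sub (i1.const_mul _)).sub (i2.const_mul _)).add (i3.const_mul _)).add
      (i4.const_mul _)) (i5.const_mul _)]
  congr 1
  funext w
  simp only [Pi.sub_apply, Pi.add_apply]
  rw [symDx_eq hhx.ne', symDy_eq hhy.ne', stepNum]
  have h1 : (hx : ℂ) ≠ 0 := by exact_mod_cast hhx.ne'
  have h2 : (hy : ℂ) ≠ 0 := by exact_mod_cast hhy.ne'
  set a := √(r.ρx * k) with ha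
  set b := √(r.ρy * k) with hb
  have ea : r.ρx * k = a ^ 2 := (Real.sq_sqrt (by positivity)).symm
  have eb : r.ρy * k = b ^ 2 := (Real.sq_sqrt (by positivity)).symm
  have eab : √(r.ρx * r.ρy) * k = a * b := by
    rw [ha, hb, Real.sqrt_mul hρx, Real.sqrt_mul hρx, Real.sqrt_mul hρy]
    linear_combination -√r.ρx * √r.ρy * Real.mul_self_sqrt hk
  rw [ea, eb, eab]
  simp only [noiseSymbol, ← ha, ← hb]
  set cx := symC hx (2 * Real.pi * w.1)
  set cy := symC hy (2 * Real.pi * w.2)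
  push_cast
  field_simp
  -- After clearing denominators the two sides differ only by `I² = -1` in the products of two
  -- first-order symbols.
  linear_combination (32 * G w * (2 * a * zx * cx * b * zy * cy + (a : ℂ) ^ 2 * cx ^ 2 * (zx ^ 2 - 1)
    + b ^ 2 * cy ^ 2 * (zy ^ 2 - 1))) * (I_sq : I ^ 2 = -1)

end Operators

/-! ### Fourier form of the iterates. -/

lemma summable_synth_sq (hhx : 0 < hx) (hhy : 0 < hy) {G : ℝ × ℝ → ℂ}
    (hG : MemLp G 2 (volume.restrict (shiftBox hx hy 0))) :
    Summable fun p : ℤ × ℤ => synth hx hy G p.1 p.2 ^ 2 := by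
  have hb := tsum_enorm_setIntegral_gridWave_le hhx hhy _ _ hG.1
  have hfin : ∫⁻ w in shiftBox hx hy 0, ‖G w‖ₑ ^ 2 ≠ ∞ := by
    rw [lintegral_enorm_sq_eq]
    exact ENNReal.pow_ne_top hG.2.ne
  rw [ENNReal.tsum_mul_right] at hb
  have hh : ENNReal.ofReal (hx * hy) ≠ 0 := by
    rw [Ne, ENNReal.ofReal_eq_zero, not_le]
    positivity
  have h1 : ∑' p : ℤ × ℤ, ‖∫ w in shiftBox hx hy 0, G w * gridWave hx hy p w‖ₑ ^ 2 ≠ ∞ := by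
    intro h
    refine hfin (top_le_iff.mp (le_trans ?_ hb))
    rw [shiftBox] at h
    rw [h, ENNReal.top_mul hh]
  refine Summable.of_nonneg_of_le (fun _ => sq_nonneg _) (fun p => ?_) (ENNReal.summable_toReal h1)
  rw [ENNReal.toReal_pow, toReal_enorm, synth, ← sq_abs]
  gcongr
  exact abs_re_le_norm _

lemma continuous_symC_comp (h : ℝ) {f : ℝ × ℝ → ℝ} (hf : Continuous f) :
    Continuous fun w => symC h (f w) := by
  unfold symC
  fun_prop

lemma continuous_symS_comp (h : ℝ) {f : ℝ × ℝ → ℝ} (hf : Continuous f) :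
    Continuous fun w => symS h (f w) := by
  unfold symS
  fun_prop

lemma one_add_implicitSymbol_ne_zero {k : ℝ} (hk : 0 ≤ k) (μx μy ξ η : ℝ) :
    1 + implicitSymbol μx μy k hx hy ξ η ≠ 0 := by
  have h := one_le_norm_one_add (L := implicitSymbol μx μy k hx hy ξ η)
    (by rw [implicitSymbol_re]; positivity)
  intro h0
  rw [h0, norm_zero] at h
  linarith

lemma continuous_schemeMult {k : ℝ} (hk : 0 ≤ k) (r : Corr) (μx μy zx zy : ℝ) :
    Continuous fun w : ℝ × ℝ =>
      schemeMult r μx μy k hx hy (2 * Real.pi * w.1) (2 * Real.pi * w.2) zx zy := by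
  have c1 := continuous_symC_comp hx (f := fun w => 2 * Real.pi * w.1) (by fun_prop)
  have c2 := continuous_symC_comp hy (f := fun w => 2 * Real.pi * w.2) (by fun_prop)
  have c3 := continuous_symS_comp hx (f := fun w => 2 * Real.pi * w.1) (by fun_prop)
  have c4 := continuous_symS_comp hy (f := fun w => 2 * Real.pi * w.2) (by fun_prop)
  unfold schemeMult stepApprox
  refine Continuous.div ?_ ?_ fun w => one_add_implicitSymbol_ne_zero hk _ _ _ _
  · unfold stepNum noiseSymbol
    fun_prop
  · unfold implicitSymbol
    fun_prop

/-- The discrete Fourier transform of the iterates of the scheme. -/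
theorem IsMilsteinScheme.eq_synth {Ω : Type*} [MeasurableSpace Ω] {r : Corr} {μx μy : ℝ} {T : ℝ≥0}
    {W₁ W₂ : ℝ≥0 → Ω → ℝ} {N : ℕ} {V₀ : Grid} {V : ℕ → Ω → Grid}
    (hV : IsMilsteinScheme r μx μy T W₁ W₂ N hx hy V₀ V) (hρx : 0 ≤ r.ρx) (hρy : 0 ≤ r.ρy)
    (hhx : 0 < hx) (hhy : 0 < hy) {φ : ℝ × ℝ → ℂ}
    (hφ : MemLp φ 2 (volume.restrict (shiftBox hx hy 0))) (h0 : V₀ = synth hx hy φ) (ω : Ω)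
    {n : ℕ} (hn : n ≤ N) :
    V n ω = synth hx hy fun w => φ w * ∏ m ∈ Finset.range n,
      schemeMult r μx μy (T / N) hx hy (2 * Real.pi * w.1) (2 * Real.pi * w.2)
        (normIncr T N W₁ m ω) (normIncr T N (noiseY r W₁ W₂) m ω) := by
  have hk : 0 ≤ (T : ℝ) / N := by positivity
  have hcont (n : ℕ) : Continuous fun w : ℝ × ℝ => ∏ m ∈ Finset.range n,
      schemeMult r μx μy (T / N) hx hy (2 * Real.pi * w.1) (2 * Real.pi * w.2)
        (normIncr T N W₁ m ω) (normIncr T N (noiseY r W₁ W₂) m ω) :=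
    continuous_finsetProd _ fun m _ => continuous_schemeMult hk r μx μy _ _
  induction n with
  | zero => simp [hV.init, h0]
  | succ n ih =>
    -- The step equation determines the new iterate only among square summable functions, so both
    -- candidates must be shown to be of that kind.
    refine implicitOp_injOn μx μy hk hx hy (hV.sq_summable _ hn ω)
      (summable_synth_sq hhx hhy (memLp_mul_continuous hφ (hcont _))) ?_
    have hi (n : ℕ) := (memLp_mul_continuous hφ (hcont n)).integrable one_le_two
    rw [hV.step n hn ω, ih (by omega), explicitOp_synth hhx hhy hρx hρy hk _ _ (hi n),
      implicitOp_synth hhx hhy μx μy _ (hi (n + 1))]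
    congr 1
    funext w
    have hne := one_add_implicitSymbol_ne_zero (hx := hx) (hy := hy) hk μx μy
      (2 * Real.pi * w.1) (2 * Real.pi * w.2)
    rw [Finset.prod_range_succ, schemeMult, stepApprox, ← mul_assoc, mul_assoc _ (_ / _),
      div_mul_cancel₀ _ hne]

/-- Orthogonality of the grid waves: the discrete delta has a transform of modulus one on the whole
box. -/
lemma diracData_eq_synth (hhx : 0 < hx) (hhy : 0 < hy) (i₀ j₀ : ℤ) :
    diracData hx hy i₀ j₀ = synth hx hy (wave (-(i₀ * hx)) (-(j₀ * hy))) := by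
  funext i j
  have h : ∀ w, wave (-(i₀ * hx)) (-(j₀ * hy)) w * gridWave hx hy (i, j) w =
      gridWave hx hy (i - i₀, j - j₀) w := fun w => by
    rw [gridWave, gridWave, ← wave_add]
    push_cast
    congr 1 <;> ring
  rw [synth]
  simp only [h]
  rw [shiftBox, setIntegral_gridWave hhx hhy, diracData]
  by_cases h1 : i = i₀ <;> by_cases h2 : j = j₀ <;>
    simp [h1, h2, sub_eq_zero, mul_comm, -ofReal_inv, -ofReal_mul]

/-! ### The solution for Dirac data as a Fourier integral -/

lemma integrable_exp_neg_mul_normSq {c : ℝ} (hc : 0 < c) :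
    Integrable fun w : ℝ × ℝ => Real.exp (-(c * (w.1 ^ 2 + w.2 ^ 2))) := by
  have h := (integrable_exp_neg_mul_sq hc).mul_prod (integrable_exp_neg_mul_sq hc)
  refine h.congr (Filter.Eventually.of_forall fun w => ?_)
  simp only [← Real.exp_add]
  congr 1
  ring

lemma lintegral_exp_neg_mul_normSq_lt_top {c : ℝ} (hc : 0 < c) :
    ∫⁻ w : ℝ × ℝ, ENNReal.ofReal (Real.exp (-(c * (w.1 ^ 2 + w.2 ^ 2)))) < ∞ :=
  (integrable_exp_neg_mul_normSq hc).lintegral_lt_top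

lemma norm_exactMult_le_exp {r : Corr} (hρx : r.ρx < 1) (hρy : r.ρy < 1) :
    ∃ c > 0, ∀ t, 0 ≤ t → ∀ μx μy m₁ m₂ ξ η,
      ‖exactMult r μx μy t m₁ m₂ ξ η‖ ≤ Real.exp (-(c * t * (ξ ^ 2 + η ^ 2))) := by
  refine ⟨min (1 - r.ρx) (1 - r.ρy) / 2, half_pos (lt_min (by linarith) (by linarith)),
    fun t ht μx μy m₁ m₂ ξ η => ?_⟩
  rw [exactMult, norm_exp]
  refine Real.exp_le_exp.mpr ?_
  simp only [sub_re, ofReal_re, mul_re, I_re, I_im, ofReal_im, mul_zero, zero_mul, sub_self,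
    sub_zero]
  have h1 : min (1 - r.ρx) (1 - r.ρy) * (t * ξ ^ 2) ≤ (1 - r.ρx) * (t * ξ ^ 2) := by
    gcongr; exact min_le_left _ _
  have h2 : min (1 - r.ρx) (1 - r.ρy) * (t * η ^ 2) ≤ (1 - r.ρy) * (t * η ^ 2) := by
    gcongr; exact min_le_right _ _
  linarith

/-- The multiplier of the solution operator, in terms of the ordinary frequency. -/
def exactSymbol (r : Corr) (μx μy t m₁ m₂ : ℝ) (w : ℝ × ℝ) : ℂ :=
  exactMult r μx μy t m₁ m₂ (2 * Real.pi * w.1) (2 * Real.pi * w.2)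

lemma continuous_exactSymbol (r : Corr) (μx μy t m₁ m₂ : ℝ) :
    Continuous (exactSymbol r μx μy t m₁ m₂) := by
  unfold exactSymbol exactMult
  fun_prop

lemma exists_norm_exactSymbol_le {r : Corr} (hρx : r.ρx < 1) (hρy : r.ρy < 1) {t : ℝ}
    (ht : 0 < t) : ∃ c > 0, ∀ μx μy m₁ m₂ w,
      ‖exactSymbol r μx μy t m₁ m₂ w‖ ≤ Real.exp (-(c * (w.1 ^ 2 + w.2 ^ 2))) := by
  obtain ⟨c, hc, h⟩ := norm_exactMult_le_exp hρx hρy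
  refine ⟨c * t * (2 * Real.pi) ^ 2, by positivity, fun μx μy m₁ m₂ w => ?_⟩
  refine (h t ht.le ..).trans_eq ?_
  congr 1
  ring

lemma memLp_exactSymbol {r : Corr} (hρx : r.ρx < 1) (hρy : r.ρy < 1) (μx μy : ℝ) {t : ℝ}
    (ht : 0 < t) (m₁ m₂ : ℝ) :
    Integrable (exactSymbol r μx μy t m₁ m₂) ∧ MemLp (exactSymbol r μx μy t m₁ m₂) 2 := by
  obtain ⟨c, hc, h⟩ := exists_norm_exactSymbol_le hρx hρy ht
  have hm := (continuous_exactSymbol r μx μy t m₁ m₂).aestronglyMeasurable (μ := volume)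
  refine ⟨(integrable_exp_neg_mul_normSq hc).mono' hm
    (Filter.Eventually.of_forall fun w => h ..), ?_⟩
  rw [memLp_two_iff_integrable_sq_norm hm]
  refine (integrable_exp_neg_mul_normSq (show 0 < 2 * c by positivity)).mono' (hm.norm.pow 2)
    (Filter.Eventually.of_forall fun w => ?_)
  rw [Real.norm_of_nonneg (by positivity)]
  calc _ ≤ Real.exp (-(c * (w.1 ^ 2 + w.2 ^ 2))) ^ 2 := by gcongr; exact h ..
    _ = _ := by rw [← Real.exp_nat_mul]; congr 1; push_cast; ring

lemma integral_gaussian_wave {s : ℝ} (hs : 0 < s) (u : ℝ) :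
    ∫ x : ℝ, cexp (((-(s * (2 * Real.pi * x) ^ 2 / 2) : ℝ) : ℂ) + ((2 * Real.pi * x * u : ℝ) : ℂ) * I) =
      ((Real.exp (-(u ^ 2 / (2 * s))) / √(2 * Real.pi * s) : ℝ) : ℂ) := by
  have hre : (((-(2 * Real.pi ^ 2 * s) : ℝ) : ℂ)).re < 0 := by
    rw [ofReal_re, neg_lt_zero]
    positivity
  have h := integral_cexp_quadratic hre (2 * Real.pi * u * I) 0
  rw [show (fun x : ℝ => cexp (((-(s * (2 * Real.pi * x) ^ 2 / 2) : ℝ) : ℂ)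
      + ((2 * Real.pi * x * u : ℝ) : ℂ) * I)) = fun x : ℝ =>
      cexp (((-(2 * Real.pi ^ 2 * s) : ℝ) : ℂ) * (x : ℂ) ^ 2 + 2 * Real.pi * u * I * x + 0) from by
    funext x
    congr 1
    push_cast
    ring, h]
  have hs' : (s : ℂ) ≠ 0 := by exact_mod_cast hs.ne'
  have hpi : (Real.pi : ℂ) ≠ 0 := by exact_mod_cast Real.pi_ne_zero
  have e1 : (Real.pi / -((-(2 * Real.pi ^ 2 * s) : ℝ) : ℂ)) =
      (((2 * Real.pi * s)⁻¹ : ℝ) : ℂ) := by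
    push_cast
    field_simp
  have e2 : 0 - (2 * Real.pi * u * I) ^ 2 / (4 * ((-(2 * Real.pi ^ 2 * s) : ℝ) : ℂ)) =
      ((-(u ^ 2 / (2 * s)) : ℝ) : ℂ) := by
    push_cast
    field_simp
    rw [I_sq]
    ring
  rw [e1, e2, ← ofReal_exp, show (1 / 2 : ℂ) = ((1 / 2 : ℝ) : ℂ) by push_cast; rfl,
    ← ofReal_cpow (by positivity), ← Real.sqrt_eq_rpow, Real.sqrt_inv, ← ofReal_mul]
  congr 1
  field_simp

/-- The exponent separates in the two frequency variables, so the integral is a product of two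
one-dimensional Gaussian Fourier integrals, with drift and noise as translations. -/
lemma integral_exactSymbol_mul_wave {r : Corr} (hρx : r.ρx < 1) (hρy : r.ρy < 1) (μx μy : ℝ)
    {t : ℝ} (ht : 0 < t) (m₁ m₂ x₀ y₀ x y : ℝ) :
    ∫ w, exactSymbol r μx μy t m₁ m₂ w * wave (x - x₀) (y - y₀) w =
      (diracSolution r μx μy t m₁ m₂ x₀ y₀ x y : ℂ) := by
  have hs1 : 0 < (1 - r.ρx) * t := mul_pos (by linarith) ht
  have hs2 : 0 < (1 - r.ρy) * t := mul_pos (by linarith) ht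
  have h := integral_prod_mul (μ := volume) (ν := volume)
    (fun a : ℝ => cexp (((-((1 - r.ρx) * t * (2 * Real.pi * a) ^ 2 / 2) : ℝ) : ℂ)
      + ((2 * Real.pi * a * (x - x₀ - μx * t - √r.ρx * m₁) : ℝ) : ℂ) * I))
    (fun a : ℝ => cexp (((-((1 - r.ρy) * t * (2 * Real.pi * a) ^ 2 / 2) : ℝ) : ℂ)
      + ((2 * Real.pi * a * (y - y₀ - μy * t - √r.ρy * m₂) : ℝ) : ℂ) * I))
  rw [integral_gaussian_wave hs1, integral_gaussian_wave hs2, ← Measure.volume_eq_prod] at h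
  refine Eq.trans ?_ (h.trans ?_)
  · congr 1
    funext w
    rw [exactSymbol, exactMult, wave, ← Complex.exp_add, ← Complex.exp_add]
    congr 1
    push_cast
    ring
  · rw [← ofReal_mul, diracSolution]
    congr 1
    have hd : √(2 * Real.pi * ((1 - r.ρx) * t)) * √(2 * Real.pi * ((1 - r.ρy) * t)) =
        2 * Real.pi * √((1 - r.ρx) * (1 - r.ρy)) * t := by
      rw [← Real.sqrt_mul (by positivity), show 2 * Real.pi * ((1 - r.ρx) * t) *
        (2 * Real.pi * ((1 - r.ρy) * t)) = (2 * Real.pi * t) ^ 2 * ((1 - r.ρx) * (1 - r.ρy)) by ring,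
        Real.sqrt_mul (by positivity), Real.sqrt_sq (by positivity)]
      ring
    rw [div_mul_div_comm, hd, ← Real.exp_add]
    congr 2
    rw [mul_assoc 2, mul_assoc 2]
    ring

/-- The solution for a Dirac datum is a Fourier integral. -/
lemma diracSolution_eq_re {r : Corr} (hρx : r.ρx < 1) (hρy : r.ρy < 1) (μx μy : ℝ)
    {t : ℝ} (ht : 0 < t) (m₁ m₂ x₀ y₀ x y : ℝ) :
    diracSolution r μx μy t m₁ m₂ x₀ y₀ x y =
      (∫ w, wave (-x₀) (-y₀) w * exactSymbol r μx μy t m₁ m₂ w * wave x y w).re := by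
  rw [← ofReal_re (diracSolution r μx μy t m₁ m₂ x₀ y₀ x y),
    ← integral_exactSymbol_mul_wave hρx hρy μx μy ht]
  congr 2
  funext w
  rw [sub_eq_add_neg, sub_eq_add_neg, wave_add]
  ring

/-! ### The solution for square integrable data as a Fourier integral -/

section Plancherel

open scoped FourierTransform SchwartzMap
open RealInnerProductSpace

variable {E : Type*} [NormedAddCommGroup E] [InnerProductSpace ℝ E] [FiniteDimensional ℝ E]
  [MeasurableSpace E] [BorelSpace E]

lemma continuous_integral_Lp_mul {α : Type*} [MeasurableSpace α] {μ : Measure α} {k : α → ℂ}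
    (hk : MemLp k 2 μ) : Continuous fun f : Lp ℂ 2 μ => ∫ x, f x * k x ∂μ := by
  have hk' : MemLp (fun x => conj (k x)) 2 μ := hk.star
  have : (fun f : Lp ℂ 2 μ => ∫ x, f x * k x ∂μ) = fun f => inner ℂ (hk'.toLp _) f := by
    funext f
    rw [L2.inner_def]
    refine integral_congr_ae ?_
    filter_upwards [hk'.coeFn_toLp] with x hx
    rw [hx, RCLike.inner_apply, conj_conj]
  rw [this]
  fun_prop

/-- The Fourier-Plancherel transform is its own transpose. -/
lemma integral_Lp_mul_fourier (f : Lp (α := E) ℂ 2 volume) {k : E → ℂ} (hk1 : Integrable k)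
    (hk2 : MemLp k 2) (hk3 : MemLp (𝓕 k) 2) :
    ∫ z, f z * 𝓕 k z = ∫ w, (𝓕 f : Lp (α := E) ℂ 2 volume) w * k w := by
  -- Both sides are continuous in `f` for the `L²` norm. On the dense set of Schwartz functions the
  -- identity is the usual self-transposition of the Fourier integral.
  refine DenseRange.induction_on (p := fun f : Lp (α := E) ℂ 2 volume =>
    ∫ z, f z * 𝓕 k z = ∫ w, (𝓕 f : Lp (α := E) ℂ 2 volume) w * k w)
    (SchwartzMap.denseRange_toLpCLM (F := ℂ) (E := E) (p := 2) ENNReal.ofNat_ne_top) f ?_ ?_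
  · refine isClosed_eq (continuous_integral_Lp_mul hk3) ?_
    exact (continuous_integral_Lp_mul hk2).comp (Lp.fourierTransformₗᵢ E ℂ).continuous
  · intro g
    have h1 : ∫ z, (SchwartzMap.toLpCLM ℝ ℂ 2 volume g : Lp (α := E) ℂ 2 volume) z * 𝓕 k z =
        ∫ z, g z * 𝓕 k z := by
      refine integral_congr_ae ?_
      filter_upwards [g.coeFn_toLp 2 volume] with z hz
      rw [SchwartzMap.toLpCLM_apply, hz]
    have h2 : ∫ w, (𝓕 (SchwartzMap.toLpCLM ℝ ℂ 2 volume g : Lp (α := E) ℂ 2 volume) :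
        Lp (α := E) ℂ 2 volume) w * k w = ∫ w, (𝓕 g : 𝓢(E, ℂ)) w * k w := by
      refine integral_congr_ae ?_
      rw [SchwartzMap.toLpCLM_apply, SchwartzMap.toLp_fourier_eq]
      filter_upwards [(𝓕 g : 𝓢(E, ℂ)).coeFn_toLp 2 volume] with z hz
      rw [hz]
    rw [h1, h2]
    have := VectorFourier.integral_fourierIntegral_smul_eq_flip (L := innerₗ E)
      Real.continuous_fourierChar continuous_inner (g.integrable (μ := volume)) hk1
    rw [flip_innerₗ] at this
    exact this.symm

end Plancherel

/-! ### Transfer of the Plancherel transform to `ℝ × ℝ`. -/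

/-- The Euclidean plane as a product. -/
def planeEquiv : EuclideanSpace ℝ (Fin 2) ≃ᵐ ℝ × ℝ :=
  (MeasurableEquiv.toLp 2 (Fin 2 → ℝ)).symm.trans MeasurableEquiv.finTwoArrow

lemma planeEquiv_apply (z : EuclideanSpace ℝ (Fin 2)) : planeEquiv z = (z 0, z 1) := rfl

lemma measurePreserving_planeEquiv : MeasurePreserving planeEquiv :=
  (volume_preserving_finTwoArrow ℝ).comp
    (EuclideanSpace.volume_preserving_symm_measurableEquiv_toLp (Fin 2))

lemma integral_comp_planeEquiv (f : ℝ × ℝ → ℂ) :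
    ∫ z, f (planeEquiv z) = ∫ w, f w :=
  measurePreserving_planeEquiv.integral_comp planeEquiv.measurableEmbedding f

section L2Data

open scoped FourierTransform

variable {v₀ : EuclideanSpace ℝ (Fin 2) → ℝ} (hv₀ : MemLp v₀ 2 volume)

/-- The Fourier-Plancherel transform of a square integrable datum, as a function on `ℝ × ℝ`. -/
def plancherelData (w : ℝ × ℝ) : ℂ :=
  (𝓕 ((hv₀.ofReal (K := ℂ)).toLp (fun z => (v₀ z : ℂ))) :
      Lp (α := EuclideanSpace ℝ (Fin 2)) ℂ 2 volume) (planeEquiv.symm w)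

lemma memLp_plancherelData : MemLp (plancherelData hv₀) 2 := by
  have h := (measurePreserving_planeEquiv.symm planeEquiv)
  exact (Lp.memLp _).comp_measurePreserving h

lemma l2Data_eq_synth {hx hy : ℝ} (hhx : 0 < hx) (hhy : 0 < hy) :
    l2Data hx hy v₀ hv₀ = synth hx hy (plancherelData hv₀) := by
  funext i j
  rw [l2Data, synth]
  congr 1
  set f : ℝ × ℝ → ℂ := fun w => plancherelData hv₀ w * gridWave hx hy (i, j) w with hf
  -- The closed box of the datum and the half-open box used for synthesis differ by a null set.
  have hbox : (Set.Icc (-(1 / (2 * hx))) (1 / (2 * hx)) ×ˢ Set.Icc (-(1 / (2 * hy))) (1 / (2 * hy)) :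
      Set (ℝ × ℝ)) =ᵐ[volume] shiftBox hx hy 0 := by
    have e1 : -(1 / (2 * hx)) + 1 / hx = 1 / (2 * hx) := by field_simp; ring
    have e2 : -(1 / (2 * hy)) + 1 / hy = 1 / (2 * hy) := by field_simp; ring
    simp only [shiftBox, freqBox, Prod.fst_zero, Prod.snd_zero, Int.cast_zero, zero_mul, add_zero,
      e1, e2]
    exact Measure.set_prod_ae_eq Ioc_ae_eq_Icc.symm Ioc_ae_eq_Icc.symm
  rw [← setIntegral_congr_set hbox, ← measurePreserving_planeEquiv.setIntegral_preimage_emb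
    planeEquiv.measurableEmbedding f]
  have hset : {w : EuclideanSpace ℝ (Fin 2) | |w 0| ≤ 1 / (2 * hx) ∧ |w 1| ≤ 1 / (2 * hy)} =
      planeEquiv ⁻¹' (Set.Icc (-(1 / (2 * hx))) (1 / (2 * hx)) ×ˢ
        Set.Icc (-(1 / (2 * hy))) (1 / (2 * hy))) := by
    ext w
    simp only [Set.mem_ofPred_eq, Set.mem_preimage, planeEquiv_apply, Set.mem_prod, Set.mem_Icc,
      abs_le]
  rw [hset]
  congr 1
  funext w
  rw [hf]
  simp only [plancherelData, MeasurableEquiv.symm_apply_apply]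
  simp only [gridWave, wave, planeEquiv_apply]
  congr 2
  push_cast
  ring

lemma memLp_comp_planeEquiv {f : ℝ × ℝ → ℂ} {p : ℝ≥0∞} (hf : MemLp f p) :
    MemLp (fun z => f (planeEquiv z)) p :=
  hf.comp_measurePreserving measurePreserving_planeEquiv

lemma fourier_comp_planeEquiv (f : ℝ × ℝ → ℂ) (z : EuclideanSpace ℝ (Fin 2)) :
    𝓕 (fun w => f (planeEquiv w)) z = ∫ w, f w * wave (-(z 0)) (-(z 1)) w := by
  rw [Real.fourier_eq', ← integral_comp_planeEquiv]
  congr 1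
  funext w
  rw [smul_eq_mul, mul_comm, wave, planeEquiv_apply]
  congr 3
  simp [EuclideanSpace.inner_eq_star_dotProduct, dotProduct, Fin.sum_univ_two]
  ring

lemma memLp_diracSolution {r : Corr} (hρx : r.ρx < 1) (hρy : r.ρy < 1) (μx μy : ℝ)
    {t : ℝ} (ht : 0 < t) (m₁ m₂ x y : ℝ) :
    MemLp (fun z : ℝ × ℝ => (diracSolution r μx μy t m₁ m₂ z.1 z.2 x y : ℂ)) 2 := by
  have hs1 : 0 < 1 / ((1 - r.ρx) * t) := one_div_pos.mpr (mul_pos (by linarith) ht)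
  have hs2 : 0 < 1 / ((1 - r.ρy) * t) := one_div_pos.mpr (mul_pos (by linarith) ht)
  have hc : Continuous fun z : ℝ × ℝ => (diracSolution r μx μy t m₁ m₂ z.1 z.2 x y : ℂ) := by
    unfold diracSolution
    fun_prop
  rw [memLp_two_iff_integrable_sq_norm hc.aestronglyMeasurable]
  have h := ((integrable_exp_neg_mul_sq hs1).comp_sub_left (x - μx * t - √r.ρx * m₁)).mul_prod
    ((integrable_exp_neg_mul_sq hs2).comp_sub_left (y - μy * t - √r.ρy * m₂))
  refine (h.const_mul ((2 * Real.pi * √((1 - r.ρx) * (1 - r.ρy)) * t)⁻¹ ^ 2)).congr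
    (Filter.Eventually.of_forall fun z => ?_)
  have h1 : (1 - r.ρx) * t ≠ 0 := (mul_pos (by linarith) ht).ne'
  have h2 : (1 - r.ρy) * t ≠ 0 := (mul_pos (by linarith) ht).ne'
  simp only [norm_real, Real.norm_eq_abs, sq_abs, diracSolution, div_eq_mul_inv _ (_ * t), mul_pow]
  rw [← Real.exp_add, ← Real.exp_nat_mul, mul_comm]
  congr 2
  push_cast
  rw [mul_assoc 2, mul_assoc 2]
  field_simp
  ring

/-- The solution for a square integrable datum is a Fourier integral. -/
lemma l2Solution_eq_re {r : Corr} (hρx : r.ρx < 1) (hρy : r.ρy < 1) (μx μy : ℝ)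
    {t : ℝ} (ht : 0 < t) (m₁ m₂ x y : ℝ) :
    l2Solution r μx μy t m₁ m₂ v₀ x y =
      (∫ w, plancherelData hv₀ w * exactSymbol r μx μy t m₁ m₂ w * wave x y w).re := by
  obtain ⟨hk1, hk2⟩ := memLp_exactSymbol hρx hρy μx μy ht m₁ m₂
  have hb : ∀ᵐ w ∂(volume : Measure (ℝ × ℝ)), ‖wave x y w‖ ≤ 1 :=
    Filter.Eventually.of_forall fun w => (norm_wave x y w).le
  have hwm := (continuous_wave x y).aestronglyMeasurable (μ := volume)
  set k : ℝ × ℝ → ℂ := fun w => exactSymbol r μx μy t m₁ m₂ w * wave x y w with hk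
  have hK1 : MemLp k 1 :=
    MemLp.mul (p := 1) (q := ∞) (memLp_top_of_bound hwm 1 hb) (memLp_one_iff_integrable.mpr hk1)
  have hK2 : MemLp k 2 := MemLp.mul (p := 2) (q := ∞) (memLp_top_of_bound hwm 1 hb) hk2
  -- As a function of the initial point, the fundamental solution is the Fourier transform of `k`.
  -- Superposition against `v₀` therefore becomes integration of `k` against the transform of `v₀`.
  have hF : 𝓕 (fun z => k (planeEquiv z)) =
      fun z => (diracSolution r μx μy t m₁ m₂ (planeEquiv z).1 (planeEquiv z).2 x y : ℂ) := by
    funext z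
    rw [fourier_comp_planeEquiv, ← integral_exactSymbol_mul_wave hρx hρy μx μy ht]
    congr 1
    funext w
    rw [hk, sub_eq_add_neg, sub_eq_add_neg, wave_add, planeEquiv_apply]
    ring
  have key := integral_Lp_mul_fourier ((hv₀.ofReal (K := ℂ)).toLp (fun z => (v₀ z : ℂ)))
    (memLp_one_iff_integrable.mp (memLp_comp_planeEquiv hK1)) (memLp_comp_planeEquiv hK2)
    (hF ▸ memLp_comp_planeEquiv (memLp_diracSolution hρx hρy μx μy ht m₁ m₂ x y))
  rw [hF] at key
  have h1 : (l2Solution r μx μy t m₁ m₂ v₀ x y : ℂ) =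
      ∫ z, ((hv₀.ofReal (K := ℂ)).toLp (fun z => (v₀ z : ℂ))) z *
        (diracSolution r μx μy t m₁ m₂ (planeEquiv z).1 (planeEquiv z).2 x y : ℂ) := by
    rw [l2Solution, ← integral_complex_ofReal]
    refine integral_congr_ae ?_
    filter_upwards [(hv₀.ofReal (K := ℂ)).coeFn_toLp] with z hz
    rw [ofReal_mul]
    exact congrArg₂ (· * ·) hz.symm rfl
  rw [← ofReal_re (l2Solution r μx μy t m₁ m₂ v₀ x y), h1, key, ← integral_comp_planeEquiv]
  congr 2
  funext w
  simp only [plancherelData, MeasurableEquiv.symm_apply_apply, hk]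
  ring

end L2Data

/-! ### The error of the scheme for data with given Fourier transform -/

/-- No measurability is assumed: the lower integral is superadditive on finite sums. This suffices
to bring the sum over the grid under the expectation without proving the iterates or the solution
measurable in `ω`. -/
lemma tsum_lintegral_le {α ι : Type*} [MeasurableSpace α] (μ : Measure α) (f : ι → α → ℝ≥0∞) :
    ∑' i, ∫⁻ a, f i a ∂μ ≤ ∫⁻ a, ∑' i, f i a ∂μ := by
  refine ENNReal.summable.tsum_le_of_sum_le fun s => ?_
  have h : ∑ i ∈ s, ∫⁻ a, f i a ∂μ ≤ ∫⁻ a, ∑ i ∈ s, f i a ∂μ := by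
    classical
    induction s using Finset.induction_on with
    | empty => simp
    | insert i s hi ih =>
      simp only [Finset.sum_insert hi]
      exact (add_le_add_right ih _).trans (le_lintegral_add _ _)
  exact h.trans (lintegral_mono fun a => ENNReal.sum_le_tsum s)

lemma abs_mul_le_pi_of_mem_shiftBox {hx hy : ℝ} (hhx : 0 < hx) (hhy : 0 < hy) {w : ℝ × ℝ}
    (hw : w ∈ shiftBox hx hy 0) :
    |2 * Real.pi * w.1| * hx ≤ Real.pi ∧ |2 * Real.pi * w.2| * hy ≤ Real.pi := by
  have key {h x : ℝ} (hh : 0 < h)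
      (hx : x ∈ Set.Ioc (-(1 / (2 * h)) + ((0 : ℤ) : ℝ) * (1 / h))
        (-(1 / (2 * h)) + ((0 : ℤ) : ℝ) * (1 / h) + 1 / h)) :
      |2 * Real.pi * x| * h ≤ Real.pi := by
    have e : -(1 / (2 * h)) + 1 / h = 1 / (2 * h) := by field_simp; ring
    simp only [Int.cast_zero, zero_mul, add_zero, e] at hx
    have h1 : |x| ≤ 1 / (2 * h) := abs_le.mpr ⟨hx.1.le, hx.2⟩
    rw [abs_mul, abs_of_pos Real.two_pi_pos]
    calc 2 * Real.pi * |x| * h ≤ 2 * Real.pi * (1 / (2 * h)) * h := by gcongr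
      _ = Real.pi := by field_simp
  exact ⟨key hhx hw.1, key hhy hw.2⟩

section Joint

variable {Ω : Type*} [MeasurableSpace Ω] {P : Measure Ω}

lemma continuous_mult_diff (r : Corr) (μx μy : ℝ) {T : ℝ} (hT : 0 ≤ T) (hx hy : ℝ) (N : ℕ) :
    Continuous fun q : (ℝ × ℝ) × (Fin N → ℝ) × (Fin N → ℝ) × ℝ × ℝ =>
      ∏ i, schemeMult r μx μy (T / N) hx hy (2 * Real.pi * q.1.1) (2 * Real.pi * q.1.2)
          (q.2.1 i) (q.2.2.1 i) -
        exactSymbol r μx μy T q.2.2.2.1 q.2.2.2.2 q.1 := by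
  have hk : 0 ≤ T / N := by positivity
  refine Continuous.sub (continuous_finsetProd _ fun i _ => ?_) ?_
  · unfold schemeMult stepApprox
    refine Continuous.div ?_ ?_ fun w => one_add_implicitSymbol_ne_zero hk _ _ _ _
    · unfold stepNum noiseSymbol symC
      fun_prop
    · unfold implicitSymbol symC symS
      fun_prop
  · unfold exactSymbol exactMult
    fun_prop

lemma IsGaussianNoise.aemeasurable_mult_diff {ρ T : ℝ} {N : ℕ} {zx zy : Fin N → Ω → ℝ}
    {mx my : Ω → ℝ} (h : IsGaussianNoise ρ T zx zy mx my P) (hT : 0 ≤ T) (r : Corr)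
    (μx μy hx hy : ℝ) {μ : Measure (ℝ × ℝ)} [SFinite μ] :
    AEMeasurable (fun p : Ω × ℝ × ℝ =>
      ∏ i, schemeMult r μx μy (T / N) hx hy (2 * Real.pi * p.2.1) (2 * Real.pi * p.2.2)
          (zx i p.1) (zy i p.1) -
        exactSymbol r μx μy T (mx p.1) (my p.1) p.2) (P.prod μ) := by
  have h1 : AEMeasurable (fun ω i => zx i ω) P := by
    have := (h.law 1 0).aemeasurable
    simpa using this
  have h2 : AEMeasurable (fun ω i => zy i ω) P := by
    have := (h.law 0 1).aemeasurable
    simpa using this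
  have hq : AEMeasurable (fun p : Ω × ℝ × ℝ => (p.2, (fun i => zx i p.1), (fun i => zy i p.1),
      mx p.1, my p.1)) (P.prod μ) :=
    measurable_snd.aemeasurable.prodMk (AEMeasurable.comp_fst (f := fun ω =>
      ((fun i => zx i ω), (fun i => zy i ω), mx ω, my ω))
      (h1.prodMk (h2.prodMk (h.aemeasurable_x.prodMk h.aemeasurable_y))))
  have hF := (continuous_mult_diff r μx μy hT hx hy N).measurable
  have := hF.comp_aemeasurable hq
  exact this

end Joint

lemma le_sq_add_one (x : ℝ≥0∞) : x ≤ x ^ 2 + 1 := by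
  rcases le_total x 1 with h | h
  · exact h.trans le_add_self
  · exact (le_self_pow₀ h two_ne_zero).trans le_self_add

section Datum

variable {φ : ℝ × ℝ → ℂ}

lemma enorm_sq_mul_exactSymbol_le {r : Corr} {μx μy t m₁ m₂ c : ℝ}
    (hK : ∀ w, ‖exactSymbol r μx μy t m₁ m₂ w‖ ≤ Real.exp (-(c * (w.1 ^ 2 + w.2 ^ 2))))
    (w : ℝ × ℝ) : ‖φ w * exactSymbol r μx μy t m₁ m₂ w‖ₑ ^ 2 ≤
      ‖φ w‖ₑ ^ 2 * ENNReal.ofReal (Real.exp (-(c * (w.1 ^ 2 + w.2 ^ 2)))) *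
        ENNReal.ofReal (Real.exp (-(c * (w.1 ^ 2 + w.2 ^ 2)))) := by
  rw [enorm_mul, mul_pow, mul_assoc, sq ‖exactSymbol r μx μy t m₁ m₂ w‖ₑ]
  have : ‖exactSymbol r μx μy t m₁ m₂ w‖ₑ ≤
      ENNReal.ofReal (Real.exp (-(c * (w.1 ^ 2 + w.2 ^ 2)))) := by
    rw [← ofReal_norm]
    exact ENNReal.ofReal_le_ofReal (hK w)
  gcongr

lemma integrable_mul_exactSymbol (hφm : AEStronglyMeasurable φ)
    {r : Corr} {μx μy t m₁ m₂ c : ℝ} (hc : 0 < c)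
    (hK : ∀ w, ‖exactSymbol r μx μy t m₁ m₂ w‖ ≤ Real.exp (-(c * (w.1 ^ 2 + w.2 ^ 2))))
    (hφ : ∫⁻ w, ‖φ w‖ₑ ^ 2 * ENNReal.ofReal (Real.exp (-(c * (w.1 ^ 2 + w.2 ^ 2)))) < ∞) :
    Integrable fun w => φ w * exactSymbol r μx μy t m₁ m₂ w := by
  refine ⟨hφm.mul (continuous_exactSymbol r μx μy t m₁ m₂).aestronglyMeasurable, ?_⟩
  rw [hasFiniteIntegral_iff_enorm]
  have hm : Measurable fun w : ℝ × ℝ =>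
      ENNReal.ofReal (Real.exp (-(c * (w.1 ^ 2 + w.2 ^ 2)))) := by fun_prop
  calc ∫⁻ w, ‖φ w * exactSymbol r μx μy t m₁ m₂ w‖ₑ
      ≤ ∫⁻ w, (‖φ w‖ₑ ^ 2 * ENNReal.ofReal (Real.exp (-(c * (w.1 ^ 2 + w.2 ^ 2)))) +
        ENNReal.ofReal (Real.exp (-(c * (w.1 ^ 2 + w.2 ^ 2))))) := by
        refine lintegral_mono fun w => ?_
        rw [enorm_mul, ← add_one_mul]
        gcongr
        · exact le_sq_add_one _
        · rw [← ofReal_norm]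
          exact ENNReal.ofReal_le_ofReal (hK w)
    _ = _ + _ := lintegral_add_right _ hm
    _ < ∞ := ENNReal.add_lt_top.mpr ⟨hφ, lintegral_exp_neg_mul_normSq_lt_top hc⟩

/-- The error of the scheme at a grid point splits into the error at the resolved frequencies and
the contribution of the unresolved ones. -/
lemma ofReal_sq_synth_sub_le {hx hy : ℝ} {A K : ℝ × ℝ → ℂ}
    (hA : Integrable A (volume.restrict (shiftBox hx hy 0))) (hK : Integrable K) (p : ℤ × ℤ) :
    ENNReal.ofReal (|synth hx hy A p.1 p.2 - (∫ w, K w * wave (p.1 * hx) (p.2 * hy) w).re| ^ 2) ≤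
      2 * ‖∫ w in shiftBox hx hy 0, (A w - K w) * gridWave hx hy p w‖ₑ ^ 2 +
      2 * ‖∫ w in (shiftBox hx hy 0)ᶜ, K w * gridWave hx hy p w‖ₑ ^ 2 := by
  have hKw : Integrable fun w => K w * gridWave hx hy p w := by
    refine hK.mul_bdd (c := 1) ?_ (Filter.Eventually.of_forall fun w => (norm_wave _ _ _).le)
    unfold gridWave
    exact (continuous_wave _ _).aestronglyMeasurable
  have h1 := integral_add_compl (measurableSet_shiftBox hx hy 0) hKw
  have h2 : ∫ w in shiftBox hx hy 0, (A w - K w) * gridWave hx hy p w =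
      (∫ w in shiftBox hx hy 0, A w * gridWave hx hy p w) -
        ∫ w in shiftBox hx hy 0, K w * gridWave hx hy p w := by
    rw [← integral_sub (integrable_mul_gridWave hA p) hKw.integrableOn]
    congr 1
    funext w
    ring
  set a := ∫ w in shiftBox hx hy 0, A w * gridWave hx hy p w
  set b := ∫ w in shiftBox hx hy 0, K w * gridWave hx hy p w
  set d := ∫ w in (shiftBox hx hy 0)ᶜ, K w * gridWave hx hy p w
  have h3 : synth hx hy A p.1 p.2 - (∫ w, K w * wave (p.1 * hx) (p.2 * hy) w).re =
      (a - (b + d)).re := by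
    rw [h1, sub_re]
    rfl
  have h4 : |(a - (b + d)).re| ^ 2 ≤ 2 * ‖a - b‖ ^ 2 + 2 * ‖d‖ ^ 2 := by
    have := normSq_sub_le a b (b + d)
    rw [sub_add_cancel_left, norm_neg] at this
    refine le_trans ?_ this
    gcongr
    exact abs_re_le_norm _
  rw [h3, h2]
  refine (ENNReal.ofReal_le_ofReal h4).trans_eq ?_
  rw [ENNReal.ofReal_add (by positivity) (by positivity), ENNReal.ofReal_mul (by norm_num),
    ENNReal.ofReal_mul (by norm_num), ENNReal.ofReal_pow (norm_nonneg _),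
    ENNReal.ofReal_pow (norm_nonneg _), ofReal_norm, ofReal_norm]
  simp

/-- The error of the scheme for a datum with Fourier transform `φ`. -/
theorem Corr.StableWith.exists_l2Error_sq_le {r : Corr} {κ : ℝ} (hr : r.StableWith κ)
    (μx μy : ℝ) {T : ℝ≥0} (hT : 0 < T) (hφm : AEStronglyMeasurable φ)
    (hφ : ∀ c > 0, ∫⁻ w, ‖φ w‖ₑ ^ 2 * ENNReal.ofReal (Real.exp (-(c * (w.1 ^ 2 + w.2 ^ 2)))) < ∞)
    (hφ2 : ∀ hx hy, 0 < hx → 0 < hy → MemLp φ 2 (volume.restrict (shiftBox hx hy 0))) :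
    ∃ C > 0, ∀ (Ω : Type*) [MeasurableSpace Ω] (P : Measure Ω) [IsProbabilityMeasure P]
      (W₁ W₂ : ℝ≥0 → Ω → ℝ), IsBrownianPair W₁ W₂ P →
    ∀ (N : ℕ) (hx hy : ℝ), 1 ≤ N → 0 < hx → 0 < hy → ∀ (V₀ : Grid) (V : ℕ → Ω → Grid),
      V₀ = synth hx hy φ → IsMilsteinScheme r μx μy T W₁ W₂ N hx hy V₀ V →
    ∀ u : Ω → ℝ → ℝ → ℝ, (∀ ω x y, u ω x y =
      (∫ w, φ w * exactSymbol r μx μy T (W₁ T ω) (noiseY r W₁ W₂ T ω) w * wave x y w).re) →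
    l2Error P hx hy (V N) u ^ 2 ≤ ENNReal.ofReal (C * (hx ^ 2 + hy ^ 2 + T / N) ^ 2) +
      ENNReal.ofReal (4 * ((1 + 3 * κ) / 4) ^ N) * ∫⁻ w in shiftBox hx hy 0, ‖φ w‖ₑ ^ 2 := by
  have hT' : (0 : ℝ) < T := hT
  have hκ0 : 0 < 1 - κ := by linarith [hr.lt_one]
  have hκ1 := hr.nonneg
  obtain ⟨C₀, hC₀, hmult⟩ := hr.exists_mult_error μx μy hT'
  obtain ⟨c, hc, hK⟩ := exists_norm_exactSymbol_le (hr.ρx_le.trans_lt hr.lt_one)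
    (hr.ρy_le.trans_lt hr.lt_one) hT'
  obtain ⟨C₁, hC₁, halias⟩ := exists_alias_le hc
  -- The factor `(2π)²` converts from the angular frequency of the multiplier estimate to the
  -- ordinary frequency `w`.
  set c' := (1 - κ) * T / 20 * (2 * Real.pi) ^ 2 with hc'
  have hc'0 : 0 < c' := by positivity
  set G := ∫⁻ w, ‖φ w‖ₑ ^ 2 * ENNReal.ofReal (Real.exp (-(c * (w.1 ^ 2 + w.2 ^ 2)))) with hG
  set G' := ∫⁻ w, ‖φ w‖ₑ ^ 2 * ENNReal.ofReal (Real.exp (-(c' * (w.1 ^ 2 + w.2 ^ 2)))) with hG'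
  have hGt : G ≠ ∞ := (hφ c hc).ne
  have hG't : G' ≠ ∞ := (hφ c' hc'0).ne
  -- The multiplier error and the aliasing error, each doubled by splitting the square; the `1` only
  -- ensures positivity.
  refine ⟨2 * C₀ * G'.toReal + 2 * C₁ ^ 2 * G.toReal + 1, by positivity, ?_⟩
  intro Ω _ P _ W₁ W₂ hW N hx hy hN hhx hhy V₀ V hV₀ hV u hu
  have hnoise := hW.isGaussianNoise hr.abs_le_one hT hN
  set B := ∫⁻ w in shiftBox hx hy 0, ‖φ w‖ₑ ^ 2 with hB
  set E := hx ^ 2 + hy ^ 2 + (T : ℝ) / N with hE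
  have hE0 : 0 < E := by positivity
  set S : Ω → ℝ × ℝ → ℂ := fun ω w => ∏ i : Fin N,
    schemeMult r μx μy (T / N) hx hy (2 * Real.pi * w.1) (2 * Real.pi * w.2)
      (normIncr T N W₁ i ω) (normIncr T N (noiseY r W₁ W₂) i ω) with hS
  set K : Ω → ℝ × ℝ → ℂ := fun ω => exactSymbol r μx μy T (W₁ T ω) (noiseY r W₁ W₂ T ω) with hKdef
  have hScont (ω : Ω) : Continuous (S ω) :=
    continuous_finsetProd _ fun i _ => continuous_schemeMult (by positivity) r μx μy _ _
  have hSi (ω : Ω) : Integrable (fun w => φ w * S ω w) (volume.restrict (shiftBox hx hy 0)) :=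
    (memLp_mul_continuous (hφ2 hx hy hhx hhy) (hScont ω)).integrable one_le_two
  have hKi (ω : Ω) : Integrable fun w => φ w * K ω w :=
    integrable_mul_exactSymbol hφm hc (fun w => hK ..) (hφ c hc)
  have hVN (ω : Ω) : V N ω = synth hx hy fun w => φ w * S ω w := by
    rw [hV.eq_synth hr.ρx_nonneg hr.ρy_nonneg hhx hhy (hφ2 hx hy hhx hhy) hV₀ ω le_rfl]
    simp only [hS, Finset.prod_range]
  -- For each fixed path, Bessel on the central box controls the resolved frequencies, and the
  -- aliasing estimate controls the rest with constants independent of the path.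
  have hpt (ω : Ω) : ∑' p : ℤ × ℤ,
      ENNReal.ofReal (|V N ω p.1 p.2 - u ω (p.1 * hx) (p.2 * hy)| ^ 2) * ENNReal.ofReal (hx * hy) ≤
      2 * (∫⁻ w in shiftBox hx hy 0, ‖φ w‖ₑ ^ 2 * ‖S ω w - K ω w‖ₑ ^ 2) +
        2 * (ENNReal.ofReal (C₁ * (hx ^ 2 + hy ^ 2)) ^ 2 * G) := by
    have b1 := tsum_enorm_setIntegral_gridWave_le hhx hhy
      (-(1 / (2 * hx)) + ((0 : ℤ × ℤ).1 : ℝ) * (1 / hx))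
      (-(1 / (2 * hy)) + ((0 : ℤ × ℤ).2 : ℝ) * (1 / hy))
      ((hSi ω).1.sub (hKi ω).1.restrict)
    have b2 := halias hx hhx hy hhy (fun w => φ w * K ω w) _ (hKi ω)
      (enorm_sq_mul_exactSymbol_le (fun w => hK ..))
    calc _ ≤ ∑' p : ℤ × ℤ,
          (2 * (‖∫ w in shiftBox hx hy 0, (φ w * S ω w - φ w * K ω w) * gridWave hx hy p w‖ₑ ^ 2
              * ENNReal.ofReal (hx * hy)) +
            2 * (‖∫ w in (shiftBox hx hy 0)ᶜ, (φ w * K ω w) * gridWave hx hy p w‖ₑ ^ 2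
              * ENNReal.ofReal (hx * hy))) := by
          refine ENNReal.tsum_le_tsum fun p => ?_
          rw [hVN, hu, ← mul_assoc, ← mul_assoc, ← add_mul]
          gcongr
          exact ofReal_sq_synth_sub_le (hSi ω) (hKi ω) p
      _ ≤ _ := by
          rw [ENNReal.tsum_add, ENNReal.tsum_mul_left, ENNReal.tsum_mul_left]
          gcongr 2 * ?_ + 2 * ?_
          · refine b1.trans_eq ?_
            refine lintegral_congr fun w => ?_
            simp only [Pi.sub_apply]
            rw [← mul_sub, enorm_mul, mul_pow]
  -- Tonelli reduces the expected error to the mean square multiplier error at each frequency. The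
  -- part with Gaussian decay is integrable against `|φ|²` over the plane, while the contraction
  -- part is integrated over the box only.
  have hswap : ∫⁻ ω, (∫⁻ w in shiftBox hx hy 0, ‖φ w‖ₑ ^ 2 * ‖S ω w - K ω w‖ₑ ^ 2) ∂P ≤
      ENNReal.ofReal (C₀ * E ^ 2) * G' + ENNReal.ofReal (2 * ((1 + 3 * κ) / 4) ^ N) * B := by
    have hm := hnoise.aemeasurable_mult_diff hT'.le r μx μy hx hy
      (μ := volume.restrict (shiftBox hx hy 0))
    have hφe : AEMeasurable (fun w => ‖φ w‖ₑ ^ 2) (volume.restrict (shiftBox hx hy 0)) :=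
      hφm.restrict.enorm.pow_const 2
    rw [lintegral_lintegral_swap ((hφe.comp_snd).mul (hm.enorm.pow_const 2))]
    calc ∫⁻ w in shiftBox hx hy 0, ∫⁻ ω, ‖φ w‖ₑ ^ 2 * ‖S ω w - K ω w‖ₑ ^ 2 ∂P
        ≤ ∫⁻ w in shiftBox hx hy 0, (ENNReal.ofReal (C₀ * E ^ 2) *
          (‖φ w‖ₑ ^ 2 * ENNReal.ofReal (Real.exp (-(c' * (w.1 ^ 2 + w.2 ^ 2))))) +
          ENNReal.ofReal (2 * ((1 + 3 * κ) / 4) ^ N) * ‖φ w‖ₑ ^ 2) := by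
          refine setLIntegral_mono' (measurableSet_shiftBox ..) fun w hw => ?_
          obtain ⟨hw1, hw2⟩ := abs_mul_le_pi_of_mem_shiftBox hhx hhy hw
          have := hmult Ω P N _ _ _ _ hnoise hx hy (2 * Real.pi * w.1) (2 * Real.pi * w.2)
            hN hhx hhy hw1 hw2
          rw [lintegral_const_mul' _ _ (by finiteness)]
          have e1 : ∫⁻ ω, ‖S ω w - K ω w‖ₑ ^ 2 ∂P ≤ ENNReal.ofReal (C₀ * E ^ 2) *
              ENNReal.ofReal (Real.exp (-(c' * (w.1 ^ 2 + w.2 ^ 2)))) +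
              ENNReal.ofReal (2 * ((1 + 3 * κ) / 4) ^ N) := by
            rw [← ENNReal.ofReal_mul (by positivity), ← ENNReal.ofReal_add (by positivity)
              (by positivity)]
            refine le_trans (le_of_eq ?_) (this.trans_eq ?_)
            · refine lintegral_congr fun ω => ?_
              rw [ENNReal.ofReal_pow (norm_nonneg _), ofReal_norm]
              rfl
            · congr 4
              rw [hc']
              ring
          calc _ ≤ ‖φ w‖ₑ ^ 2 * (ENNReal.ofReal (C₀ * E ^ 2) *
              ENNReal.ofReal (Real.exp (-(c' * (w.1 ^ 2 + w.2 ^ 2)))) +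
              ENNReal.ofReal (2 * ((1 + 3 * κ) / 4) ^ N)) := by gcongr
            _ = _ := by rw [mul_add, mul_left_comm, mul_comm (‖φ w‖ₑ ^ 2) (ENNReal.ofReal (2 * _))]
      _ = ENNReal.ofReal (C₀ * E ^ 2) * (∫⁻ w in shiftBox hx hy 0,
            ‖φ w‖ₑ ^ 2 * ENNReal.ofReal (Real.exp (-(c' * (w.1 ^ 2 + w.2 ^ 2))))) +
          ENNReal.ofReal (2 * ((1 + 3 * κ) / 4) ^ N) * B := by
          rw [lintegral_add_right' _ (hφe.const_mul _), lintegral_const_mul' _ _ (by finiteness),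
            lintegral_const_mul' _ _ (by finiteness)]
      _ ≤ _ := by
          gcongr
          exact setLIntegral_le_lintegral _ _
  have hsq : l2Error P hx hy (V N) u ^ 2 = ∑' p : ℤ × ℤ,
      (∫⁻ ω, ENNReal.ofReal (|V N ω p.1 p.2 - u ω (p.1 * hx) (p.2 * hy)| ^ 2) ∂P) *
        ENNReal.ofReal (hx * hy) := by
    rw [l2Error, ← ENNReal.rpow_two, ← ENNReal.rpow_mul]
    norm_num
  rw [hsq]
  calc _ = ∑' p : ℤ × ℤ, ∫⁻ ω, ENNReal.ofReal (|V N ω p.1 p.2 - u ω (p.1 * hx) (p.2 * hy)| ^ 2) *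
        ENNReal.ofReal (hx * hy) ∂P := by
        simp_rw [lintegral_mul_const' _ _ ENNReal.ofReal_ne_top]
    _ ≤ ∫⁻ ω, (2 * (∫⁻ w in shiftBox hx hy 0, ‖φ w‖ₑ ^ 2 * ‖S ω w - K ω w‖ₑ ^ 2) +
        2 * (ENNReal.ofReal (C₁ * (hx ^ 2 + hy ^ 2)) ^ 2 * G)) ∂P :=
        (tsum_lintegral_le _ _).trans (lintegral_mono hpt)
    _ = 2 * ∫⁻ ω, (∫⁻ w in shiftBox hx hy 0, ‖φ w‖ₑ ^ 2 * ‖S ω w - K ω w‖ₑ ^ 2) ∂P +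
        2 * (ENNReal.ofReal (C₁ * (hx ^ 2 + hy ^ 2)) ^ 2 * G) := by
        rw [lintegral_add_right _ measurable_const, lintegral_const_mul' _ _ (by finiteness)]
        simp
    _ ≤ 2 * (ENNReal.ofReal (C₀ * E ^ 2) * G' + ENNReal.ofReal (2 * ((1 + 3 * κ) / 4) ^ N) * B) +
        2 * (ENNReal.ofReal (C₁ * E) ^ 2 * G) := by
        gcongr
        rw [hE]
        have : 0 < (T : ℝ) / N := by positivity
        linarith
    _ = ENNReal.ofReal (2 * C₀ * G'.toReal * E ^ 2 + 2 * C₁ ^ 2 * G.toReal * E ^ 2) +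
        ENNReal.ofReal (4 * ((1 + 3 * κ) / 4) ^ N) * B := by
        rw [ENNReal.ofReal_add (by positivity) (by positivity),
          show 2 * C₀ * G'.toReal * E ^ 2 = 2 * (C₀ * E ^ 2 * G'.toReal) by ring,
          show 2 * C₁ ^ 2 * G.toReal * E ^ 2 = 2 * ((C₁ * E) ^ 2 * G.toReal) by ring,
          show 4 * ((1 + 3 * κ) / 4) ^ N = 2 * (2 * ((1 + 3 * κ) / 4) ^ N) by ring]
        simp only [ENNReal.ofReal_mul (show (0 : ℝ) ≤ 2 by norm_num)]
        rw [ENNReal.ofReal_mul (q := G'.toReal) (by positivity), ENNReal.ofReal_toReal hG't,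
          ENNReal.ofReal_mul (q := G.toReal) (by positivity), ENNReal.ofReal_toReal hGt,
          ENNReal.ofReal_pow (p := C₁ * E) (by positivity)]
        simp only [ENNReal.ofReal_ofNat]
        ring
    _ ≤ _ := by
        gcongr
        nlinarith [sq_nonneg E]

end Datum

/-! ### From the squared error to the two estimates. -/

lemma le_of_sq_le_ofReal {x : ℝ≥0∞} {a : ℝ} (ha : 0 ≤ a) (h : x ^ 2 ≤ ENNReal.ofReal (a ^ 2)) :
    x ≤ ENNReal.ofReal a := by
  rw [ENNReal.ofReal_pow ha] at h
  exact (ENNReal.pow_right_strictMono two_ne_zero).le_iff_le.mp h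

lemma rpow_neg_half_sq {h : ℝ} (hh : 0 < h) : (h ^ (-(1 / 2) : ℝ)) ^ 2 = 1 / h := by
  rw [← Real.rpow_natCast, ← Real.rpow_mul hh.le]
  norm_num [Real.rpow_neg_one]

lemma lintegral_wave_lt_top {x y c : ℝ} (hc : 0 < c) :
    ∫⁻ w, ‖wave x y w‖ₑ ^ 2 * ENNReal.ofReal (Real.exp (-(c * (w.1 ^ 2 + w.2 ^ 2)))) < ∞ := by
  simp only [enorm_wave, one_pow, one_mul]
  exact lintegral_exp_neg_mul_normSq_lt_top hc

lemma memLp_wave_shiftBox (x y hx hy : ℝ) :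
    MemLp (wave x y) 2 (volume.restrict (shiftBox hx hy 0)) :=
  MemLp.of_bound (continuous_wave x y).aestronglyMeasurable 1
    (Filter.Eventually.of_forall fun w => (norm_wave x y w).le)

lemma setLIntegral_wave_shiftBox (x y : ℝ) {hx hy : ℝ} (hhx : 0 < hx) :
    ∫⁻ w in shiftBox hx hy 0, ‖wave x y w‖ₑ ^ 2 = ENNReal.ofReal (1 / hx * (1 / hy)) := by
  simp only [enorm_wave, one_pow]
  rw [setLIntegral_one, shiftBox, volume_freqBox, ENNReal.ofReal_mul (by positivity)]

lemma exists_sq_mul_pow_le {θ : ℝ} (h0 : 0 ≤ θ) (h1 : θ < 1) :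
    ∃ C > 0, ∀ N : ℕ, (N : ℝ) ^ 2 * θ ^ N ≤ C := by
  have h := tendsto_pow_const_mul_const_pow_of_abs_lt_one 2
    (by rwa [abs_of_nonneg h0] : |θ| < 1)
  obtain ⟨C, hC⟩ := h.bddAbove_range
  exact ⟨max C 1, by positivity, fun N => (hC ⟨N, rfl⟩).trans (le_max_left _ _)⟩

variable {r : Corr} {κ : ℝ}

/-- The transform of the datum has modulus one, so the contraction part of the squared error is `4
((1 + 3κ)/4)^N` times the area `1/(hx hy)` of the box. Its square root is the last term of the
estimate. -/
theorem Corr.StableWith.exists_l2Error_dirac_le (hr : r.StableWith κ) (μx μy : ℝ) {T : ℝ≥0}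
    (hT : 0 < T) (x₀ y₀ : ℝ) : ∃ C : ℝ, 0 < C ∧
    ∀ (Ω : Type*) [MeasurableSpace Ω] (P : Measure Ω) [IsProbabilityMeasure P]
      (W₁ W₂ : ℝ≥0 → Ω → ℝ), IsBrownianPair W₁ W₂ P →
    ∀ (N : ℕ) (hx hy : ℝ), 1 ≤ N → 0 < hx → 0 < hy →
    ∀ i₀ j₀ : ℤ, x₀ = i₀ * hx → y₀ = j₀ * hy →
    ∀ V : ℕ → Ω → Grid,
      IsMilsteinScheme r μx μy T W₁ W₂ N hx hy (diracData hx hy i₀ j₀) V →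
      l2Error P hx hy (V N)
          (fun ω => diracSolution r μx μy T (W₁ T ω) (noiseY r W₁ W₂ T ω) x₀ y₀) ≤
        ENNReal.ofReal (C * (hx ^ 2 + hy ^ 2 + (T : ℝ) / N +
          √((1 + 3 * κ) / 4) ^ N * hx ^ (-(1 / 2) : ℝ) * hy ^ (-(1 / 2) : ℝ))) := by
  have hκ1 := hr.nonneg
  obtain ⟨C, hC, h⟩ := hr.exists_l2Error_sq_le (φ := wave (-x₀) (-y₀)) μx μy hT
    (continuous_wave _ _).aestronglyMeasurable (fun c hc => lintegral_wave_lt_top hc)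
    (fun hx hy _ _ => memLp_wave_shiftBox _ _ hx hy)
  -- From `C E² + 4 D² ≤ (√C E + 2 D)²`, where `D` is the contraction term and `E` the algebraic
  -- one.
  refine ⟨√C + 2, by positivity, ?_⟩
  intro Ω _ P _ W₁ W₂ hW N hx hy hN hhx hhy i₀ j₀ hi hj V hV
  have hE := h Ω P W₁ W₂ hW N hx hy hN hhx hhy _ V
    (by rw [diracData_eq_synth hhx hhy, ← hi, ← hj]) hV _
    (fun ω x y => diracSolution_eq_re (hr.ρx_le.trans_lt hr.lt_one)
      (hr.ρy_le.trans_lt hr.lt_one) μx μy hT _ _ x₀ y₀ x y)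
  rw [setLIntegral_wave_shiftBox _ _ hhx, ← ENNReal.ofReal_mul (by positivity),
    ← ENNReal.ofReal_add (by positivity) (by positivity)] at hE
  set E := hx ^ 2 + hy ^ 2 + (T : ℝ) / N
  have hE0 : 0 ≤ E := by positivity
  set D := √((1 + 3 * κ) / 4) ^ N * hx ^ (-(1 / 2) : ℝ) * hy ^ (-(1 / 2) : ℝ) with hD
  have hD0 : 0 ≤ D := by positivity
  have hD2 : D ^ 2 = ((1 + 3 * κ) / 4) ^ N * (1 / hx * (1 / hy)) := by
    rw [hD, mul_pow, mul_pow, rpow_neg_half_sq hhx, rpow_neg_half_sq hhy, ← pow_mul, mul_comm N,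
      pow_mul, Real.sq_sqrt (by positivity), mul_assoc]
  refine le_of_sq_le_ofReal (by positivity) (hE.trans (ENNReal.ofReal_le_ofReal ?_))
  rw [mul_assoc 4, ← hD2]
  have hs := Real.sq_sqrt hC.le
  have hs0 := Real.sqrt_nonneg C
  have : C * E ^ 2 + 4 * D ^ 2 ≤ (√C * E + 2 * D) ^ 2 := by
    have : 0 ≤ √C * E * D := by positivity
    nlinarith
  refine this.trans (pow_le_pow_left₀ (by positivity) ?_ 2)
  nlinarith [mul_nonneg hs0 hD0]

/-- By Plancherel the integral of `|φ|²` over the box is bounded independently of the mesh, and a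
geometric sequence is `O(N⁻²)`. The contraction part is thus absorbed in the square of the time
step. -/
theorem Corr.StableWith.exists_l2Error_l2_le (hr : r.StableWith κ) (μx μy : ℝ) {T : ℝ≥0}
    (hT : 0 < T) (v₀ : EuclideanSpace ℝ (Fin 2) → ℝ) (hv₀ : MemLp v₀ 2 volume) :
    ∃ C : ℝ, 0 < C ∧
    ∀ (Ω : Type*) [MeasurableSpace Ω] (P : Measure Ω) [IsProbabilityMeasure P]
      (W₁ W₂ : ℝ≥0 → Ω → ℝ), IsBrownianPair W₁ W₂ P →
    ∀ (N : ℕ) (hx hy : ℝ), 1 ≤ N → 0 < hx → 0 < hy →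
    ∀ V : ℕ → Ω → Grid,
      IsMilsteinScheme r μx μy T W₁ W₂ N hx hy (l2Data hx hy v₀ hv₀) V →
      l2Error P hx hy (V N)
          (fun ω => l2Solution r μx μy T (W₁ T ω) (noiseY r W₁ W₂ T ω) v₀) ≤
        ENNReal.ofReal (C * (hx ^ 2 + hy ^ 2 + (T : ℝ) / N)) := by
  have hκ1 := hr.nonneg
  have hκ2 := hr.lt_one
  have hT' : (0 : ℝ) < T := hT
  have hφ := memLp_plancherelData hv₀
  have hB : ∫⁻ w, ‖plancherelData hv₀ w‖ₑ ^ 2 ≠ ∞ := by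
    rw [lintegral_enorm_sq_eq]
    exact ENNReal.pow_ne_top hφ.2.ne
  set B := ∫⁻ w, ‖plancherelData hv₀ w‖ₑ ^ 2
  obtain ⟨C, hC, h⟩ := hr.exists_l2Error_sq_le (φ := plancherelData hv₀) μx μy hT hφ.1
    (fun c hc => lt_of_le_of_lt (lintegral_mono fun w => by
      refine mul_le_of_le_one_right zero_le ?_
      rw [← ENNReal.ofReal_one]
      refine ENNReal.ofReal_le_ofReal (Real.exp_le_one_iff.mpr ?_)
      rw [neg_nonpos]
      positivity) hB.lt_top)
    (fun hx hy _ _ => hφ.restrict _)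
  obtain ⟨C', hC', hN'⟩ := exists_sq_mul_pow_le (θ := (1 + 3 * κ) / 4) (by positivity) (by linarith)
  -- `T²` in the denominator comes from rewriting `N⁻²` as `(T/N)² / T²`.
  refine ⟨√(C + 4 * C' * B.toReal / T ^ 2), by positivity, ?_⟩
  intro Ω _ P _ W₁ W₂ hW N hx hy hN hhx hhy V hV
  have hE := h Ω P W₁ W₂ hW N hx hy hN hhx hhy _ V (l2Data_eq_synth hv₀ hhx hhy) hV _
    (fun ω x y => l2Solution_eq_re hv₀ (hr.ρx_le.trans_lt hr.lt_one)
      (hr.ρy_le.trans_lt hr.lt_one) μx μy hT _ _ x y)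
  refine le_of_sq_le_ofReal (by positivity) (hE.trans ?_)
  have hNpos : (0 : ℝ) < N := by exact_mod_cast hN
  calc _ ≤ ENNReal.ofReal (C * (hx ^ 2 + hy ^ 2 + (T : ℝ) / N) ^ 2) +
        ENNReal.ofReal (4 * ((1 + 3 * κ) / 4) ^ N) * ENNReal.ofReal B.toReal := by
        rw [ENNReal.ofReal_toReal hB]
        gcongr
        exact setLIntegral_le_lintegral _ _
    _ = ENNReal.ofReal (C * (hx ^ 2 + hy ^ 2 + (T : ℝ) / N) ^ 2 +
        4 * ((1 + 3 * κ) / 4) ^ N * B.toReal) := by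
        rw [← ENNReal.ofReal_mul (by positivity), ← ENNReal.ofReal_add (by positivity)
          (by positivity)]
    _ ≤ _ := by
        refine ENNReal.ofReal_le_ofReal ?_
        rw [mul_pow, Real.sq_sqrt (by positivity), add_mul]
        refine add_le_add le_rfl ?_
        have h1 : ((1 + 3 * κ) / 4) ^ N ≤ C' / N ^ 2 := by
          rw [le_div_iff₀ (by positivity), mul_comm]
          exact hN' N
        have h2 : ((T : ℝ) / N) ^ 2 ≤ (hx ^ 2 + hy ^ 2 + (T : ℝ) / N) ^ 2 := by
          gcongr
          nlinarith [sq_nonneg hx, sq_nonneg hy]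
        calc 4 * ((1 + 3 * κ) / 4) ^ N * B.toReal ≤ 4 * (C' / N ^ 2) * B.toReal := by gcongr
          _ = 4 * C' * B.toReal / T ^ 2 * ((T : ℝ) / N) ^ 2 := by field_simp
          _ ≤ _ := by gcongr

end ZakaiMilstein

end

open ZakaiMilstein in
theorem corollary2p4 (r : Corr) (hr : r.Stable) :
    -- Dirac initial data at a grid point
    (∃ θ : ℝ, 0 < θ ∧ θ < 1 ∧
      ∀ (μx μy : ℝ) (T : ℝ≥0), 0 < T → ∀ x₀ y₀ : ℝ, ∃ C : ℝ, 0 < C ∧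
        ∀ (Ω : Type*) [MeasurableSpace Ω] (P : Measure Ω) [IsProbabilityMeasure P]
          (W₁ W₂ : ℝ≥0 → Ω → ℝ), IsBrownianPair W₁ W₂ P →
        ∀ (N : ℕ) (hx hy : ℝ), 1 ≤ N → 0 < hx → 0 < hy →
        ∀ i₀ j₀ : ℤ, x₀ = i₀ * hx → y₀ = j₀ * hy →
        ∀ V : ℕ → Ω → Grid,
          IsMilsteinScheme r μx μy T W₁ W₂ N hx hy (diracData hx hy i₀ j₀) V →
          l2Error P hx hy (V N)
              (fun ω => diracSolution r μx μy T (W₁ T ω) (noiseY r W₁ W₂ T ω) x₀ y₀) ≤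
            ENNReal.ofReal (C * (hx ^ 2 + hy ^ 2 + (T : ℝ) / N +
              θ ^ N * hx ^ (-(1 / 2) : ℝ) * hy ^ (-(1 / 2) : ℝ)))) ∧
    -- initial data in `L²(ℝ²)`
    (∀ (μx μy : ℝ) (T : ℝ≥0), 0 < T →
      ∀ (v₀ : EuclideanSpace ℝ (Fin 2) → ℝ) (hv₀ : MemLp v₀ 2 volume),
      ∃ C : ℝ, 0 < C ∧
        ∀ (Ω : Type*) [MeasurableSpace Ω] (P : Measure Ω) [IsProbabilityMeasure P]
          (W₁ W₂ : ℝ≥0 → Ω → ℝ), IsBrownianPair W₁ W₂ P →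
        ∀ (N : ℕ) (hx hy : ℝ), 1 ≤ N → 0 < hx → 0 < hy →
        ∀ V : ℕ → Ω → Grid,
          IsMilsteinScheme r μx μy T W₁ W₂ N hx hy (l2Data hx hy v₀ hv₀) V →
          l2Error P hx hy (V N)
              (fun ω => l2Solution r μx μy T (W₁ T ω) (noiseY r W₁ W₂ T ω) v₀) ≤
            ENNReal.ofReal (C * (hx ^ 2 + hy ^ 2 + (T : ℝ) / N))) := by
  obtain ⟨κ, hκ⟩ := hr.exists_stableWith
  have h0 := hκ.nonneg
  have h1 := hκ.lt_one
  -- `κ` is chosen from the correlations alone, and so is `θ`; it is positive even for `κ = 0`.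
  refine ⟨⟨√((1 + 3 * κ) / 4), by positivity, ?_, ?_⟩, ?_⟩
  · rw [Real.sqrt_lt' one_pos]
    linarith
  · intro μx μy T hT x₀ y₀
    exact hκ.exists_l2Error_dirac_le μx μy hT x₀ y₀
  · intro μx μy T hT v₀ hv₀
    exact hκ.exists_l2Error_l2_le μx μy hT v₀ hv₀
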